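/- **Model.** Let $K\ge 0$ be the number of tiers and, for $1\le i\le K$, let $\lambda_i>0$, $\alpha_i>2$, $P_i>0$, $\phi_i>0$, $\hat T_i>0$, $\epsilon_i\in[0,1]$ and an integer $\Delta_i\ge 1$ be the base station (BS) density, path loss exponent, cell-center transmission power, ratio of cell-edge to cell-center power, coverage threshold, optimisation factor and frequency reuse factor of tier $i$. Let $\sigma^2\ge 0$ be the noise power, $\mu_z\in\mathbb R$, $\sigma_z>0$, and put $\lambda_i^{(c)}=\frac{\Delta_i-1}{\Delta_i}\lambda_i$, $\lambda_i^{(e)}=\frac1{\Delta_i}\lambda_i$. A channel power gain is Rayleigh–lognormal if it has the law of $10^{Z/10}E$ with $Z\sim N(\mu_z,\sigma_z^2)$ and $E\sim\mathrm{Exp}(1)$ independent. The typical user is at the origin of $\mathbb R^2$; the BSs of tier $i$ form independent homogeneous Poisson processes of density $\lambda_i$; $R_i$ is the distance from the user to the nearest BS of tier $i$; the user is connected to the tier $i$ with $R_i^{\alpha_i}\le R_j^{\alpha_j}$ for all $j$ (least path loss); $P_{Ai}$ is the probability of this event, and $$f_{R_i}(r)=\frac{2\pi\lambda_i}{P_{Ai}}\,r\exp\Big(-\pi\sum_{j=1}^K\lambda_j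 r^{2\alpha_i/\alpha_j}\Big),\qquad r>0 .$$ At serving distance $r$ the interferers are the points farther than $r$ from the user of Poisson processes $\theta_j^{(c)},\theta_j^{(e)}$ on $\mathbb R^2$ of densities $\lambda_j^{(c)},\lambda_j^{(e)}$ ($1\le j\le K$), the points carrying i.i.d. Rayleigh–lognormal gains $g_z$ and independent indicators $\tau_z\in\{0,1\}$ of mean $\epsilon_j$: $$I(r)=\sum_{j=1}^K\Big(\sum_{z\in\theta_j^{(c)},\,|z|>r}\tau_zP_jg_z|z|^{-\alpha_j}+\sum_{z\in\theta_j^{(e)},\,|z|>r}\tau_z\phi_jP_jg_z|z|^{-\alpha_j}\Big),\qquad SINR_i(\phi_i,r)=\frac{\phi_iP_ig_ir^{-\alpha_i}}{I(r)+\sigma^2},$$ with Rayleigh–lognormal serving gains $g_i$; the processes $\theta_j^{(c)},\theta_j^{(e)}$, the gains $g_i$ and the processes of BSs that determine the $R_i$ are all independent. Let $\mathbb P_i^{(e)}(\hat T_i,\phi_i|r)=\mathbb P(SINR_i(\phi_i,r)\ge\hat T_i)$ be the coverage probability of a cell-edge user served by tier $i$ at distance $r$, and let $P_c^{(e)}$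 be the average coverage probability of the typical cell-edge user, that is, the probability that for some $i$ the user is connected to tier $i$ and $SINR_i(\phi_i,R_i)\ge\hat T_i$. **Closed form.** Let $x_m,c_m$ ($1\le m\le N_L$) be the nodes and weights of the Gauss–Legendre rule of order $N_L$ on $[-1,1]$, and $a_n,\omega_n$ ($1\le n\le N_H$) those of the Gauss–Hermite rule of order $N_H$ (weight $e^{-x^2}$). Put $\gamma(a)=10^{(\sqrt2\sigma_za+\mu_z)/10}$ and, for $\psi>0$, $$C=C_{n,n_1}(\psi)=\hat T_i\frac{\gamma(a_{n_1})}{\gamma(a_n)}\frac{\psi P_j}{\phi_iP_i}r^{\alpha_i-\alpha_j},\qquad f_I(\psi)=f_I(\hat T_i,\phi_i,\psi,i,j)=\sum_{n_1=1}^{N_H}\frac{\omega_{n_1}}{\sqrt\pi}\Big[\frac{2\pi C^{2/\alpha_j}}{\alpha_j\sin\frac{\pi(\alpha_j-2)}{\alpha_j}}-\sum_{m=1}^{N_L}\frac{c_m}2\,\frac{C}{C+\big(\frac{x_m+1}2\big)^{\alpha_j/2}}\Big],$$ $$\widehat{\mathbb P}_i(r)=\sum_{n=1}^{N_H}\frac{\omega_n}{\sqrt\pi}\exp\Big[-\frac{\hat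 T_ir^{\alpha_i}}{\gamma(a_n)}\frac{\sigma^2}{\phi_iP_i}\Big]\exp\Big[-\pi r^2\sum_{j=1}^K\epsilon_j\big(\lambda_j^{(c)}f_I(1)+\lambda_j^{(e)}f_I(\phi_j)\big)\Big].$$ **Proposition.** For every $i$ one has $P_{Ai}>0$, and $f_{R_i}$ is the density of $R_i$ conditional on the user being connected to tier $i$. Moreover $$P_c^{(e)}=\sum_{i=1}^KP_{Ai}\int_0^\infty\mathbb P_i^{(e)}(\hat T_i,\phi_i|r)\,f_{R_i}(r)\,dr ,$$ where the integrals converge. Under $r=\frac t{1-t}$, $t=\frac{x+1}2$, Gauss–Legendre quadrature gives the approximation $$P_c^{(e)}\approx\sum_{i=1}^K\sum_{m=1}^{N_L}4\pi\lambda_i\frac{c_m(x_m+1)}{(1-x_m)^3}\exp\Big(-\pi\sum_{j=1}^K\lambda_j\Big(\frac{x_m+1}{1-x_m}\Big)^{2\alpha_i/\alpha_j}\Big)\,p_i\Big(\frac{x_m+1}{1-x_m}\Big),$$ both with $p_i(r)=\mathbb P_i^{(e)}(\hat T_i,\phi_i|r)$, in the sense that the right-hand side converges to $P_c^{(e)}$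 as $N_L\to\infty$, and with the closed form $p_i=\widehat{\mathbb P}_i$, in the sense that it converges to $P_c^{(e)}$ as $N_H,N_L\to\infty$ jointly. -/

import Mathlib

open MeasureTheory ProbabilityTheory Filter Topology
open scoped ENNReal NNReal

noncomputable section

/-! ### Gaussian quadrature rules -/

/-- The Legendre polynomial of degree `n` (Rodrigues' formula). -/
def legendrePoly (n : ℕ) : Polynomial ℝ :=
  Polynomial.C ((2 ^ n * (n.factorial : ℝ))⁻¹) *
    Polynomial.derivative^[n] ((Polynomial.X ^ 2 - 1) ^ n)

/-- The physicists' Hermite polynomial `H_n(x) = 2^{n/2} He_n(√2 x)`, orthogonal with respect to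
`exp (-x^2)`; `He_n` is Mathlib's `Polynomial.hermite n`. -/
def physHermite (n : ℕ) : Polynomial ℝ :=
  Polynomial.C (Real.sqrt 2 ^ n) *
    ((Polynomial.hermite n).map (Int.castRingHom ℝ)).comp
      (Polynomial.C (Real.sqrt 2) * Polynomial.X)

/-- The nodes `x_m` of the Gauss–Legendre rule of order `N`. -/
def glNodes (N : ℕ) : Finset ℝ := (legendrePoly N).roots.toFinset

/-- The weight `c_m` of the Gauss–Legendre rule of order `N` at the node `x`. -/
def glWeight (N : ℕ) (x : ℝ) : ℝ :=
  ∫ t in (-1 : ℝ)..1, (Lagrange.basis (glNodes N) id x).eval t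

/-- The nodes `a_n` of the Gauss–Hermite rule of order `N`. -/
def ghNodes (N : ℕ) : Finset ℝ := (physHermite N).roots.toFinset

/-- The weight `ω_n` of the Gauss–Hermite rule of order `N` at the node `a`. -/
def ghWeight (N : ℕ) (a : ℝ) : ℝ :=
  ∫ t : ℝ, (Lagrange.basis (ghNodes N) id a).eval t * Real.exp (-t ^ 2)

/-! ### Poisson point processes -/

/-- `N` is a Poisson point process with intensity measure `μ`, seen as a random measure: the numbers
of points in sets of finite intensity are Poisson distributed, and the numbers of points in
pairwise disjoint sets are independent. -/
structure IsPoissonProcess {Ω E : Type*} [MeasurableSpace Ω] [MeasurableSpace E]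
    (P : Measure Ω) (μ : Measure E) (N : Ω → Measure E) : Prop where
  measurable : Measurable N
  law : ∀ B : Set E, MeasurableSet B → μ B ≠ ∞ →
    P.map (fun ω => N ω B) =
      (poissonMeasure (μ B).toNNReal).map (fun k : ℕ => (k : ℝ≥0∞))
  indep : ∀ (n : ℕ) (B : Fin n → Set E), (∀ k, MeasurableSet (B k)) →
    Pairwise (fun k l => Disjoint (B k) (B l)) → iIndepFun (fun k ω => N ω (B k)) P

/-! ### The network -/

/-- The plane in which the base stations lie; the typical user is at the origin. -/
abbrev Plane : Type := EuclideanSpace ℝ (Fin 2)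

/-- The two kinds of cells, according to the use of the resource block under consideration. -/
inductive Zone : Type
  | center
  | edge

/-- Parameters of a `K`-tier network with soft frequency reuse. -/
structure NetworkParams (K : ℕ) where
  /-- density of base stations -/
  lam : Fin K → ℝ
  /-- path loss exponent -/
  alpha : Fin K → ℝ
  /-- transmission power on a cell-center resource block -/
  power : Fin K → ℝ
  /-- transmission power ratio of a cell-edge to a cell-center resource block -/
  phi : Fin K → ℝ
  /-- frequency reuse factor -/
  reuse : Fin K → ℕ
  /-- optimisation factor: the probability that an interfering cell uses the resource block -/
  eps : Fin K → ℝ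
  /-- coverage threshold -/
  thr : Fin K → ℝ
  /-- noise power `σ^2` -/
  noise : ℝ
  /-- mean of the lognormal shadowing, in dB -/
  muZ : ℝ
  /-- standard deviation of the lognormal shadowing, in dB -/
  sigmaZ : ℝ
  lam_pos : ∀ i, 0 < lam i
  two_lt_alpha : ∀ i, 2 < alpha i
  power_pos : ∀ i, 0 < power i
  phi_pos : ∀ i, 0 < phi i
  one_le_reuse : ∀ i, 1 ≤ reuse i
  eps_nonneg : ∀ i, 0 ≤ eps i
  eps_le_one : ∀ i, eps i ≤ 1
  thr_pos : ∀ i, 0 < thr i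
  noise_nonneg : 0 ≤ noise
  sigmaZ_pos : 0 < sigmaZ

namespace NetworkParams

variable {K : ℕ} (prm : NetworkParams K)

/-- Density of the cells of tier `j` in which the resource block is a cell-center block
(`(Δ_j - 1) / Δ_j * λ_j`) or a cell-edge block (`λ_j / Δ_j`). -/
def zoneLam (j : Fin K) : Zone → ℝ
  | .center => ((prm.reuse j : ℝ) - 1) / (prm.reuse j : ℝ) * prm.lam j
  | .edge => 1 / (prm.reuse j : ℝ) * prm.lam j

/-- Factor of the transmission power in a cell of tier `j`: `1` (center) or `φ_j` (edge). -/
def zoneRatio (j : Fin K) : Zone → ℝ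
  | .center => 1
  | .edge => prm.phi j

/-- Law of the power gain of a Rayleigh–lognormal channel: the product of a lognormal variable
`10^(Z/10)`, `Z` normal with mean `μ_z` and standard deviation `σ_z`, and an independent
exponential variable of mean `1`. -/
def gainLaw : Measure ℝ :=
  ((gaussianReal prm.muZ (prm.sigmaZ ^ 2).toNNReal).prod (expMeasure 1)).map
    (fun p : ℝ × ℝ => (10 : ℝ) ^ (p.1 / 10) * p.2)

/-- Law of the indicator that an interfering cell of tier `j` uses the resource block. -/
def activityLaw (j : Fin K) : Measure Bool :=
  ENNReal.ofReal (prm.eps j) • Measure.dirac true +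
    ENNReal.ofReal (1 - prm.eps j) • Measure.dirac false

/-- Intensity of the base stations of tier `j` of the given kind, marked independently with
their channel gains and their activity indicators. -/
def markedIntensity (j : Fin K) (z : Zone) : Measure (Plane × ℝ × Bool) :=
  (ENNReal.ofReal (prm.zoneLam j z) • (volume : Measure Plane)).prod
    (prm.gainLaw.prod (prm.activityLaw j))

end NetworkParams

/-- The random elements of the network model.
* `Φ j`: the base stations of tier `j`, from which the serving base station is selected;
* `Θ j z`: the marked base stations of tier `j` and kind `z` that make up the interfering field;
  given that the serving distance is `r`, those farther than `r` from the user interfere;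
* `G i`: the channel gain from the serving base station if it belongs to tier `i`. -/
structure IsNetwork {K : ℕ} (prm : NetworkParams K) {Ω : Type*} [MeasurableSpace Ω]
    (P : Measure Ω) (Φ : Fin K → Ω → Measure Plane)
    (Θ : Fin K → Zone → Ω → Measure (Plane × ℝ × Bool)) (G : Fin K → Ω → ℝ) : Prop where
  poisson_serving : ∀ j,
    IsPoissonProcess P (ENNReal.ofReal (prm.lam j) • (volume : Measure Plane)) (Φ j)
  poisson_interf : ∀ j z, IsPoissonProcess P (prm.markedIntensity j z) (Θ j z)
  measurable_gain : ∀ i, Measurable (G i)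
  law_gain : ∀ i, P.map (G i) = prm.gainLaw
  indep_serving : iIndepFun Φ P
  indep_interf : iIndepFun (fun (k : Fin K × Zone) => Θ k.1 k.2) P
  indep_gain : iIndepFun G P
  indep_interf_gain : IndepFun (fun ω j z => Θ j z ω) (fun ω i => G i ω) P
  indep_serving_rest : IndepFun (fun ω j => Φ j ω)
    (fun ω => ((fun j z => Θ j z ω : Fin K → Zone → Measure (Plane × ℝ × Bool)),
      (fun i => G i ω : Fin K → ℝ))) P

section Model

variable {K : ℕ} (prm : NetworkParams K) {Ω : Type*} [MeasurableSpace Ω] (P : Measure Ω)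
  (Φ : Fin K → Ω → Measure Plane) (Θ : Fin K → Zone → Ω → Measure (Plane × ℝ × Bool))
  (G : Fin K → Ω → ℝ)

/-- Distance `R_i` from the typical user to the nearest base station of tier `i`. -/
def nearestDist (i : Fin K) (ω : Ω) : ℝ :=
  sInf {r : ℝ | 0 ≤ r ∧ Φ i ω (Metric.closedBall 0 r) ≠ 0}

/-- The event that the typical user is connected to tier `i`: the path loss of the nearest base
station is least in tier `i`. -/
def assocEvent (i : Fin K) : Set Ω :=
  {ω | ∀ j, nearestDist Φ i ω ^ prm.alpha i ≤ nearestDist Φ j ω ^ prm.alpha j}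

/-- `P_{Ai}`: the probability that the typical user is connected to tier `i`. -/
def assocProb (i : Fin K) : ℝ := P.real (assocEvent prm Φ i)

/-- The intercell interference at the typical user when its serving distance is `r`. -/
def interference (r : ℝ) (ω : Ω) : ℝ≥0∞ :=
  ∑ j, (∫⁻ s in {s : Plane × ℝ × Bool | r < ‖s.1‖ ∧ s.2.2 = true},
      ENNReal.ofReal (prm.zoneRatio j .center * prm.power j * s.2.1 * ‖s.1‖ ^ (-prm.alpha j))
        ∂(Θ j .center ω)) +
  ∑ j, (∫⁻ s in {s : Plane × ℝ × Bool | r < ‖s.1‖ ∧ s.2.2 = true},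
      ENNReal.ofReal (prm.zoneRatio j .edge * prm.power j * s.2.1 * ‖s.1‖ ^ (-prm.alpha j))
        ∂(Θ j .edge ω))

/-- `SINR_i(φ_i, r)` of a cell-edge user served by tier `i` at distance `r`. -/
def sinr (i : Fin K) (r : ℝ) (ω : Ω) : ℝ≥0∞ :=
  ENNReal.ofReal (prm.phi i * prm.power i * G i ω * r ^ (-prm.alpha i)) /
    (interference prm Θ r ω + ENNReal.ofReal prm.noise)

/-- `P_i^{(e)}(T̂_i, φ_i | r)`: the coverage probability of a cell-edge user served by tier `i`
at distance `r`. -/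
def condCoverage (i : Fin K) (r : ℝ) : ℝ :=
  P.real {ω | ENNReal.ofReal (prm.thr i) ≤ sinr prm Θ G i r ω}

/-- `P_c^{(e)}`: the average coverage probability of the typical cell-edge user, i.e. the
probability that the SINR from the serving base station reaches the threshold of its tier. -/
def avgCoverage : ℝ :=
  P.real (⋃ i, {ω | ω ∈ assocEvent prm Φ i ∧
    ENNReal.ofReal (prm.thr i) ≤ sinr prm Θ G i (nearestDist Φ i ω) ω})

/-- The density `f_{R_i}` of the serving distance of a user connected to tier `i`. -/
def servingDensity (i : Fin K) (r : ℝ) : ℝ :=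
  2 * Real.pi * prm.lam i / assocProb prm P Φ i * r *
    Real.exp (-Real.pi * ∑ j, prm.lam j * r ^ (2 * prm.alpha i / prm.alpha j))

end Model

/-! ### The closed-form expressions -/

namespace NetworkParams

variable {K : ℕ} (prm : NetworkParams K)

/-- `γ(a) = 10^((√2 σ_z a + μ_z) / 10)`. -/
def gam (a : ℝ) : ℝ := (10 : ℝ) ^ ((Real.sqrt 2 * prm.sigmaZ * a + prm.muZ) / 10)

/-- `1 / (φ_i SNR_i)` with `SNR_i = P_i / σ^2`, written so as to make sense for `σ^2 = 0`. -/
def invEdgeSnr (i : Fin K) : ℝ := prm.noise / (prm.phi i * prm.power i)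

/-- The quantity `C`, with interfering power ratio `ψ`, at serving distance `r`. -/
def cFactor (i j : Fin K) (ψ a a₁ r : ℝ) : ℝ :=
  prm.thr i * (prm.gam a₁ / prm.gam a) * (ψ * prm.power j / (prm.phi i * prm.power i)) *
    r ^ (prm.alpha i - prm.alpha j)

/-- The function `f_I(T̂_i, φ_i, ψ, i, j)`, with quadrature orders `NH` and `NL`; it depends on
the node `a` of the outer sum and on the serving distance `r`. -/
def fI (NH NL : ℕ) (i j : Fin K) (ψ a r : ℝ) : ℝ :=
  ∑ a₁ ∈ ghNodes NH, ghWeight NH a₁ / Real.sqrt Real.pi *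
    (2 * Real.pi * prm.cFactor i j ψ a a₁ r ^ (2 / prm.alpha j) /
        (prm.alpha j * Real.sin (Real.pi * (prm.alpha j - 2) / prm.alpha j)) -
      ∑ x ∈ glNodes NL, glWeight NL x / 2 *
        (prm.cFactor i j ψ a a₁ r /
          (prm.cFactor i j ψ a a₁ r + ((x + 1) / 2) ^ (prm.alpha j / 2))))

/-- The closed-form expression for `P_i^{(e)}(T̂_i, φ_i | r)`. -/
def condCoverageClosed (NH NL : ℕ) (i : Fin K) (r : ℝ) : ℝ :=
  ∑ a ∈ ghNodes NH, ghWeight NH a / Real.sqrt Real.pi *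
    Real.exp (-(prm.thr i * r ^ prm.alpha i / prm.gam a * prm.invEdgeSnr i)) *
    Real.exp (-Real.pi * r ^ 2 * ∑ j, prm.eps j *
      (prm.zoneLam j .center * prm.fI NH NL i j 1 a r +
        prm.zoneLam j .edge * prm.fI NH NL i j (prm.phi j) a r))

/-- The Gauss–Legendre sum of order `NL` for the average over the serving distance of conditional
coverage probabilities `p i r`, after the substitution `r = t / (1 - t)`, `t = (x + 1) / 2`. -/
def averageSum (NL : ℕ) (p : Fin K → ℝ → ℝ) : ℝ :=
  ∑ i, ∑ x ∈ glNodes NL, 4 * Real.pi * prm.lam i *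
    (glWeight NL x * (x + 1) / (1 - x) ^ 3) *
    Real.exp (-Real.pi * ∑ j, prm.lam j *
      ((x + 1) / (1 - x)) ^ (2 * prm.alpha i / prm.alpha j)) *
    p i ((x + 1) / (1 - x))

end NetworkParams

end

/-! Probability. On the event that tier `i` has least path loss, the law of `R_i` is its own density
times the void probabilities `exp (-π λ_j r^(2 α_i / α_j))` of the other tiers, by independence
(`map_restrict_leastPathLoss`). Ties have probability zero, and the interferers and gains are
independent of the serving processes, so the average coverage is the sum over `i` of the integral of
the conditional coverage against this unnormalised density (`IsNetwork.avgCoverage_eq`).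

For fixed shadowing `a` of the serving channel, coverage at distance `r` means that an exponential
variable exceeds `s (I + σ²)`, with `s` linear in the threshold. Its probability is therefore the
Laplace transform of `I + σ²` at `s`. The Laplace functional of a Poisson process
(`IsPoissonProcess.integral_negExp_lintegral`) and radial integration reduce the exponent to
Gaussian averages of `tailInt β C`, the integral of `C / (C + u^β)` over `(1, ∞)` with `β = α_j / 2`
(`lintegral_laplace_exponent`). The conditional coverage is then a Gaussian average of
`coverageTerm` (`IsNetwork.condCoverage_eq`).

Analysis. The bracket in `f_I` is an approximate tail integral: the integral over `(0, ∞)` is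
explicit by the reflection formula, and the part over `(0, 1]` is replaced by its Gauss–Legendre
sum. Three quadratures are thus nested, and all their orders grow together. Each layer is handled by
`IsQuadratureSeq.tendsto_sum`, which admits integrands varying with the order, provided that they
converge continuously and obey one common exponential bound. For the Hermite rule this needs
exponential moments bounded in the order: a symmetric Gauss rule underestimates even moments, hence
also the integral of `cosh` (`sum_ghWeight_cosh_le`).

The outer integral runs over unbounded `r`, where the closed form at finite orders is not known to
be at most 1. The remedy is a one-sided error bound, uniform in all parameters: eventually `f_I ≥
-δ` (`eventually_neg_le_fI`). The closed form is then at most `exp (π δ (∑ λ_j) r²)`, which the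
Gaussian decay of the serving density absorbs for small `δ`. After the substitution the integrand is
`O(1 - x²)`, so its extension by zero has no singularity at `±1`, and the limit theorem applies. -/

open MeasureTheory ProbabilityTheory Filter Topology
open scoped ENNReal NNReal

/-! ### Gaussian quadrature for a positive functional on polynomials -/

section GaussQuadrature

open Polynomial

/-- `P` is a polynomial of degree `N` which is orthogonal to all polynomials of smaller degree with
respect to the functional `L`, where `L` is positive definite on the set `I`. -/
structure IsGaussPoly (L : ℝ[X] →ₗ[ℝ] ℝ) (I : Set ℝ) (N : ℕ) (P : ℝ[X]) : Prop where
  preconn : IsPreconnected I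
  pos : ∀ p : ℝ[X], p ≠ 0 → (∀ x ∈ I, 0 ≤ p.eval x) → 0 < L p
  ne_zero : P ≠ 0
  natDegree_eq : P.natDegree = N
  orth : ∀ q : ℝ[X], q.degree < N → L (P * q) = 0

namespace IsGaussPoly

variable {L : ℝ[X] →ₗ[ℝ] ℝ} {I : Set ℝ} {N : ℕ} {P : ℝ[X]}

lemma degree_eq (h : IsGaussPoly L I N P) : P.degree = N := by
  rw [degree_eq_natDegree h.ne_zero, h.natDegree_eq]

/-- Without a zero on the connected set `I`, the factor `m` would have constant sign there. Then `m
q²` or its negative is nonnegative on `I`, while `L (P q) = 0` because `q` has degree below `N`.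
Linear `m` locates the roots of `P` in `I`; the root-free cofactor as `m` shows that `P` splits. -/
lemma exists_root_of_factor (h : IsGaussPoly L I N P) {m q : ℝ[X]} (hP : P = m * q)
    (hm : 0 < m.natDegree) : ∃ x ∈ I, m.eval x = 0 := by
  by_contra! hne
  have hm0 : m ≠ 0 := by rintro rfl; simp at hm
  have hq0 : q ≠ 0 := by rintro rfl; exact h.ne_zero (by simp [hP])
  have hdeg : q.degree < N := by
    rw [degree_eq_natDegree hq0, ← h.natDegree_eq, hP, natDegree_mul hm0 hq0]
    exact_mod_cast by omega
  have horth := h.orth q hdeg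
  have hsign : (∀ x ∈ I, 0 ≤ m.eval x) ∨ (∀ x ∈ I, 0 ≤ -m.eval x) := by
    by_contra! hc
    obtain ⟨⟨x, hx, hx'⟩, y, hy, hy'⟩ := hc
    obtain ⟨z, hz, hz0⟩ := h.preconn.intermediate_value hx hy
      (f := fun t => m.eval t) m.continuous.continuousOn (show (0 : ℝ) ∈ _ from ⟨hx'.le, by linarith⟩)
    exact hne z hz hz0
  rcases hsign with hs | hs
  · have := h.pos (m * q * q) (by simp [hm0, hq0]) (fun x hx => by
      simp only [eval_mul, mul_assoc]
      exact mul_nonneg (hs x hx) (mul_self_nonneg _))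
    rw [hP] at horth
    linarith
  · have := h.pos (-(m * q * q)) (by simp [hm0, hq0]) (fun x hx => by
      simp only [eval_mul, mul_assoc, eval_neg, ← neg_mul]
      exact mul_nonneg (hs x hx) (mul_self_nonneg _))
    rw [hP] at horth
    rw [map_neg] at this
    linarith

lemma mem_of_isRoot (h : IsGaussPoly L I N P) {a : ℝ} (ha : a ∈ P.roots.toFinset) : a ∈ I := by
  rw [Multiset.mem_toFinset, mem_roots h.ne_zero] at ha
  obtain ⟨q, hq⟩ := dvd_iff_isRoot.2 ha
  obtain ⟨x, hx, hx0⟩ := h.exists_root_of_factor hq (by simp)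
  simp only [eval_sub, eval_X, eval_C, sub_eq_zero] at hx0
  exact hx0 ▸ hx

/-- From `P = (X - a)² q` the product `P q` would be a square, although `q` has degree below `N` and
so is orthogonal to `P`. -/
lemma nodup_roots (h : IsGaussPoly L I N P) : P.roots.Nodup := by
  rw [Multiset.nodup_iff_count_le_one]
  intro a
  by_contra! hc
  rw [count_roots] at hc
  obtain ⟨q, hq⟩ := (le_rootMultiplicity_iff h.ne_zero).1 hc
  have hq0 : q ≠ 0 := by rintro rfl; exact h.ne_zero (by simp [hq])
  have hX : (X - C a : ℝ[X]) ≠ 0 := X_sub_C_ne_zero a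
  have hdeg : q.degree < N := by
    rw [degree_eq_natDegree hq0, ← h.natDegree_eq, hq, natDegree_mul (pow_ne_zero _ hX) hq0,
      natDegree_pow, natDegree_X_sub_C]
    exact_mod_cast by omega
  have := h.pos (P * q) (mul_ne_zero h.ne_zero hq0) (fun x _ => by
    rw [hq]
    simp only [eval_mul, eval_pow]
    rw [mul_assoc]
    exact mul_nonneg (sq_nonneg _) (mul_self_nonneg _))
  linarith [h.orth q hdeg]

lemma card_roots (h : IsGaussPoly L I N P) : P.roots.card = N := by
  obtain ⟨q, hq, hcard, hroots⟩ := exists_prod_multiset_X_sub_C_mul P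
  have hq0 : q ≠ 0 := by rintro rfl; exact h.ne_zero (by rw [← hq, mul_zero])
  rcases Nat.eq_zero_or_pos q.natDegree with h0 | h0
  · rw [← h.natDegree_eq]; omega
  · obtain ⟨x, -, hx⟩ := h.exists_root_of_factor (by rw [← hq, mul_comm]) h0
    have : x ∈ q.roots := (mem_roots hq0).2 hx
    simp [hroots] at this

lemma card_nodes (h : IsGaussPoly L I N P) : P.roots.toFinset.card = N := by
  rw [Multiset.toFinset_card_of_nodup h.nodup_roots, h.card_roots]

/-- A polynomial of degree below the number of nodes is its own Lagrange interpolant; apply `L` to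
the interpolation formula. -/
lemma sum_weight_of_degree_lt (h : IsGaussPoly L I N P) {p : ℝ[X]} (hp : p.degree < N) :
    ∑ x ∈ P.roots.toFinset, L (Lagrange.basis P.roots.toFinset id x) * p.eval x = L p := by
  have := Lagrange.eq_interpolate (s := P.roots.toFinset) (v := id) (f := p)
    Function.injective_id.injOn (by rwa [h.card_nodes])
  conv_rhs => rw [this]
  rw [Lagrange.interpolate_apply, map_sum]
  refine Finset.sum_congr rfl fun x _ => ?_
  rw [← smul_eq_C_mul, map_smul, smul_eq_mul, mul_comm, id]

/-- The Gauss rule with `N` nodes is exact for polynomials of degree less than `2 * N`. -/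
lemma sum_weight (h : IsGaussPoly L I N P) {p : ℝ[X]} (hp : p.degree < (2 * N : ℕ)) :
    ∑ x ∈ P.roots.toFinset, L (Lagrange.basis P.roots.toFinset id x) * p.eval x = L p := by
  have hdm : P * (p / P) + p % P = p := EuclideanDomain.div_add_mod p P
  have hmod : (p % P).degree < N := h.degree_eq ▸ degree_mod_lt p h.ne_zero
  have hdiv : (p / P).degree < N := by
    by_cases hlt : p.degree < P.degree
    · rw [(Polynomial.div_eq_zero_iff h.ne_zero).2 hlt, degree_zero]
      exact WithBot.bot_lt_coe _
    · have h1 := degree_add_div h.ne_zero (not_lt.1 hlt)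
      have hq0 : p / P ≠ 0 := fun h0 => hlt ((Polynomial.div_eq_zero_iff h.ne_zero).1 h0)
      rw [← h1, h.degree_eq, degree_eq_natDegree hq0] at hp
      rw [degree_eq_natDegree hq0]
      norm_cast at hp ⊢
      omega
  -- Orthogonality removes the multiple of `P` from `L p`, and the nodes, being roots of `P`, see
  -- only the remainder.
  rw [← hdm, map_add, h.orth _ hdiv, zero_add, ← h.sum_weight_of_degree_lt hmod]
  refine Finset.sum_congr rfl fun x hx => ?_
  have hx0 : P.eval x = 0 := by
    rw [Multiset.mem_toFinset, mem_roots h.ne_zero] at hx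
    exact hx
  simp [hx0]

/-- The squared Lagrange basis polynomial has degree `2N - 2`, so the rule is exact for it; its
quadrature sum is the single weight at `a`, and `L` is positive on squares. -/
lemma weight_pos (h : IsGaussPoly L I N P) {a : ℝ} (ha : a ∈ P.roots.toFinset) :
    0 < L (Lagrange.basis P.roots.toFinset id a) := by
  set s := P.roots.toFinset
  have hinj : Set.InjOn (id : ℝ → ℝ) s := Function.injective_id.injOn
  have hb0 : Lagrange.basis s id a ≠ 0 := Lagrange.basis_ne_zero hinj ha
  have hcard : s.card = N := h.card_nodes
  have hN : 0 < N := hcard ▸ Finset.card_pos.2 ⟨a, ha⟩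
  have hdeg : (Lagrange.basis s id a ^ 2).degree < (2 * N : ℕ) := by
    rw [degree_pow, Lagrange.degree_basis hinj ha, hcard]
    rw [nsmul_eq_mul]
    norm_cast
    omega
  have h1 := h.sum_weight hdeg
  rw [Finset.sum_eq_single_of_mem a ha] at h1
  · have h2 := Lagrange.eval_basis_self hinj ha
    rw [id] at h2
    rw [eval_pow, h2] at h1
    rw [show L (Lagrange.basis s id a) = L (Lagrange.basis s id a ^ 2) by simpa using h1]
    exact h.pos _ (pow_ne_zero _ hb0) fun x _ => by rw [eval_pow]; positivity
  · intro b hb hba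
    have h2 := Lagrange.eval_basis_of_ne (v := id) hba.symm hb
    rw [id] at h2
    rw [eval_pow, h2]; simp

end IsGaussPoly

/-- Division of a polynomial with nonnegative coefficients by a linear factor with nonnegative
root. -/
lemma exists_nonneg_div_X_sub_C {a : ℝ} (ha : 0 ≤ a) (p : ℝ[X]) (hp : ∀ n, 0 ≤ p.coeff n) :
    ∃ q : ℝ[X], ∃ b : ℝ, (∀ n, 0 ≤ q.coeff n) ∧ 0 ≤ b ∧ p = (X - C a) * q + C b := by
  induction hd : p.natDegree using Nat.strong_induction_on generalizing p with
  | _ d ih =>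
    by_cases h0 : d = 0
    · refine ⟨0, p.coeff 0, by simp, hp 0, ?_⟩
      rw [mul_zero, zero_add]
      exact eq_C_of_natDegree_eq_zero (hd.trans h0)
    · obtain ⟨q, b, hq, hb, heq⟩ := ih p.divX.natDegree
        (by rw [natDegree_divX_eq_natDegree_tsub_one]; omega) p.divX
        (fun n => by rw [coeff_divX]; exact hp _) rfl
      refine ⟨X * q + C b, p.coeff 0 + a * b, fun n => ?_,
        add_nonneg (hp 0) (mul_nonneg ha hb), ?_⟩
      · rw [coeff_add]
        refine add_nonneg ?_ ?_
        · cases n with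
          | zero => simp
          | succ n => rw [coeff_X_mul]; exact hq n
        · rw [coeff_C]; split_ifs <;> simp [hb]
      · conv_lhs => rw [← X_mul_divX_add p, heq]
        simp only [C_add, C_mul]
        ring

/-- Linear factors are divided out one at a time: the quotient keeps nonnegative coefficients, and
the constant remainders accumulate in `r` as in Newton interpolation. -/
lemma exists_nonneg_div_prod {ι : Type*} (s : Finset ι) (f : ι → ℝ) (hf : ∀ i, 0 ≤ f i)
    (p : ℝ[X]) (hp : ∀ n, 0 ≤ p.coeff n) :
    ∃ q r : ℝ[X], (∀ n, 0 ≤ q.coeff n) ∧ r.degree < s.card ∧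
      p = (∏ i ∈ s, (X - C (f i))) * q + r := by
  classical
  induction s using Finset.induction_on with
  | empty => exact ⟨p, 0, hp, by simp, by simp⟩
  | insert i s hi ih =>
    obtain ⟨q, r, hq, hr, heq⟩ := ih
    obtain ⟨q', b, hq', hb, heq'⟩ := exists_nonneg_div_X_sub_C (hf i) q hq
    refine ⟨q', (∏ i ∈ s, (X - C (f i))) * C b + r, hq', ?_, ?_⟩
    · rw [Finset.card_insert_of_notMem hi]
      have hlt : (s.card : WithBot ℕ) < ((s.card + 1 : ℕ) : WithBot ℕ) := by
        exact_mod_cast Nat.lt_succ_self _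
      refine (degree_add_le _ _).trans_lt (max_lt ?_ (hr.trans hlt))
      refine lt_of_le_of_lt (degree_mul_le _ _) (lt_of_le_of_lt ?_ hlt)
      rw [degree_prod]
      calc _ ≤ (∑ i ∈ s, (1 : WithBot ℕ)) + 0 := by
            gcongr
            · exact (degree_X_sub_C _).le
            · exact degree_C_le
        _ = s.card := by simp
    · rw [Finset.prod_insert hi, heq, heq']
      ring

/-- The Gauss rule with a symmetric set of nodes underestimates the even moments. -/
lemma IsGaussPoly.sum_weight_even_pow_le {L : ℝ[X] →ₗ[ℝ] ℝ} {I : Set ℝ} {N : ℕ} {P : ℝ[X]}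
    (h : IsGaussPoly L I N P) (hsymm : ∀ x ∈ P.roots.toFinset, -x ∈ P.roots.toFinset) (k : ℕ) :
    ∑ x ∈ P.roots.toFinset, L (Lagrange.basis P.roots.toFinset id x) * x ^ (2 * k) ≤
      L (X ^ (2 * k)) := by
  set s := P.roots.toFinset
  have hcard : s.card = N := h.card_nodes
  -- Divide `y^k` by the product of the `y - x²` over the nodes and put `y = X²`. By symmetry of the
  -- nodes the divisor becomes the square `E²` of the nodal polynomial, so the error term `E² q(X²)`
  -- is nonnegative, while `r(X²)` has degree below `2N` and is integrated exactly.
  obtain ⟨q, r, hq, hr, heq⟩ := exists_nonneg_div_prod s (fun x => x ^ 2)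
    (fun x => sq_nonneg x) (X ^ k) (fun n => by rw [coeff_X_pow]; split_ifs <;> simp)
  set E : ℝ[X] := ∏ x ∈ s, (X - C x)
  have hE : (∏ x ∈ s, (X - C (x ^ 2))).comp (X ^ 2) = E ^ 2 := by
    have hneg : E = ∏ x ∈ s, (X + C x) := by
      refine Finset.prod_bij' (fun x _ => -x) (fun x _ => -x) hsymm hsymm
        (fun x _ => neg_neg x) (fun x _ => neg_neg x) fun x _ => ?_
      rw [C_neg, sub_eq_add_neg]
    rw [sq E]
    nth_rewrite 2 [hneg]
    rw [← Finset.prod_mul_distrib, prod_comp]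
    refine Finset.prod_congr rfl fun x _ => ?_
    simp only [C_pow, sub_comp, X_comp, pow_comp, C_comp]
    ring
  have hX : (X : ℝ[X]) ^ (2 * k) = E ^ 2 * q.comp (X ^ 2) + r.comp (X ^ 2) := by
    rw [← hE, ← mul_comp, ← add_comp, ← heq, X_pow_comp, pow_mul]
  have hr' : (r.comp (X ^ 2)).degree < (2 * N : ℕ) := by
    by_cases hr0 : r = 0
    · rw [hr0, zero_comp, degree_zero]
      exact WithBot.bot_lt_coe _
    refine degree_le_natDegree.trans_lt (Nat.cast_lt.2 ?_)
    rw [natDegree_comp, natDegree_X_pow]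
    rw [degree_eq_natDegree hr0, hcard] at hr
    norm_cast at hr
    omega
  have hpos : 0 ≤ L (E ^ 2 * q.comp (X ^ 2)) := by
    by_cases h0 : E ^ 2 * q.comp (X ^ 2) = 0
    · simp [h0]
    · refine (h.pos _ h0 fun x _ => ?_).le
      rw [eval_mul, eval_pow, eval_comp, eval_pow, eval_X]
      refine mul_nonneg (sq_nonneg _) ?_
      rw [eval_eq_sum]
      exact Finset.sum_nonneg fun n _ => mul_nonneg (hq n) (by positivity)
  calc _ = ∑ x ∈ s, L (Lagrange.basis s id x) * (r.comp (X ^ 2)).eval x := by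
        refine Finset.sum_congr rfl fun x hx => ?_
        have := congrArg (eval x) hX
        rw [eval_add, eval_mul, eval_pow, eval_pow, eval_X, eval_prod,
          Finset.prod_eq_zero hx (by simp)] at this
        rw [this]; simp
    _ = L (r.comp (X ^ 2)) := h.sum_weight hr'
    _ ≤ L (X ^ (2 * k)) := by rw [hX, map_add]; linarith

end GaussQuadrature

/-! ### Positive definiteness of integration against an atomless measure -/

section PolyIntegral

open Polynomial

/-- Integration of polynomials against a measure with finite moments. -/
noncomputable def polyIntegral (μ : Measure ℝ) (h : ∀ p : ℝ[X], Integrable (fun x => p.eval x) μ) :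
    ℝ[X] →ₗ[ℝ] ℝ where
  toFun p := ∫ x, p.eval x ∂μ
  map_add' p q := by
    simp only [eval_add]
    exact integral_add (h p) (h q)
  map_smul' c p := by
    simp only [eval_smul, smul_eq_mul, RingHom.id_apply]
    exact integral_const_mul _ _

/-- A nonnegative integrand with zero integral vanishes almost everywhere, but a nonzero polynomial
vanishes only on a finite set, which is null for an atomless measure. -/
lemma polyIntegral_pos {μ : Measure ℝ} [NullSingletonClass μ] [NeZero μ]
    (h : ∀ p : ℝ[X], Integrable (fun x => p.eval x) μ) {I : Set ℝ} (hI : ∀ᵐ x ∂μ, x ∈ I)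
    {p : ℝ[X]} (hp : p ≠ 0) (hnn : ∀ x ∈ I, 0 ≤ p.eval x) : 0 < polyIntegral μ h p := by
  have hae : 0 ≤ᵐ[μ] fun x => p.eval x := by
    filter_upwards [hI] with x hx using hnn x hx
  refine (integral_nonneg_of_ae hae).lt_of_ne' fun h0 => ?_
  have h0' := (integral_eq_zero_iff_of_nonneg_ae hae (h p)).1 h0
  have hfin : ∀ᵐ x ∂μ, x ∉ (p.roots.toFinset : Set ℝ) := by
    rw [← measure_eq_zero_iff_ae_notMem]
    exact p.roots.toFinset.countable_toSet.measure_zero μ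
  have : ∀ᵐ x ∂μ, False := by
    filter_upwards [h0', hfin] with x hx hx'
    exact hx' (by simpa [hp] using hx)
  rw [ae_iff] at this
  simp only [not_false_eq_true, Set.ofPred_true, Measure.measure_univ_eq_zero] at this
  exact NeZero.ne μ this

lemma integrable_eval_of_integrable_pow {μ : Measure ℝ} (h : ∀ n : ℕ, Integrable (fun x => x ^ n) μ)
    (p : ℝ[X]) : Integrable (fun x => p.eval x) μ := by
  simp only [eval_eq_sum_range]
  exact integrable_finsetSum _ fun n _ => (h n).const_mul _

end PolyIntegral

/-! ### The Gauss–Legendre rule -/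

section Legendre

open Polynomial

/-- The uniform distribution on `[-1, 1]`. -/
noncomputable def legendreMeasure : Measure ℝ := (2⁻¹ : ℝ≥0∞) • volume.restrict (Set.Ioc (-1) 1)

lemma integral_legendreMeasure (f : ℝ → ℝ) :
    ∫ x, f x ∂legendreMeasure = (∫ x in (-1 : ℝ)..1, f x) / 2 := by
  rw [legendreMeasure, integral_smul_measure, intervalIntegral.integral_of_le (by norm_num)]
  simp [div_eq_inv_mul]

instance : IsProbabilityMeasure legendreMeasure where
  measure_univ := by
    rw [legendreMeasure]
    simp only [Measure.smul_apply, MeasurableSet.univ, Measure.restrict_apply, Set.univ_inter,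
      Real.volume_Ioc, smul_eq_mul]
    norm_num
    exact ENNReal.inv_mul_cancel (by norm_num) (by norm_num)

instance : NullSingletonClass legendreMeasure where
  measure_singleton x := by simp [legendreMeasure]

lemma ae_mem_legendreMeasure : ∀ᵐ x ∂legendreMeasure, x ∈ Set.Ioo (-1 : ℝ) 1 := by
  refine Measure.ae_smul_measure ?_ _
  rw [← restrict_Ioo_eq_restrict_Ioc]
  exact ae_restrict_mem measurableSet_Ioo

lemma integrable_legendreMeasure {f : ℝ → ℝ} (hf : ContinuousOn f (Set.Icc (-1) 1)) :
    Integrable f legendreMeasure :=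
  ((hf.integrableOn_Icc).mono_set Set.Ioc_subset_Icc_self).smul_measure (by norm_num)

lemma eval_iterate_derivative_eq_zero {a : ℝ} {n k : ℕ} (hk : k < n) (q : ℝ[X])
    (hq : (X - C a) ^ n ∣ q) : (derivative^[k] q).eval a = 0 := by
  have h1 : (X - C a) ^ (n - k) ∣ derivative^[k] q := by
    obtain ⟨r, rfl⟩ := hq
    exact pow_sub_dvd_iterate_derivative_of_pow_dvd k (Dvd.intro r rfl)
  have h2 : (X - C a) ∣ derivative^[k] q := (dvd_pow_self _ (by omega)).trans h1
  exact dvd_iff_isRoot.1 h2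

/-- Integration by parts moves derivatives onto `q` until nothing is left. The boundary terms vanish
since `(X² - 1)^n` has zeros of order `n` at `±1` and fewer than `n` derivatives have been taken.
Keeping `n` fixed and letting `k` vary is what makes the induction run. -/
lemma integral_iterate_derivative_mul_eq_zero (n k : ℕ) (hk : k ≤ n) (q : ℝ[X])
    (hq : q.degree < k) :
    ∫ x in (-1 : ℝ)..1, (derivative^[k] ((X ^ 2 - 1 : ℝ[X]) ^ n) * q).eval x = 0 := by
  induction k generalizing q with
  | zero =>
    have : q = 0 := by
      rw [← degree_eq_bot]
      exact Nat.WithBot.lt_zero_iff.1 (by exact_mod_cast hq)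
    simp [this]
  | succ k ih =>
    set W : ℝ[X] := (X ^ 2 - 1) ^ n
    have hW : W = (X - C 1) ^ n * (X - C (-1)) ^ n := by
      rw [← mul_pow]; simp only [C_neg, C_1]; ring
    have e1 := eval_iterate_derivative_eq_zero (show k < n by omega) W
      (a := 1) (hW ▸ Dvd.intro _ rfl)
    have e2 := eval_iterate_derivative_eq_zero (show k < n by omega) W
      (a := -1) (hW ▸ Dvd.intro_left _ rfl)
    have hparts : ∫ x in (-1 : ℝ)..1, (derivative (derivative^[k] W * q)).eval x = 0 := by
      rw [intervalIntegral.integral_eq_sub_of_hasDerivAt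
        (f := fun x => (derivative^[k] W * q).eval x)
        (fun x _ => Polynomial.hasDerivAt _ x) ((Polynomial.continuous _).intervalIntegrable _ _)]
      simp [e1, e2]
    have hq' : (derivative q).degree < k := by
      by_cases h0 : q = 0
      · simp [h0]
      · have h1 := degree_derivative_lt h0
        rw [degree_eq_natDegree h0] at hq h1
        by_cases h2 : derivative q = 0
        · simp [h2]
        rw [degree_eq_natDegree h2] at h1 ⊢
        norm_cast at *
        omega
    have := ih (by omega) (derivative q) hq'
    rw [derivative_mul] at hparts
    simp only [eval_add] at hparts
    rw [intervalIntegral.integral_add ((Polynomial.continuous _).intervalIntegrable _ _)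
      ((Polynomial.continuous _).intervalIntegrable _ _), this, add_zero] at hparts
    rw [Function.iterate_succ_apply']
    exact hparts

lemma integrable_eval_legendreMeasure (p : ℝ[X]) :
    Integrable (fun x => p.eval x) legendreMeasure :=
  integrable_legendreMeasure p.continuous.continuousOn

lemma natDegree_legendrePoly (n : ℕ) : (legendrePoly n).natDegree = n ∧ legendrePoly n ≠ 0 := by
  have hc : ((2 ^ n * (n.factorial : ℝ))⁻¹) ≠ 0 := by positivity
  have hm : ((X : ℝ[X]) ^ 2 - 1).natDegree = 2 := by
    rw [← C_1]; exact natDegree_X_pow_sub_C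
  have hW : (((X : ℝ[X]) ^ 2 - 1) ^ n).natDegree = 2 * n := by
    rw [natDegree_pow, hm, mul_comm]
  have hW0 : ((X : ℝ[X]) ^ 2 - 1) ≠ 0 := by
    intro h; rw [h] at hm; simp at hm
  -- The coefficient of degree `n` is a descending factorial times the leading coefficient of `(X² -
  -- 1)^n`.
  have hco : (derivative^[n] (((X : ℝ[X]) ^ 2 - 1) ^ n)).coeff n ≠ 0 := by
    rw [coeff_iterate_derivative, nsmul_eq_mul]
    refine mul_ne_zero ?_ ?_
    · norm_cast
      exact (Nat.descFactorial_pos.2 (by omega)).ne'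
    · rw [show n + n = 2 * n by ring, ← hW, coeff_natDegree]
      exact leadingCoeff_ne_zero.2 (pow_ne_zero _ hW0)
  have hd : (derivative^[n] (((X : ℝ[X]) ^ 2 - 1) ^ n)).natDegree = n := by
    refine le_antisymm ((natDegree_iterate_derivative _ n).trans (by omega)) ?_
    exact le_natDegree_of_ne_zero hco
  constructor
  · rw [legendrePoly, natDegree_C_mul hc, hd]
  · rw [legendrePoly]
    refine mul_ne_zero (C_ne_zero.2 hc) fun h => hco ?_
    rw [h, coeff_zero]

/-- Taking the open interval as positivity set keeps the nodes away from `±1`; this matters for the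
substitution `r = (1 + x) / (1 - x)`. -/
lemma isGaussPoly_legendre (N : ℕ) :
    IsGaussPoly (polyIntegral legendreMeasure integrable_eval_legendreMeasure) (Set.Ioo (-1) 1) N
      (legendrePoly N) where
  preconn := isPreconnected_Ioo
  pos _ hp hnn := polyIntegral_pos _ ae_mem_legendreMeasure hp hnn
  ne_zero := (natDegree_legendrePoly N).2
  natDegree_eq := (natDegree_legendrePoly N).1
  orth q hq := by
    change ∫ x, _ ∂legendreMeasure = 0
    rw [integral_legendreMeasure, legendrePoly]
    simp only [mul_assoc, eval_C_mul]
    rw [intervalIntegral.integral_const_mul,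
      integral_iterate_derivative_mul_eq_zero N N le_rfl q hq]
    simp

lemma glWeight_div_two (N : ℕ) (x : ℝ) : glWeight N x / 2 =
    polyIntegral legendreMeasure integrable_eval_legendreMeasure
      (Lagrange.basis (glNodes N) id x) :=
  (integral_legendreMeasure _).symm

end Legendre

/-! ### The Gauss–Hermite rule -/

section Hermite

open Polynomial

/-- The probability measure with density proportional to `exp (-x ^ 2)`. -/
noncomputable abbrev hermiteMeasure : Measure ℝ := gaussianReal 0 (1 / 2)

lemma integral_hermiteMeasure (f : ℝ → ℝ) :
    ∫ x, f x ∂hermiteMeasure = (∫ x, f x * Real.exp (-x ^ 2)) / √Real.pi := by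
  rw [hermiteMeasure, integral_gaussianReal_eq_integral_smul (by norm_num), ← integral_div]
  congr with x
  rw [gaussianPDFReal, smul_eq_mul]
  have : √(2 * Real.pi * ((1 / 2 : ℝ≥0) : ℝ)) = √Real.pi := by congr 1; push_cast; ring
  rw [this]
  have : -(x - 0) ^ 2 / (2 * ((1 / 2 : ℝ≥0) : ℝ)) = - x ^ 2 := by push_cast; ring
  rw [this]
  ring

instance : NullSingletonClass hermiteMeasure := nullSingletonClass_gaussianReal (by norm_num)

lemma integrable_eval_hermiteMeasure (p : ℝ[X]) :
    Integrable (fun x => p.eval x) hermiteMeasure := by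
  refine integrable_eval_of_integrable_pow (fun n => ?_) p
  have := (memLp_id_gaussianReal (μ := 0) (v := 1 / 2) n).integrable_norm_pow'
  refine this.mono' (by fun_prop) (ae_of_all _ fun x => ?_)
  simp

/-- Gaussian integration by parts: the difference of the two integrands, times `exp (-x²)`, is the
derivative of `p(x) exp (-x²)`, which is integrable. -/
lemma integral_derivative_hermiteMeasure (p : ℝ[X]) :
    ∫ x, (derivative p).eval x ∂hermiteMeasure = ∫ x, (C 2 * X * p).eval x ∂hermiteMeasure := by
  have hint (q : ℝ[X]) : Integrable (fun x => q.eval x * Real.exp (-x ^ 2)) := by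
    have h := integrable_eval_hermiteMeasure q
    rw [hermiteMeasure, gaussianReal_of_var_ne_zero _ (by norm_num),
      integrable_withDensity_iff (by fun_prop) (ae_of_all _ fun _ => gaussianPDF_lt_top)] at h
    refine (h.const_mul √Real.pi).congr (ae_of_all _ fun x => ?_)
    have h1 : √(2 * Real.pi * ((1 / 2 : ℝ≥0) : ℝ)) = √Real.pi := by congr 1; push_cast; ring
    have h2 : -(x - 0) ^ 2 / (2 * ((1 / 2 : ℝ≥0) : ℝ)) = - x ^ 2 := by push_cast; ring
    have h3 : √Real.pi ≠ 0 := by positivity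
    simp only [toReal_gaussianPDF, gaussianPDFReal, h1, h2]
    field_simp
  rw [integral_hermiteMeasure, integral_hermiteMeasure, ← sub_eq_zero, ← sub_div,
    ← integral_sub (hint _) (hint _)]
  refine (div_eq_zero_iff.2 (Or.inl (integral_eq_zero_of_hasDerivAt_of_integrable
    (f := fun x => p.eval x * Real.exp (-x ^ 2)) (fun x => ?_) ((hint _).sub (hint _)) (hint p))))
  · have h1 : HasDerivAt (fun x : ℝ => Real.exp (-x ^ 2)) (Real.exp (-x ^ 2) * (-(2 * x))) x := by
      simpa using (((hasDerivAt_id x).pow 2).neg).exp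
    convert! (p.hasDerivAt x).mul h1 using 1
    simp only [eval_mul, eval_C, eval_X]
    ring

lemma physHermite_succ (n : ℕ) :
    physHermite (n + 1) = C 2 * X * physHermite n - derivative (physHermite n) := by
  have h2 : (C √2 : ℝ[X]) * C √2 = C 2 := by rw [← C_mul, Real.mul_self_sqrt (by norm_num)]
  simp only [physHermite, hermite_succ, Polynomial.map_sub, Polynomial.map_mul, map_X, sub_comp,
    mul_comp, X_comp, derivative_mul, derivative_C, zero_mul, zero_add, derivative_comp,
    derivative_map, derivative_X, mul_one, pow_succ, C_mul, ← h2]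
  ring

lemma natDegree_physHermite (n : ℕ) : (physHermite n).natDegree = n ∧ physHermite n ≠ 0 := by
  have hc : √2 ^ n ≠ 0 := by positivity
  have hs : √2 ≠ 0 := by positivity
  have hm : ((hermite n).map (Int.castRingHom ℝ)).Monic := (hermite_monic n).map _
  have hd : ((hermite n).map (Int.castRingHom ℝ)).natDegree = n := by
    rw [(hermite_monic n).natDegree_map, natDegree_hermite]
  refine ⟨?_, ?_⟩
  · rw [physHermite, natDegree_C_mul hc, natDegree_comp, hd, natDegree_C_mul_X _ hs, mul_one]
  · rw [physHermite]
    refine mul_ne_zero (C_ne_zero.2 hc) fun h => ?_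
    rw [comp_eq_zero_iff] at h
    rcases h with h | ⟨-, h⟩
    · exact hm.ne_zero h
    · have := congrArg natDegree h
      rw [natDegree_C_mul_X _ hs, natDegree_C] at this
      omega

/-- By the recurrence, `H_(n+1) q = 2X (H_n q) - (H_n q)' + H_n q'`. The first two terms cancel
under the Gaussian integral, and the last pairs `H_n` with a polynomial of smaller degree. -/
lemma integral_physHermite_mul_eq_zero (n : ℕ) (q : ℝ[X]) (hq : q.degree < n) :
    ∫ x, (physHermite n * q).eval x ∂hermiteMeasure = 0 := by
  induction n generalizing q with
  | zero =>
    have : q = 0 := by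
      rw [← degree_eq_bot]
      exact Nat.WithBot.lt_zero_iff.1 (by exact_mod_cast hq)
    simp [this]
  | succ n ih =>
    have hq' : (derivative q).degree < n := by
      by_cases h0 : q = 0
      · simp [h0]
      · have h1 := degree_derivative_lt h0
        rw [degree_eq_natDegree h0] at hq h1
        by_cases h2 : derivative q = 0
        · simp [h2]
        rw [degree_eq_natDegree h2] at h1 ⊢
        norm_cast at *
        omega
    have h1 := integral_derivative_hermiteMeasure (physHermite n * q)
    have h2 : physHermite (n + 1) * q = C 2 * X * (physHermite n * q) -
        derivative (physHermite n * q) + physHermite n * derivative q := by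
      rw [physHermite_succ, derivative_mul]; ring
    change polyIntegral hermiteMeasure integrable_eval_hermiteMeasure _ = _ at h1
    change polyIntegral hermiteMeasure integrable_eval_hermiteMeasure _ = 0
    rw [h2, map_add, map_sub, h1]
    exact (congrArg₂ (· + ·) (sub_self _) (ih _ hq')).trans (add_zero 0)

lemma isGaussPoly_physHermite (N : ℕ) :
    IsGaussPoly (polyIntegral hermiteMeasure integrable_eval_hermiteMeasure) Set.univ N
      (physHermite N) where
  preconn := isPreconnected_univ
  pos _ hp hnn := polyIntegral_pos _ (ae_of_all _ fun _ => Set.mem_univ _) hp hnn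
  ne_zero := (natDegree_physHermite N).2
  natDegree_eq := (natDegree_physHermite N).1
  orth q hq := integral_physHermite_mul_eq_zero N q hq

/-- Parity is needed only to make the Hermite nodes symmetric about the origin, as the estimate of
even moments requires. -/
lemma physHermite_comp_neg (n : ℕ) : (physHermite n).comp (-X) = (-1) ^ n * physHermite n := by
  induction n with
  | zero => simp [physHermite]
  | succ n ih =>
    have h := congrArg derivative ih
    rw [derivative_comp] at h
    have h3 : derivative ((-1 : ℝ[X]) ^ n * physHermite n) =
        (-1) ^ n * derivative (physHermite n) := by
      have : (-1 : ℝ[X]) ^ n = C ((-1) ^ n) := by simp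
      rw [this, derivative_C_mul]
    rw [h3] at h
    simp only [derivative_neg, derivative_X] at h
    rw [physHermite_succ, sub_comp, mul_comp, mul_comp, ih, C_comp, X_comp, pow_succ]
    linear_combination h

lemma neg_mem_ghNodes {N : ℕ} {x : ℝ} (hx : x ∈ ghNodes N) : -x ∈ ghNodes N := by
  rw [ghNodes, Multiset.mem_toFinset, mem_roots (natDegree_physHermite N).2, IsRoot.def] at hx ⊢
  have := congrArg (eval x) (physHermite_comp_neg N)
  simpa [eval_comp, hx] using this

lemma ghWeight_div_sqrt_pi (N : ℕ) (x : ℝ) : ghWeight N x / √Real.pi =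
    polyIntegral hermiteMeasure integrable_eval_hermiteMeasure
      (Lagrange.basis (ghNodes N) id x) :=
  (integral_hermiteMeasure _).symm

end Hermite

/-! ### Convergence of quadrature rules -/

/-- The form in which compactness is used throughout: a property that holds jointly near each point
of a compact set holds uniformly on it. -/
lemma eventually_forall_mem_of_isCompact {ι X : Type*} [TopologicalSpace X] {l : Filter ι}
    {K : Set X} (hK : IsCompact K) {p : ι → X → Prop}
    (h : ∀ x ∈ K, ∀ᶠ q : ι × X in l ×ˢ 𝓝 x, p q.1 q.2) : ∀ᶠ i in l, ∀ x ∈ K, p i x := by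
  have hnhds := hK.mem_prod_nhdsSet_of_forall h
  obtain ⟨U, hU, V, hV, hUV⟩ := mem_prod_iff.1 hnhds
  filter_upwards [hU] with i hi x hx
  exact hUV (Set.mk_mem_prod hi (subset_of_mem_nhdsSet hV hx))

/-- For `k ≥ n` one has `y^k ≤ 2^(-n) (2y)^k`, so the tail of the series is at most `2^(-n)` times
the whole series at `2y`. Doubling the exponent buys geometric smallness uniform in `y`. -/
lemma exp_sub_sum_le {y : ℝ} (hy : 0 ≤ y) (n : ℕ) :
    Real.exp y - ∑ k ∈ Finset.range n, y ^ k / k.factorial ≤ (1 / 2) ^ n * Real.exp (2 * y) := by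
  have hs : HasSum (fun k : ℕ => y ^ k / k.factorial) (Real.exp y) := by
    rw [Real.exp_eq_exp_ℝ]; exact NormedSpace.expSeries_div_hasSum_exp y
  have h2 : HasSum (fun k : ℕ => (2 * y) ^ k / k.factorial) (Real.exp (2 * y)) := by
    rw [Real.exp_eq_exp_ℝ]; exact NormedSpace.expSeries_div_hasSum_exp _
  refine le_of_tendsto (hs.tendsto_sum_nat.sub_const _) ?_
  filter_upwards [eventually_ge_atTop n] with m hm
  rw [← Finset.sum_Ico_eq_sub _ hm]
  calc ∑ k ∈ Finset.Ico n m, y ^ k / k.factorial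
      ≤ ∑ k ∈ Finset.Ico n m, (1 / 2) ^ n * ((2 * y) ^ k / k.factorial) := by
        refine Finset.sum_le_sum fun k hk => ?_
        have hk' := (Finset.mem_Ico.1 hk).1
        rw [mul_pow, ← mul_div_assoc, ← mul_assoc]
        gcongr
        refine le_mul_of_one_le_left (by positivity) ?_
        obtain ⟨j, rfl⟩ := Nat.exists_eq_add_of_le hk'
        rw [pow_add, ← mul_assoc, ← mul_pow]
        norm_num
        exact one_le_pow₀ (by norm_num)
    _ = (1 / 2) ^ n * ∑ k ∈ Finset.Ico n m, (2 * y) ^ k / k.factorial := by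
        rw [Finset.mul_sum]
    _ ≤ (1 / 2) ^ n * Real.exp (2 * y) := by
        gcongr
        exact sum_le_hasSum _ (fun _ _ => by positivity) h2

/-- A sequence of quadrature rules with nodes `S N` and weights `W N` for the probability measure
`μ`, with convergent moments and bounded exponential moments. -/
structure IsQuadratureSeq (S : ℕ → Finset ℝ) (W : ℕ → ℝ → ℝ) (μ : Measure ℝ) : Prop where
  nonneg : ∀ N, ∀ x ∈ S N, 0 ≤ W N x
  sum_one : ∀ N, N ≠ 0 → ∑ x ∈ S N, W N x = 1
  moments : ∀ k : ℕ, Tendsto (fun N => ∑ x ∈ S N, W N x * x ^ k) atTop (𝓝 (∫ x, x ^ k ∂μ))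
  exp_bound : ∀ κ : ℝ, ∃ M, ∀ N, ∑ x ∈ S N, W N x * Real.exp (κ * |x|) ≤ M
  integrable_exp : ∀ κ : ℝ, Integrable (fun x => Real.exp (κ * |x|)) μ

/-- The discrete measure of a quadrature rule. -/
noncomputable def discreteMeasure (s : Finset ℝ) (w : ℝ → ℝ) : Measure ℝ :=
  ∑ x ∈ s, ENNReal.ofReal (w x) • Measure.dirac x

lemma integral_discreteMeasure {E : Type*} [NormedAddCommGroup E] [NormedSpace ℝ E]
    [CompleteSpace E] {s : Finset ℝ} {w : ℝ → ℝ} (hw : ∀ x ∈ s, 0 ≤ w x)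
    (f : ℝ → E) : ∫ x, f x ∂discreteMeasure s w = ∑ x ∈ s, w x • f x := by
  rw [discreteMeasure, integral_finsetSum_measure]
  · refine Finset.sum_congr rfl fun x hx => ?_
    rw [integral_smul_measure, integral_dirac, ENNReal.toReal_ofReal (hw x hx)]
  · intro x _
    exact (integrable_dirac enorm_lt_top).smul_measure ENNReal.ofReal_ne_top

lemma isProbabilityMeasure_discreteMeasure {s : Finset ℝ} {w : ℝ → ℝ} (hw : ∀ x ∈ s, 0 ≤ w x)
    (h1 : ∑ x ∈ s, w x = 1) : IsProbabilityMeasure (discreteMeasure s w) where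
  measure_univ := by
    simp only [discreteMeasure, Measure.coe_finsetSum, Finset.sum_apply, Measure.smul_apply,
      measure_univ, smul_eq_mul, mul_one]
    rw [← ENNReal.ofReal_sum_of_nonneg hw, h1, ENNReal.ofReal_one]

namespace IsQuadratureSeq

variable {S : ℕ → Finset ℝ} {W : ℕ → ℝ → ℝ} {μ : Measure ℝ}

lemma integrable_of_le [IsProbabilityMeasure μ] (hQ : IsQuadratureSeq S W μ) {f : ℝ → ℝ}
    (hf : AEStronglyMeasurable f μ) {B κ : ℝ} (hB : ∀ x, |f x| ≤ B * Real.exp (κ * |x|)) :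
    Integrable f μ :=
  ((hQ.integrable_exp κ).const_mul B).mono' hf (ae_of_all _ hB)

/-- The Taylor polynomials of `exp (itx)` converge under the rule because moments do. Their
remainder is at most `2^(-n) exp (2|t||x|)`, whose quadrature sums are bounded independently of the
order, so the two limits may be exchanged. -/
lemma tendsto_charFun [IsProbabilityMeasure μ] (hQ : IsQuadratureSeq S W μ) (t : ℝ) :
    Tendsto (fun N => ∑ x ∈ S N, (W N x : ℂ) * Complex.exp (t * x * Complex.I)) atTop
      (𝓝 (∫ x : ℝ, Complex.exp (t * x * Complex.I) ∂μ)) := by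
  obtain ⟨M, hM⟩ := hQ.exp_bound (2 * |t|)
  set T : ℕ → ℝ → ℂ := fun n x => ∑ k ∈ Finset.range n, (t * x * Complex.I) ^ k / k.factorial
  have hT (n : ℕ) (x : ℝ) : ‖Complex.exp (t * x * Complex.I) - T n x‖ ≤
      (1 / 2) ^ n * Real.exp (2 * |t| * |x|) := by
    refine (Complex.norm_exp_sub_sum_le_exp_norm_sub_sum _ n).trans ?_
    have : ‖(t * x * Complex.I : ℂ)‖ = |t| * |x| := by simp
    rw [this, mul_assoc]
    exact exp_sub_sum_le (by positivity) n
  have hTeq (n : ℕ) (x : ℝ) : T n x =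
      ∑ k ∈ Finset.range n, ((t * Complex.I) ^ k / k.factorial) * ((x ^ k : ℝ) : ℂ) := by
    refine Finset.sum_congr rfl fun k _ => ?_
    push_cast
    rw [show (t * x * Complex.I : ℂ) = t * Complex.I * x by ring, mul_pow]
    ring
  have hpow (k : ℕ) : Integrable (fun x : ℝ => x ^ k) μ := by
    refine hQ.integrable_of_le (B := k.factorial) (κ := 1) (by fun_prop) fun x => ?_
    rw [abs_pow, one_mul]
    have := Real.pow_div_factorial_le_exp |x| (abs_nonneg x) k
    rw [div_le_iff₀ (by positivity)] at this
    linarith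
  have hTint (n : ℕ) : Integrable (T n) μ := by
    simp only [funext (hTeq n)]
    exact integrable_finsetSum _ fun k _ => ((hpow k).ofReal).const_mul _
  have hlim (n : ℕ) : Tendsto (fun N => ∑ x ∈ S N, (W N x : ℂ) * T n x) atTop
      (𝓝 (∫ x, T n x ∂μ)) := by
    simp only [hTeq]
    rw [integral_finsetSum _ fun k _ => ((hpow k).ofReal).const_mul _]
    simp only [Finset.mul_sum]
    simp_rw [Finset.sum_comm (s := S _)]
    refine tendsto_finsetSum _ fun k _ => ?_
    rw [integral_const_mul, integral_complex_ofReal]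
    have := (Complex.continuous_ofReal.tendsto _).comp (hQ.moments k)
    refine (this.const_mul ((t * Complex.I) ^ k / k.factorial : ℂ)).congr fun N => ?_
    simp only [Function.comp, Complex.ofReal_sum, Finset.mul_sum, Complex.ofReal_mul]
    exact Finset.sum_congr rfl fun x _ => by ring
  have hexpint : Integrable (fun x : ℝ => Complex.exp (t * x * Complex.I)) μ := by
    refine (integrable_const (1 : ℝ)).mono' (by fun_prop) (ae_of_all _ fun x => ?_)
    rw [← Complex.ofReal_mul, Complex.norm_exp_ofReal_mul_I]
  set A := ∫ x, Real.exp (2 * |t| * |x|) ∂μ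
  rw [Metric.tendsto_atTop]
  intro ε hε
  have hsmall : Tendsto (fun n : ℕ => (1 / 2 : ℝ) ^ n * (|M| + |A|)) atTop (𝓝 0) := by
    simpa using (tendsto_pow_atTop_nhds_zero_of_lt_one (r := (1 / 2 : ℝ)) (by norm_num)
      (by norm_num)).mul_const (|M| + |A|)
  obtain ⟨n, hn⟩ := ((tendsto_order.1 hsmall).2 (ε / 2) (by linarith)).exists
  obtain ⟨N₀, hN₀⟩ := Metric.tendsto_atTop.1 (hlim n) (ε / 2) (by linarith)
  refine ⟨N₀, fun N hN => ?_⟩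
  have h1 : ‖∑ x ∈ S N, (W N x : ℂ) * Complex.exp (t * x * Complex.I) -
      ∑ x ∈ S N, (W N x : ℂ) * T n x‖ ≤ (1 / 2) ^ n * |M| := by
    rw [← Finset.sum_sub_distrib]
    refine (norm_sum_le _ _).trans ?_
    calc _ ≤ ∑ x ∈ S N, (1 / 2) ^ n * (W N x * Real.exp (2 * |t| * |x|)) := by
          refine Finset.sum_le_sum fun x hx => ?_
          rw [← mul_sub, norm_mul, Complex.norm_real, Real.norm_of_nonneg (hQ.nonneg N x hx)]
          calc _ ≤ W N x * ((1 / 2) ^ n * Real.exp (2 * |t| * |x|)) :=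
                mul_le_mul_of_nonneg_left (hT n x) (hQ.nonneg N x hx)
            _ = _ := by ring
      _ ≤ (1 / 2) ^ n * |M| := by
          rw [← Finset.mul_sum]
          gcongr
          exact (hM N).trans (le_abs_self M)
  have h2 : ‖∫ x, T n x ∂μ - ∫ x : ℝ, Complex.exp (t * x * Complex.I) ∂μ‖ ≤
      (1 / 2) ^ n * |A| := by
    rw [← integral_sub (hTint n) hexpint]
    calc _ ≤ ∫ x, (1 / 2) ^ n * Real.exp (2 * |t| * |x|) ∂μ := by
          refine norm_integral_le_of_norm_le ((hQ.integrable_exp _).const_mul _)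
            (ae_of_all _ fun x => ?_)
          rw [norm_sub_rev]
          exact hT n x
      _ = (1 / 2) ^ n * A := integral_const_mul _ _
      _ ≤ _ := by gcongr; exact le_abs_self A
  have h3 := hN₀ N hN
  rw [dist_eq_norm] at h3 ⊢
  calc _ = ‖(∑ x ∈ S N, (W N x : ℂ) * Complex.exp (t * x * Complex.I) -
            ∑ x ∈ S N, (W N x : ℂ) * T n x) +
          (∑ x ∈ S N, (W N x : ℂ) * T n x - ∫ x, T n x ∂μ) +
          (∫ x, T n x ∂μ - ∫ x : ℝ, Complex.exp (t * x * Complex.I) ∂μ)‖ := by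
        congr 1; ring
    _ ≤ _ := norm_add₃_le
    _ < ε := by linarith

/-- Lévy's continuity theorem for the discrete measures of the rules. -/
lemma tendsto_boundedContinuous [IsProbabilityMeasure μ] (hQ : IsQuadratureSeq S W μ)
    (f : BoundedContinuousFunction ℝ ℝ) :
    Tendsto (fun N => ∑ x ∈ S N, W N x * f x) atTop (𝓝 (∫ x, f x ∂μ)) := by
  -- The shift discards order `0`, for which total mass one is not assumed.
  rw [← tendsto_add_atTop_iff_nat 1]
  have hprob (N : ℕ) := isProbabilityMeasure_discreteMeasure (hQ.nonneg (N + 1))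
    (hQ.sum_one (N + 1) (Nat.succ_ne_zero N))
  let ν : ℕ → ProbabilityMeasure ℝ := fun N => ⟨discreteMeasure (S (N + 1)) (W (N + 1)), hprob N⟩
  have hν : Tendsto ν atTop (𝓝 (⟨μ, inferInstance⟩ : ProbabilityMeasure ℝ)) := by
    refine ProbabilityMeasure.tendsto_of_tendsto_charFun fun t => ?_
    have := (tendsto_add_atTop_iff_nat 1).2 (hQ.tendsto_charFun t)
    refine Tendsto.congr (fun N => ?_) (by simpa [charFun_apply_real] using this)
    simp only [ν, charFun_apply_real, ProbabilityMeasure.coe_mk]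
    rw [integral_discreteMeasure (hQ.nonneg _)]
    simp
  have := ProbabilityMeasure.tendsto_iff_forall_integral_tendsto.1 hν f
  simp only [ν, ProbabilityMeasure.coe_mk] at this
  refine this.congr fun N => ?_
  rw [integral_discreteMeasure (hQ.nonneg _)]
  simp

/-- Truncating `f` to `[-T, T]` costs at most `f² / T`, and `f²` still has exponential growth, so
the cost is `O(1 / T)` under `μ` and under every rule alike. -/
lemma tendsto_of_continuous [IsProbabilityMeasure μ] (hQ : IsQuadratureSeq S W μ) {f : ℝ → ℝ}
    (hf : Continuous f) {B κ : ℝ} (hB : ∀ x, |f x| ≤ B * Real.exp (κ * |x|)) :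
    Tendsto (fun N => ∑ x ∈ S N, W N x * f x) atTop (𝓝 (∫ x, f x ∂μ)) := by
  obtain ⟨M, hM⟩ := hQ.exp_bound (2 * κ)
  set A := ∫ x, Real.exp (2 * κ * |x|) ∂μ
  rw [Metric.tendsto_atTop]
  intro ε hε
  obtain ⟨T, hT0, hT⟩ : ∃ T : ℝ, 0 < T ∧ B ^ 2 * (|M| + |A|) / T < ε / 3 := by
    have h : Tendsto (fun T : ℝ => B ^ 2 * (|M| + |A|) / T) atTop (𝓝 0) :=
      tendsto_const_nhds.div_atTop tendsto_id
    obtain ⟨T, h1, h2⟩ := (((tendsto_order.1 h).2 (ε / 3) (by linarith)).and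
      (eventually_gt_atTop 0)).exists
    exact ⟨T, h2, h1⟩
  set g : ℝ → ℝ := fun x => max (-T) (min (f x) T)
  have hgT (x : ℝ) : |g x| ≤ T := abs_le.2 ⟨le_max_left _ _,
    max_le (by linarith) (min_le_right _ _)⟩
  have hfg (x : ℝ) : |f x - g x| ≤ B ^ 2 / T * Real.exp (2 * κ * |x|) := by
    have h1 : |f x - g x| ≤ f x ^ 2 / T := by
      rw [le_div_iff₀ hT0]
      simp only [g]
      rcases le_total (f x) T with h | h
      · rw [min_eq_left h]
        rcases le_total (-T) (f x) with h' | h'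
        · rw [max_eq_right h']; simp; positivity
        · rw [max_eq_left h', abs_of_nonpos (by linarith)]; nlinarith
      · rw [min_eq_right h, max_eq_right (by linarith), abs_of_nonneg (by linarith)]; nlinarith
    have h2 : f x ^ 2 ≤ B ^ 2 * Real.exp (2 * κ * |x|) := by
      rw [← sq_abs]
      calc |f x| ^ 2 ≤ (B * Real.exp (κ * |x|)) ^ 2 := by gcongr; exact hB x
        _ = _ := by rw [mul_pow, ← Real.exp_nat_mul]; push_cast; ring_nf
    calc _ ≤ f x ^ 2 / T := h1
      _ ≤ B ^ 2 * Real.exp (2 * κ * |x|) / T := by gcongr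
      _ = _ := by ring
  have hgc : Continuous g := by fun_prop
  have hlim := hQ.tendsto_boundedContinuous
    (BoundedContinuousFunction.ofNormedAddCommGroup g hgc T hgT)
  obtain ⟨N₀, hN₀⟩ := Metric.tendsto_atTop.1 hlim (ε / 3) (by linarith)
  refine ⟨N₀, fun N hN => ?_⟩
  have h1 : |∑ x ∈ S N, W N x * f x - ∑ x ∈ S N, W N x * g x| ≤ B ^ 2 / T * |M| := by
    rw [← Finset.sum_sub_distrib]
    refine (Finset.abs_sum_le_sum_abs _ _).trans ?_
    calc _ ≤ ∑ x ∈ S N, B ^ 2 / T * (W N x * Real.exp (2 * κ * |x|)) := by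
          refine Finset.sum_le_sum fun x hx => ?_
          rw [← mul_sub, abs_mul, abs_of_nonneg (hQ.nonneg N x hx)]
          calc _ ≤ W N x * (B ^ 2 / T * Real.exp (2 * κ * |x|)) :=
                mul_le_mul_of_nonneg_left (hfg x) (hQ.nonneg N x hx)
            _ = _ := by ring
      _ ≤ _ := by
          rw [← Finset.mul_sum]
          gcongr
          exact (hM N).trans (le_abs_self M)
  have hfint : Integrable f μ := hQ.integrable_of_le hf.aestronglyMeasurable hB
  have hgint : Integrable g μ := (integrable_const T).mono' hgc.aestronglyMeasurable
    (ae_of_all _ hgT)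
  have h2 : |∫ x, g x ∂μ - ∫ x, f x ∂μ| ≤ B ^ 2 / T * |A| := by
    rw [← integral_sub hgint hfint]
    calc _ ≤ ∫ x, B ^ 2 / T * Real.exp (2 * κ * |x|) ∂μ := by
          rw [← Real.norm_eq_abs]
          refine norm_integral_le_of_norm_le ((hQ.integrable_exp _).const_mul _)
            (ae_of_all _ fun x => ?_)
          rw [norm_sub_rev]
          exact hfg x
      _ = B ^ 2 / T * A := integral_const_mul _ _
      _ ≤ _ := by gcongr; exact le_abs_self A
  have h3 := hN₀ N hN
  simp only [BoundedContinuousFunction.coe_ofNormedAddCommGroup] at h3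
  rw [Real.dist_eq] at h3 ⊢
  have hT' : B ^ 2 / T * |M| + B ^ 2 / T * |A| < ε / 3 := by
    calc _ = B ^ 2 * (|M| + |A|) / T := by ring
      _ < _ := hT
  rw [abs_le] at h1 h2
  rw [abs_lt] at h3 ⊢
  constructor <;> linarith

/-- Quadrature rules are compatible with continuous convergence of the integrands, if these grow
at most exponentially. -/
theorem tendsto_sum [IsProbabilityMeasure μ] (hQ : IsQuadratureSeq S W μ) {ι : Type*}
    {l : Filter ι} {n : ι → ℕ} (hn : Tendsto n l atTop) {h : ι → ℝ → ℝ} {f : ℝ → ℝ} {B κ : ℝ}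
    (hf : Continuous f) (hfB : ∀ x, |f x| ≤ B * Real.exp (κ * |x|))
    (hB : ∀ᶠ i in l, ∀ x ∈ S (n i), |h i x| ≤ B * Real.exp (κ * |x|))
    (hlim : ∀ x, Tendsto (fun p : ι × ℝ => h p.1 p.2) (l ×ˢ 𝓝 x) (𝓝 (f x))) :
    Tendsto (fun i => ∑ x ∈ S (n i), W (n i) x * h i x) l (𝓝 (∫ x, f x ∂μ)) := by
  have hB0 : 0 ≤ B := by
    have := (abs_nonneg _).trans (hfB 0)
    simpa using this
  have key : Tendsto (fun i => ∑ x ∈ S (n i), W (n i) x * (h i x - f x)) l (𝓝 0) := by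
    -- The rate exceeds the growth rate `κ` by one: for `|x| ≥ L` the surplus yields a factor `exp
    -- (-L)` uniformly in the order. On `[-L, L]` the convergence is uniform by compactness.
    obtain ⟨M, hM⟩ := hQ.exp_bound (κ + 1)
    rw [Metric.tendsto_nhds]
    intro ε hε
    have h1 : Tendsto (fun L : ℝ => 2 * B * |M| * Real.exp (-L)) atTop (𝓝 0) := by
      simpa using (Real.tendsto_exp_neg_atTop_nhds_zero).const_mul (2 * B * |M|)
    obtain ⟨L, hL⟩ := ((tendsto_order.1 h1).2 (ε / 2) (by linarith)).exists
    have hunif : ∀ᶠ i in l, ∀ x ∈ Set.Icc (-L) L, |h i x - f x| < ε / 2 := by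
      have hpt : ∀ x ∈ Set.Icc (-L) L, ∀ᶠ p : ι × ℝ in l ×ˢ 𝓝 x, |h p.1 p.2 - f p.2| < ε / 2 := by
        intro x _
        have hd : Tendsto (fun p : ι × ℝ => |h p.1 p.2 - f p.2|) (l ×ˢ 𝓝 x) (𝓝 0) := by
          have := ((hlim x).sub ((hf.tendsto x).comp tendsto_snd)).abs
          simpa using this
        exact (tendsto_order.1 hd).2 _ (by linarith)
      exact eventually_forall_mem_of_isCompact isCompact_Icc
        (p := fun i x => |h i x - f x| < ε / 2) hpt
    filter_upwards [hunif, hB, hn.eventually_ne_atTop 0] with i hi hBi hn0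
    rw [Real.dist_eq, sub_zero]
    refine (Finset.abs_sum_le_sum_abs _ _).trans_lt ?_
    calc ∑ x ∈ S (n i), |W (n i) x * (h i x - f x)|
        ≤ ∑ x ∈ S (n i), (ε / 2 * W (n i) x +
            2 * B * Real.exp (-L) * (W (n i) x * Real.exp ((κ + 1) * |x|))) := by
          refine Finset.sum_le_sum fun x hx => ?_
          have hW := hQ.nonneg _ x hx
          rw [abs_mul, abs_of_nonneg hW]
          by_cases hxL : x ∈ Set.Icc (-L) L
          · have h2 := (hi x hxL).le
            have h3 : 0 ≤ 2 * B * Real.exp (-L) * (W (n i) x * Real.exp ((κ + 1) * |x|)) := by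
              positivity
            nlinarith
          · have hx' : L ≤ |x| := by
              rw [Set.mem_Icc, ← abs_le] at hxL
              linarith
            have h2 : |h i x - f x| ≤ 2 * B * Real.exp (κ * |x|) :=
              (abs_sub _ _).trans (by linarith [hBi x hx, hfB x])
            have h3 : Real.exp (κ * |x|) ≤ Real.exp (-L) * Real.exp ((κ + 1) * |x|) := by
              rw [← Real.exp_add]
              exact Real.exp_le_exp.2 (by linarith)
            calc W (n i) x * |h i x - f x|
                ≤ W (n i) x * (2 * B * (Real.exp (-L) * Real.exp ((κ + 1) * |x|))) := by
                  refine mul_le_mul_of_nonneg_left (h2.trans ?_) hW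
                  gcongr
              _ ≤ _ := by
                  have : 0 ≤ ε / 2 * W (n i) x := by positivity
                  linarith
      _ = ε / 2 + 2 * B * Real.exp (-L) * ∑ x ∈ S (n i), W (n i) x * Real.exp ((κ + 1) * |x|) := by
          rw [Finset.sum_add_distrib, ← Finset.mul_sum, ← Finset.mul_sum, hQ.sum_one _ hn0, mul_one]
      _ ≤ ε / 2 + 2 * B * Real.exp (-L) * |M| := by
          gcongr
          exact (hM _).trans (le_abs_self M)
      _ < ε := by linarith
  have h2 := key.add ((hQ.tendsto_of_continuous hf hfB).comp hn)
  rw [zero_add] at h2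
  refine h2.congr fun i => ?_
  simp only [Function.comp, ← Finset.sum_add_distrib]
  exact Finset.sum_congr rfl fun x _ => by ring

end IsQuadratureSeq

/-! ### The two Gaussian rules -/

open Polynomial in
-- Exactness below degree `2N` makes each moment eventually constant; exponential moments are
-- bounded because the nodes lie in `(-1, 1)`. Halving the weights normalises them to a probability.
lemma isQuadratureSeq_legendre :
    IsQuadratureSeq glNodes (fun N x => glWeight N x / 2) legendreMeasure where
  nonneg N x hx := by
    rw [glWeight_div_two]
    exact ((isGaussPoly_legendre N).weight_pos hx).le
  sum_one N hN := by
    have h := (isGaussPoly_legendre N).sum_weight (p := 1)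
      (by rw [degree_one]; exact_mod_cast (by omega : 0 < 2 * N))
    simp only [eval_one, mul_one] at h
    simp only [glWeight_div_two]
    refine h.trans ?_
    simp [polyIntegral]
  moments k := by
    refine tendsto_const_nhds.congr' ?_
    filter_upwards [eventually_gt_atTop k] with N hN
    have h := (isGaussPoly_legendre N).sum_weight (p := X ^ k)
      (by rw [degree_X_pow]; exact_mod_cast (by omega : k < 2 * N))
    simp only [eval_pow, eval_X] at h
    simp only [glWeight_div_two]
    refine (h.trans ?_).symm
    simp [polyIntegral]
  exp_bound κ := by
    refine ⟨Real.exp |κ|, fun N => ?_⟩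
    rcases Nat.eq_zero_or_pos N with rfl | hN
    · have : glNodes 0 = ∅ := by simp [glNodes, legendrePoly]
      rw [this, Finset.sum_empty]; positivity
    have h := (isGaussPoly_legendre N).sum_weight (p := 1)
      (by rw [degree_one]; exact_mod_cast (by omega : 0 < 2 * N))
    have h1 : ∑ x ∈ glNodes N, glWeight N x / 2 = 1 := by
      simp only [eval_one, mul_one] at h
      simp only [glWeight_div_two]
      refine h.trans ?_
      simp [polyIntegral]
    rw [← one_mul (Real.exp |κ|), ← h1, Finset.sum_mul]
    refine Finset.sum_le_sum fun x hx => ?_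
    have hw : 0 ≤ glWeight N x / 2 := by
      rw [glWeight_div_two]
      exact ((isGaussPoly_legendre N).weight_pos hx).le
    have hx1 := (isGaussPoly_legendre N).mem_of_isRoot hx
    have hx2 : |x| ≤ 1 := abs_le.2 ⟨hx1.1.le, hx1.2.le⟩
    gcongr
    calc κ * |x| ≤ |κ| * |x| := by gcongr; exact le_abs_self κ
      _ ≤ |κ| * 1 := by gcongr
      _ = |κ| := mul_one _
  integrable_exp κ := integrable_legendreMeasure (by fun_prop)

lemma integrable_cosh_hermiteMeasure (κ : ℝ) :
    Integrable (fun x => Real.cosh (κ * x)) hermiteMeasure := by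
  simp only [Real.cosh_eq]
  refine ((integrable_exp_mul_gaussianReal κ).add ?_).div_const 2
  simpa using integrable_exp_mul_gaussianReal (μ := 0) (v := 1 / 2) (-κ)

lemma exp_mul_abs_le_two_mul_cosh (κ x : ℝ) : Real.exp (κ * |x|) ≤ 2 * Real.cosh (κ * x) := by
  rw [Real.cosh_eq]
  rcases abs_cases x with ⟨h, -⟩ | ⟨h, -⟩ <;> rw [h]
  · linarith [Real.exp_pos (-(κ * x))]
  · rw [mul_neg]; linarith [Real.exp_pos (κ * x)]

/-- The power series of `cosh` contains only even powers, with nonnegative coefficients, and each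
even moment is underestimated by the rule. This bounds exponential moments uniformly in the order,
although the Hermite nodes are not confined to a bounded set. -/
lemma sum_ghWeight_cosh_le (N : ℕ) (κ : ℝ) :
    ∑ x ∈ ghNodes N, ghWeight N x / √Real.pi * Real.cosh (κ * x) ≤
      ∫ x, Real.cosh (κ * x) ∂hermiteMeasure := by
  have hlim : Tendsto (fun m => ∑ x ∈ ghNodes N, ghWeight N x / √Real.pi *
      ∑ k ∈ Finset.range m, (κ * x) ^ (2 * k) / (2 * k).factorial) atTop
      (𝓝 (∑ x ∈ ghNodes N, ghWeight N x / √Real.pi * Real.cosh (κ * x))) :=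
    tendsto_finsetSum _ fun x _ => (Real.hasSum_cosh (κ * x)).tendsto_sum_nat.const_mul _
  refine le_of_tendsto hlim (Eventually.of_forall fun m => ?_)
  have hpow (k : ℕ) : Integrable (fun x : ℝ => x ^ k) hermiteMeasure := by
    simpa using integrable_eval_hermiteMeasure (Polynomial.X ^ k)
  have hmom (k : ℕ) : ∑ x ∈ ghNodes N, ghWeight N x / √Real.pi * x ^ (2 * k) ≤
      ∫ x, x ^ (2 * k) ∂hermiteMeasure := by
    have := (isGaussPoly_physHermite N).sum_weight_even_pow_le (fun x hx => neg_mem_ghNodes hx) k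
    simp only [ghWeight_div_sqrt_pi]
    refine this.trans_eq ?_
    simp [polyIntegral]
  calc _ = ∑ k ∈ Finset.range m, κ ^ (2 * k) / (2 * k).factorial *
          ∑ x ∈ ghNodes N, ghWeight N x / √Real.pi * x ^ (2 * k) := by
        simp only [Finset.mul_sum]
        rw [Finset.sum_comm]
        refine Finset.sum_congr rfl fun k _ => Finset.sum_congr rfl fun x _ => ?_
        rw [mul_pow]; ring
    _ ≤ ∑ k ∈ Finset.range m, κ ^ (2 * k) / (2 * k).factorial *
          ∫ x, x ^ (2 * k) ∂hermiteMeasure := by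
        refine Finset.sum_le_sum fun k _ => mul_le_mul_of_nonneg_left (hmom k) ?_
        rw [pow_mul]; positivity
    _ = ∫ x, ∑ k ∈ Finset.range m, κ ^ (2 * k) / (2 * k).factorial * x ^ (2 * k)
          ∂hermiteMeasure := by
        rw [integral_finsetSum _ fun k _ => (hpow _).const_mul _]
        exact Finset.sum_congr rfl fun k _ => (integral_const_mul _ _).symm
    _ ≤ _ := by
        refine integral_mono (integrable_finsetSum _ fun k _ => (hpow _).const_mul _)
          (integrable_cosh_hermiteMeasure κ) fun x => ?_
        refine le_of_eq_of_le ?_ (sum_le_hasSum (Finset.range m) (fun k _ => ?_)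
          (Real.hasSum_cosh (κ * x)))
        · exact Finset.sum_congr rfl fun k _ => by rw [mul_pow]; ring
        · rw [pow_mul]; positivity

open Polynomial in
lemma isQuadratureSeq_hermite :
    IsQuadratureSeq ghNodes (fun N x => ghWeight N x / √Real.pi) hermiteMeasure where
  nonneg N x hx := by
    rw [ghWeight_div_sqrt_pi]
    exact ((isGaussPoly_physHermite N).weight_pos hx).le
  sum_one N hN := by
    have h := (isGaussPoly_physHermite N).sum_weight (p := 1)
      (by rw [degree_one]; exact_mod_cast (by omega : 0 < 2 * N))
    simp only [eval_one, mul_one] at h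
    simp only [ghWeight_div_sqrt_pi]
    refine h.trans ?_
    simp [polyIntegral]
  moments k := by
    refine tendsto_const_nhds.congr' ?_
    filter_upwards [eventually_gt_atTop k] with N hN
    have h := (isGaussPoly_physHermite N).sum_weight (p := X ^ k)
      (by rw [degree_X_pow]; exact_mod_cast (by omega : k < 2 * N))
    simp only [eval_pow, eval_X] at h
    simp only [ghWeight_div_sqrt_pi]
    refine (h.trans ?_).symm
    simp [polyIntegral]
  exp_bound κ := by
    refine ⟨2 * ∫ x, Real.cosh (κ * x) ∂hermiteMeasure, fun N => ?_⟩
    have h := sum_ghWeight_cosh_le N κ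
    calc _ ≤ ∑ x ∈ ghNodes N, 2 * (ghWeight N x / √Real.pi * Real.cosh (κ * x)) := by
          refine Finset.sum_le_sum fun x hx => ?_
          have hw : 0 ≤ ghWeight N x / √Real.pi := by
            rw [ghWeight_div_sqrt_pi]
            exact ((isGaussPoly_physHermite N).weight_pos hx).le
          calc _ ≤ ghWeight N x / √Real.pi * (2 * Real.cosh (κ * x)) := by
                gcongr; exact exp_mul_abs_le_two_mul_cosh κ x
            _ = _ := by ring
      _ ≤ _ := by rw [← Finset.mul_sum]; gcongr
  integrable_exp κ := by
    refine ((integrable_cosh_hermiteMeasure κ).const_mul 2).mono' (by fun_prop)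
      (ae_of_all _ fun x => ?_)
    rw [Real.norm_of_nonneg (Real.exp_pos _).le]
    exact exp_mul_abs_le_two_mul_cosh κ x

/-! ### The function `exp (-x)` on `[0, ∞]` -/

/-- The function `exp (-x)` on `[0, ∞]`. -/
noncomputable def negExp (x : ℝ≥0∞) : ℝ := (EReal.exp (-(x : EReal))).toReal

lemma negExp_aux_ne_top (x : ℝ≥0∞) : EReal.exp (-(x : EReal)) ≠ ∞ := by
  simp [EReal.exp_eq_top_iff]

lemma negExp_zero : negExp 0 = 1 := by simp [negExp]

lemma negExp_top : negExp ∞ = 0 := by simp [negExp]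

lemma negExp_ofReal {x : ℝ} (hx : 0 ≤ x) : negExp (ENNReal.ofReal x) = Real.exp (-x) := by
  rw [negExp, EReal.coe_ennreal_ofReal, max_eq_left hx, ← EReal.coe_neg, EReal.exp_coe,
    ENNReal.toReal_ofReal (Real.exp_pos _).le]

lemma negExp_nonneg (x : ℝ≥0∞) : 0 ≤ negExp x := ENNReal.toReal_nonneg

lemma negExp_antitone : Antitone negExp := fun x y hxy =>
  ENNReal.toReal_mono (negExp_aux_ne_top x) (EReal.exp_monotone (by simpa using hxy))

lemma negExp_le_one (x : ℝ≥0∞) : negExp x ≤ 1 := negExp_zero ▸ negExp_antitone zero_le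

lemma negExp_add (x y : ℝ≥0∞) : negExp (x + y) = negExp x * negExp y := by
  rw [negExp, negExp, negExp, EReal.coe_ennreal_add, EReal.neg_add (by simp) (by simp),
    sub_eq_add_neg, EReal.exp_add, ENNReal.toReal_mul]

lemma continuous_negExp : Continuous negExp := by
  have h1 : Continuous fun x : ℝ≥0∞ => EReal.exp (-(x : EReal)) :=
    ENNReal.continuous_exp.comp (continuous_neg.comp continuous_coe_ennreal_ereal)
  exact ENNReal.continuousOn_toReal.comp_continuous h1 negExp_aux_ne_top

lemma measurable_negExp : Measurable negExp := continuous_negExp.measurable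

lemma negExp_sum {ι : Type*} (s : Finset ι) (f : ι → ℝ≥0∞) :
    negExp (∑ i ∈ s, f i) = ∏ i ∈ s, negExp (f i) := by
  classical
  induction s using Finset.induction_on with
  | empty => simp [negExp_zero]
  | insert a s ha ih => rw [Finset.sum_insert ha, Finset.prod_insert ha, negExp_add, ih]

lemma negExp_mul_natCast (x : ℝ≥0∞) (k : ℕ) : negExp (x * k) = negExp x ^ k := by
  induction k with
  | zero => simp [negExp_zero]
  | succ k ih => rw [Nat.cast_succ, mul_add, mul_one, negExp_add, ih, pow_succ]

lemma integrable_negExp_comp {Ω : Type*} [MeasurableSpace Ω] {P : Measure Ω} [IsFiniteMeasure P]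
    {f : Ω → ℝ≥0∞} (hf : Measurable f) : Integrable (fun ω => negExp (f ω)) P :=
  (integrable_const (1 : ℝ)).mono' (measurable_negExp.comp hf).aestronglyMeasurable
    (ae_of_all _ fun ω => by
      rw [Real.norm_of_nonneg (negExp_nonneg _)]; exact negExp_le_one _)

/-! ### The Laplace functional of a Poisson process -/

/-- The generating function of the Poisson law at `negExp c`. The value `c = ∞` is included and
gives the void probability. -/
lemma integral_negExp_poisson (c : ℝ≥0∞) (m : ℝ≥0) :
    ∫ k : ℕ, negExp (c * k) ∂(poissonMeasure m) = Real.exp (-((1 - negExp c) * m)) := by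
  rw [integral_poissonMeasure]
  have h : HasSum (fun k : ℕ => Real.exp (-m) * ((m * negExp c) ^ k / k.factorial))
      (Real.exp (-m) * Real.exp (m * negExp c)) := by
    refine HasSum.mul_left _ ?_
    rw [Real.exp_eq_exp_ℝ]
    exact NormedSpace.expSeries_div_hasSum_exp _
  rw [← Real.exp_add] at h
  rw [show -((1 - negExp c) * (m : ℝ)) = -m + m * negExp c by ring, ← h.tsum_eq]
  congr with k
  rw [negExp_mul_natCast, smul_eq_mul, mul_pow]
  ring

namespace IsPoissonProcess

variable {Ω E : Type*} [MeasurableSpace Ω] [MeasurableSpace E] {P : Measure Ω}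
  {μ : Measure E} {N : Ω → Measure E}

lemma integral_negExp_mul (hN : IsPoissonProcess P μ N) {B : Set E} (hB : MeasurableSet B)
    (hfin : μ B ≠ ∞) (c : ℝ≥0∞) :
    ∫ ω, negExp (c * N ω B) ∂P = negExp (ENNReal.ofReal (1 - negExp c) * μ B) := by
  have hm : Measurable fun ω => N ω B := (Measure.measurable_coe hB).comp hN.measurable
  have hg : Measurable fun y : ℝ≥0∞ => negExp (c * y) :=
    measurable_negExp.comp (measurable_const.mul measurable_id)
  have h1 : ∫ ω, negExp (c * N ω B) ∂P = ∫ y, negExp (c * y) ∂(P.map fun ω => N ω B) :=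
    (integral_map hm.aemeasurable hg.aestronglyMeasurable).symm
  rw [h1, hN.law B hB hfin, integral_map (by fun_prop) hg.aestronglyMeasurable,
    integral_negExp_poisson]
  have hc : 0 ≤ 1 - negExp c := sub_nonneg.2 (negExp_le_one c)
  rw [← ENNReal.ofReal_toReal hfin, ← ENNReal.ofReal_mul hc, negExp_ofReal (by positivity),
    ENNReal.ofReal_toReal hfin]
  rfl

lemma integral_negExp_sum (hN : IsPoissonProcess P μ N) [IsProbabilityMeasure P]
    {ι : Type*} [Fintype ι] (B : ι → Set E) (hB : ∀ i, MeasurableSet (B i))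
    (hd : Pairwise fun i j => Disjoint (B i) (B j)) (hfin : ∀ i, μ (B i) ≠ ∞) (c : ι → ℝ≥0∞) :
    ∫ ω, negExp (∑ i, c i * N ω (B i)) ∂P =
      negExp (∑ i, ENNReal.ofReal (1 - negExp (c i)) * μ (B i)) := by
  let e := Fintype.equivFin ι
  have hind := hN.indep _ (fun k => B (e.symm k)) (fun k => hB _)
    (fun k l hkl => hd (e.symm.injective.ne hkl))
  have hind' : iIndepFun (fun k ω => negExp (c (e.symm k) * N ω (B (e.symm k)))) P :=
    hind.comp (fun k y => negExp (c (e.symm k) * y))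
      fun k => measurable_negExp.comp (measurable_const.mul measurable_id)
  simp only [negExp_sum]
  calc _ = ∫ ω, ∏ k, negExp (c (e.symm k) * N ω (B (e.symm k))) ∂P := by
        congr with ω
        exact (e.symm.prod_comp fun i => negExp (c i * N ω (B i))).symm
    _ = ∏ k, ∫ ω, negExp (c (e.symm k) * N ω (B (e.symm k))) ∂P := by
        refine hind'.integral_fun_prod_eq_prod_integral fun k => ?_
        exact (measurable_negExp.comp (measurable_const.mul
          ((Measure.measurable_coe (hB _)).comp hN.measurable))).aestronglyMeasurable
    _ = ∏ k, negExp (ENNReal.ofReal (1 - negExp (c (e.symm k))) * μ (B (e.symm k))) :=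
        Finset.prod_congr rfl fun k _ => hN.integral_negExp_mul (hB _) (hfin _) _
    _ = _ := e.symm.prod_comp fun i => negExp (ENNReal.ofReal (1 - negExp (c i)) * μ (B i))

/-- The level sets are disjoint, so the counts on them are independent Poisson variables. -/
lemma integral_negExp_simpleFunc (hN : IsPoissonProcess P μ N) [IsProbabilityMeasure P]
    (g : SimpleFunc E ℝ≥0∞) (hg : ∀ y, y ≠ 0 → μ (g ⁻¹' {y}) ≠ ∞) :
    ∫ ω, negExp (∫⁻ x, g x ∂(N ω)) ∂P =
      negExp (∫⁻ x, ENNReal.ofReal (1 - negExp (g x)) ∂μ) := by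
  classical
  -- The level `0` is dropped: its set may have infinite intensity, and it contributes nothing to
  -- either side.
  let s := g.range.filter (· ≠ 0)
  have hsum (φ : ℝ≥0∞ → ℝ≥0∞) (hφ : φ 0 = 0) (ν : Measure E) :
      ∫⁻ x, φ (g x) ∂ν = ∑ i : s, φ i * ν (g ⁻¹' {(i : ℝ≥0∞)}) := by
    have : ∫⁻ x, φ (g x) ∂ν = (g.map φ).lintegral ν :=
      SimpleFunc.lintegral_eq_lintegral (g.map φ) ν
    rw [this, SimpleFunc.map_lintegral, Finset.sum_coe_sort s (fun y => φ y * ν (g ⁻¹' {y})),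
      Finset.sum_filter_of_ne]
    rintro x - hx rfl
    simp [hφ] at hx
  have h1 := hN.integral_negExp_sum (fun i : s => g ⁻¹' {(i : ℝ≥0∞)})
    (fun i => g.measurableSet_fiber _) (fun i j hij => by
      refine Disjoint.preimage _ ?_
      simpa [Subtype.coe_inj] using hij)
    (fun i => hg _ (Finset.mem_filter.1 i.2).2) (fun i => (i : ℝ≥0∞))
  rw [hsum (fun y => ENNReal.ofReal (1 - negExp y)) (by simp [negExp_zero]), ← h1]
  congr with ω
  exact congrArg negExp (hsum id rfl (N ω))

/-- The Laplace functional of a Poisson process. -/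
theorem integral_negExp_lintegral (hN : IsPoissonProcess P μ N) [IsProbabilityMeasure P]
    [SigmaFinite μ] {f : E → ℝ≥0∞} (hf : Measurable f) :
    ∫ ω, negExp (∫⁻ x, f x ∂(N ω)) ∂P =
      negExp (∫⁻ x, ENNReal.ofReal (1 - negExp (f x)) ∂μ) := by
  -- Cutting the approximations off outside sets of finite intensity makes all nonzero levels
  -- admissible. Both integrals of `g n` increase to those of `f`, and the expectation passes to the
  -- limit by domination by `1`.
  let g : ℕ → SimpleFunc E ℝ≥0∞ := fun n =>
    (SimpleFunc.eapprox f n).restrict (spanningSets μ n)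
  have hgapp (n : ℕ) (x : E) :
      g n x = (spanningSets μ n).indicator (SimpleFunc.eapprox f n) x :=
    SimpleFunc.restrict_apply _ (measurableSet_spanningSets μ n) x
  have hgmono (x : E) : Monotone fun n => g n x := by
    intro m n hmn
    simp only [hgapp]
    refine (Set.indicator_le_indicator_of_subset (monotone_spanningSets μ hmn)
      (fun _ => zero_le) x).trans (Set.indicator_le_indicator ?_)
    exact SimpleFunc.monotone_eapprox f hmn x
  have hglim (x : E) : Tendsto (fun n => g n x) atTop (𝓝 (f x)) := by
    have h1 : Tendsto (fun n => SimpleFunc.eapprox f n x) atTop (𝓝 (f x)) := by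
      rw [← SimpleFunc.iSup_eapprox_apply hf x]
      exact tendsto_atTop_iSup fun m n hmn => SimpleFunc.monotone_eapprox f hmn x
    refine h1.congr' ?_
    filter_upwards [eventually_ge_atTop (spanningSetsIndex μ x)] with n hn
    rw [hgapp, Set.indicator_of_mem]
    exact monotone_spanningSets μ hn (mem_spanningSetsIndex μ x)
  have hlint (ν : Measure E) (φ : ℝ≥0∞ → ℝ≥0∞) (hφ : Continuous φ) (hm : Monotone φ) :
      Tendsto (fun n => ∫⁻ x, φ (g n x) ∂ν) atTop (𝓝 (∫⁻ x, φ (f x) ∂ν)) := by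
    refine lintegral_tendsto_of_tendsto_of_monotone
      (fun n => (hφ.measurable.comp (g n).measurable).aemeasurable)
      (ae_of_all _ fun x m n hmn => hm (hgmono x hmn)) (ae_of_all _ fun x => ?_)
    exact (hφ.tendsto _).comp (hglim x)
  have hL : Tendsto (fun n => ∫ ω, negExp (∫⁻ x, g n x ∂(N ω)) ∂P) atTop
      (𝓝 (∫ ω, negExp (∫⁻ x, f x ∂(N ω)) ∂P)) := by
    refine tendsto_integral_of_dominated_convergence (fun _ => 1) (fun n => ?_)
      (integrable_const _) (fun n => ae_of_all _ fun ω => ?_) (ae_of_all _ fun ω => ?_)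
    · exact (measurable_negExp.comp
        ((Measure.measurable_lintegral (g n).measurable).comp hN.measurable)).aestronglyMeasurable
    · rw [Real.norm_of_nonneg (negExp_nonneg _)]; exact negExp_le_one _
    · exact (continuous_negExp.tendsto _).comp (hlint (N ω) id continuous_id monotone_id)
  have hR : Tendsto (fun n => negExp (∫⁻ x, ENNReal.ofReal (1 - negExp (g n x)) ∂μ)) atTop
      (𝓝 (negExp (∫⁻ x, ENNReal.ofReal (1 - negExp (f x)) ∂μ))) :=
    (continuous_negExp.tendsto _).comp (hlint μ (fun y => ENNReal.ofReal (1 - negExp y))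
      (ENNReal.continuous_ofReal.comp (continuous_const.sub continuous_negExp))
      fun x y hxy => ENNReal.ofReal_le_ofReal (sub_le_sub_left (negExp_antitone hxy) 1))
  refine tendsto_nhds_unique hL (hR.congr fun n => (hN.integral_negExp_simpleFunc (g n) ?_).symm)
  intro y hy
  refine ne_top_of_le_ne_top (measure_spanningSets_lt_top μ n).ne (measure_mono fun x hx => ?_)
  by_contra hxn
  rw [Set.mem_preimage, Set.mem_singleton_iff, hgapp, Set.indicator_of_notMem hxn] at hx
  exact hy hx.symm

end IsPoissonProcess

/-! ### The integrals of `C / (C + u ^ β)` -/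

section PathLossIntegral

variable {β C : ℝ}

/-- The integral of `C / (C + u ^ β)` over `(0, 1]`. -/
noncomputable def headInt (β C : ℝ) : ℝ := ∫ u in Set.Ioc (0 : ℝ) 1, C / (C + u ^ β)

/-- The integral of `C / (C + u ^ β)` over `(1, ∞)`. -/
noncomputable def tailInt (β C : ℝ) : ℝ := ∫ u in Set.Ioi (1 : ℝ), C / (C + u ^ β)

/-- The integral of `1 / (1 + u ^ β)` over `(0, ∞)`. -/
noncomputable def fullConst (β : ℝ) : ℝ := Real.pi / β / Real.sin (Real.pi / β)

lemma fullConst_pos (hβ : 1 < β) : 0 < fullConst β := by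
  have h : Real.pi / β < Real.pi := by
    rw [div_lt_iff₀ (by linarith)]; nlinarith [Real.pi_pos]
  exact div_pos (by positivity) (Real.sin_pos_of_pos_of_lt_pi (by positivity) h)

lemma pathLoss_le_one (hC : 0 < C) {y : ℝ} (hy : 0 ≤ y) : C / (C + y) ≤ 1 := by
  rw [div_le_one (by linarith)]; linarith

lemma pathLoss_mono {C' : ℝ} (hC : 0 < C) (hCC : C ≤ C') {y : ℝ} (hy : 0 ≤ y) :
    C / (C + y) ≤ C' / (C' + y) := by
  rw [div_le_div_iff₀ (by linarith) (by linarith)]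
  nlinarith

lemma measurable_pathLoss (β C : ℝ) : Measurable fun u : ℝ => C / (C + u ^ β) := by fun_prop

lemma lintegral_exp_neg_mul_Ioi {a : ℝ} (ha : 0 < a) :
    ∫⁻ t in Set.Ioi (0 : ℝ), ENNReal.ofReal (Real.exp (-(t * a))) = ENNReal.ofReal (1 / a) := by
  have h : ∫ t in Set.Ioi (0 : ℝ), Real.exp (-(t * a)) = 1 / a := by
    have := integral_exp_mul_Ioi (neg_neg_of_pos ha) 0
    simp only [mul_zero, Real.exp_zero, neg_div_neg_eq] at this
    rw [← this]
    congr with t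
    ring_nf
  rw [← h, ofReal_integral_eq_lintegral_ofReal (.of_integral_ne_zero (by rw [h]; positivity))]
  exact ae_of_all _ fun t => (Real.exp_pos _).le

/-- Write `1 / (C + u^β)` as the integral of `exp (-t (C + u^β))` over `t > 0` and exchange the
integrals. Both resulting integrals are Gamma functions, and the reflection formula combines `Γ(1/β)
Γ(1 - 1/β)` into the sine. -/
lemma lintegral_pathLoss (hβ : 1 < β) (hC : 0 < C) :
    ∫⁻ u in Set.Ioi (0 : ℝ), ENNReal.ofReal (C / (C + u ^ β)) =
      ENNReal.ofReal (fullConst β * C ^ (1 / β)) := by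
  have hβ0 : 0 < β := by linarith
  have hb : 0 < 1 - 1 / β := by rw [sub_pos, div_lt_one hβ0]; exact hβ
  have hinner (u : ℝ) (hu : u ∈ Set.Ioi (0 : ℝ)) : ENNReal.ofReal (C / (C + u ^ β)) =
      ∫⁻ t in Set.Ioi (0 : ℝ), ENNReal.ofReal (C * Real.exp (-(t * (C + u ^ β)))) := by
    have hpos : 0 < C + u ^ β := by have := Real.rpow_pos_of_pos hu β; linarith
    simp only [ENNReal.ofReal_mul hC.le]
    rw [lintegral_const_mul _ (by fun_prop), lintegral_exp_neg_mul_Ioi hpos,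
      ← ENNReal.ofReal_mul hC.le, mul_one_div]
  rw [setLIntegral_congr_fun measurableSet_Ioi hinner, lintegral_lintegral_swap (by fun_prop)]
  have hstep (t : ℝ) (ht : t ∈ Set.Ioi (0 : ℝ)) :
      ∫⁻ u in Set.Ioi (0 : ℝ), ENNReal.ofReal (C * Real.exp (-(t * (C + u ^ β)))) =
        ENNReal.ofReal (C * Real.Gamma (1 / β + 1) *
          (t ^ ((1 - 1 / β) - 1) * Real.exp (-(C * t)))) := by
    have ht' : 0 < t := ht
    have h1 := integral_exp_neg_mul_rpow hβ0 ht'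
    have h2 : ∫⁻ u in Set.Ioi (0 : ℝ), ENNReal.ofReal (Real.exp (-t * u ^ β)) =
        ENNReal.ofReal (t ^ (-1 / β) * Real.Gamma (1 / β + 1)) := by
      rw [← h1, ofReal_integral_eq_lintegral_ofReal (.of_integral_ne_zero ?_)
        (ae_of_all _ fun t => (Real.exp_pos _).le)]
      rw [h1]
      have := Real.Gamma_pos_of_pos (show 0 < 1 / β + 1 by positivity)
      positivity
    have h3 (u : ℝ) : ENNReal.ofReal (C * Real.exp (-(t * (C + u ^ β)))) =
        ENNReal.ofReal (C * Real.exp (-(C * t))) * ENNReal.ofReal (Real.exp (-t * u ^ β)) := by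
      rw [← ENNReal.ofReal_mul (by positivity), mul_assoc, ← Real.exp_add]
      ring_nf
    simp only [h3]
    rw [lintegral_const_mul _ (by fun_prop), h2, ← ENNReal.ofReal_mul (by positivity)]
    congr 1
    rw [show (1 - 1 / β) - 1 = -1 / β by ring]
    ring
  rw [setLIntegral_congr_fun measurableSet_Ioi hstep]
  have hG1 := Real.Gamma_pos_of_pos (show 0 < 1 / β + 1 by positivity)
  have hG2 := Real.Gamma_pos_of_pos hb
  have h4 := Real.integral_rpow_mul_exp_neg_mul_Ioi hb hC
  have h5 : ∫ t in Set.Ioi (0 : ℝ), C * Real.Gamma (1 / β + 1) *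
      (t ^ ((1 - 1 / β) - 1) * Real.exp (-(C * t))) =
      C * Real.Gamma (1 / β + 1) * ((1 / C) ^ (1 - 1 / β) * Real.Gamma (1 - 1 / β)) := by
    rw [integral_const_mul, h4]
  rw [← ofReal_integral_eq_lintegral_ofReal (.of_integral_ne_zero ?_), h5]
  · congr 1
    have h6 := Real.Gamma_mul_Gamma_one_sub (1 / β)
    rw [Real.Gamma_add_one (by positivity)]
    have h7 : C * (1 / C) ^ (1 - 1 / β) = C ^ (1 / β) := by
      rw [Real.div_rpow zero_le_one hC.le, Real.one_rpow, Real.rpow_sub hC, Real.rpow_one]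
      field_simp
    calc _ = (C * (1 / C) ^ (1 - 1 / β)) * (1 / β) *
          (Real.Gamma (1 / β) * Real.Gamma (1 - 1 / β)) := by ring
      _ = _ := by
        rw [h6, h7, fullConst, mul_one_div Real.pi]
        ring
  · filter_upwards [ae_restrict_mem measurableSet_Ioi] with t ht
    have ht' : 0 < t := ht
    show 0 ≤ C * Real.Gamma (1 / β + 1) * (t ^ ((1 - 1 / β) - 1) * Real.exp (-(C * t)))
    positivity
  · rw [h5]; positivity

lemma pathLoss_nonneg (hC : 0 < C) {u : ℝ} (hu : 0 ≤ u) : 0 ≤ C / (C + u ^ β) := by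
  positivity

lemma integrableOn_pathLoss (hβ : 1 < β) (hC : 0 < C) :
    IntegrableOn (fun u : ℝ => C / (C + u ^ β)) (Set.Ioi 0) := by
  refine ⟨(measurable_pathLoss β C).aestronglyMeasurable, ?_⟩
  rw [hasFiniteIntegral_iff_ofReal, lintegral_pathLoss hβ hC]
  · exact ENNReal.ofReal_lt_top
  · filter_upwards [ae_restrict_mem measurableSet_Ioi] with u hu
    exact pathLoss_nonneg hC (le_of_lt hu)

/-- The identity behind `f_I`: the tail integral that the model calls for equals an explicit power
of `C` minus an integral over a bounded interval, which suits Gauss–Legendre quadrature. -/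
lemma headInt_add_tailInt (hβ : 1 < β) (hC : 0 < C) :
    headInt β C + tailInt β C = fullConst β * C ^ (1 / β) := by
  have hint := integrableOn_pathLoss hβ hC
  rw [headInt, tailInt, ← setIntegral_union (Set.Ioc_disjoint_Ioi le_rfl) measurableSet_Ioi
    (hint.mono_set Set.Ioc_subset_Ioi_self) (hint.mono_set (Set.Ioi_subset_Ioi zero_le_one)),
    Set.Ioc_union_Ioi_eq_Ioi zero_le_one, integral_eq_lintegral_of_nonneg_ae,
    lintegral_pathLoss hβ hC, ENNReal.toReal_ofReal]
  · have := fullConst_pos hβ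
    positivity
  · filter_upwards [ae_restrict_mem measurableSet_Ioi] with u hu
    exact pathLoss_nonneg hC (le_of_lt hu)
  · exact (measurable_pathLoss β C).aestronglyMeasurable

lemma tailInt_nonneg (hC : 0 < C) : 0 ≤ tailInt β C :=
  setIntegral_nonneg measurableSet_Ioi fun _ hu =>
    pathLoss_nonneg hC (zero_le_one.trans (le_of_lt hu))

lemma headInt_nonneg (hC : 0 < C) : 0 ≤ headInt β C :=
  setIntegral_nonneg measurableSet_Ioc fun _ hu => pathLoss_nonneg hC hu.1.le

lemma tailInt_le (hβ : 1 < β) (hC : 0 < C) : tailInt β C ≤ fullConst β * C ^ (1 / β) := by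
  linarith [headInt_add_tailInt hβ hC, headInt_nonneg (β := β) hC]

lemma headInt_le (hβ : 1 < β) (hC : 0 < C) : headInt β C ≤ fullConst β * C ^ (1 / β) := by
  linarith [headInt_add_tailInt hβ hC, tailInt_nonneg (β := β) hC]

lemma ofReal_tailInt (hβ : 1 < β) (hC : 0 < C) :
    ENNReal.ofReal (tailInt β C) = ∫⁻ u in Set.Ioi (1 : ℝ), ENNReal.ofReal (C / (C + u ^ β)) := by
  refine ofReal_integral_eq_lintegral_ofReal
    ((integrableOn_pathLoss hβ hC).mono_set (Set.Ioi_subset_Ioi zero_le_one)) ?_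
  filter_upwards [ae_restrict_mem measurableSet_Ioi] with u hu
  exact pathLoss_nonneg hC (zero_le_one.trans (le_of_lt hu))

lemma continuousOn_headInt (β : ℝ) : ContinuousOn (headInt β) (Set.Ioi 0) := by
  refine continuousOn_of_dominated (bound := fun _ => 1)
    (fun C _ => (measurable_pathLoss β C).aestronglyMeasurable) (fun C hC => ?_)
    (integrable_const 1) ?_
  · filter_upwards [ae_restrict_mem measurableSet_Ioc] with u hu
    rw [Real.norm_of_nonneg (pathLoss_nonneg hC hu.1.le)]
    exact pathLoss_le_one hC (Real.rpow_nonneg hu.1.le _)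
  · filter_upwards [ae_restrict_mem measurableSet_Ioc] with u hu
    refine continuousOn_id.div (continuousOn_id.add continuousOn_const) fun C hC => ?_
    have := Real.rpow_nonneg hu.1.le β
    have hC' : 0 < C := hC
    show C + u ^ β ≠ 0
    linarith

lemma continuousOn_tailInt (hβ : 1 < β) : ContinuousOn (tailInt β) (Set.Ioi 0) := by
  have h : ContinuousOn (fun C => fullConst β * C ^ (1 / β) - headInt β C) (Set.Ioi 0) :=
    (continuousOn_const.mul (continuousOn_id.rpow_const fun C hC => Or.inl (ne_of_gt hC))).sub
      (continuousOn_headInt β)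
  refine h.congr fun C hC => ?_
  linarith [headInt_add_tailInt hβ hC]

lemma le_headInt (hβ : 0 < β) (hC : 0 < C) : C / (C + 1) ≤ headInt β C := by
  have h : ∫ u in Set.Ioc (0 : ℝ) 1, C / (C + 1) = C / (C + 1) := by simp
  have hb (u : ℝ) (hu : u ∈ Set.Ioc (0 : ℝ) 1) : C / (C + u ^ β) ≤ 1 :=
    pathLoss_le_one hC (Real.rpow_nonneg hu.1.le _)
  rw [← h]
  refine setIntegral_mono_on (integrable_const _) ?_ measurableSet_Ioc fun u hu => ?_
  · refine (integrable_const (1 : ℝ)).mono' (measurable_pathLoss β C).aestronglyMeasurable ?_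
    filter_upwards [ae_restrict_mem measurableSet_Ioc] with u hu
    rw [Real.norm_of_nonneg (pathLoss_nonneg hC hu.1.le)]
    exact hb u hu
  · have h1 := Real.rpow_nonneg hu.1.le β
    have h2 := Real.rpow_le_one hu.1.le hu.2 hβ.le
    gcongr

/-! ### Gauss–Legendre approximation of the integral over `(0, 1]` -/

/-- The Gauss–Legendre approximation of `headInt β C`. -/
noncomputable def headSum (β : ℝ) (N : ℕ) (C : ℝ) : ℝ :=
  ∑ x ∈ glNodes N, glWeight N x / 2 * (C / (C + ((x + 1) / 2) ^ β))

lemma glNodes_mem {N : ℕ} {x : ℝ} (hx : x ∈ glNodes N) : x ∈ Set.Ioo (-1 : ℝ) 1 :=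
  (isGaussPoly_legendre N).mem_of_isRoot hx

lemma headSum_mono (N : ℕ) {C' : ℝ} (hC : 0 < C) (hCC : C ≤ C') :
    headSum β N C ≤ headSum β N C' := by
  refine Finset.sum_le_sum fun x hx => ?_
  refine mul_le_mul_of_nonneg_left (pathLoss_mono hC hCC ?_)
    (isQuadratureSeq_legendre.nonneg N x hx)
  have := (glNodes_mem hx).1
  exact Real.rpow_nonneg (by linarith) _

lemma headSum_le_one {N : ℕ} (hN : N ≠ 0) (hC : 0 < C) : headSum β N C ≤ 1 := by
  rw [← isQuadratureSeq_legendre.sum_one N hN]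
  refine Finset.sum_le_sum fun x hx => ?_
  refine mul_le_of_le_one_right (isQuadratureSeq_legendre.nonneg N x hx) (pathLoss_le_one hC ?_)
  have := (glNodes_mem hx).1
  exact Real.rpow_nonneg (by linarith) _

/-- Convergence is joint in the order and in `C`, because in `f_I` the argument `C` moves with the
outer node and with the serving distance. -/
lemma tendsto_headSum (hβ : 0 < β) (hC : 0 < C) :
    Tendsto (fun p : ℕ × ℝ => headSum β p.1 p.2) (atTop ×ˢ 𝓝 C) (𝓝 (headInt β C)) := by
  -- For `x < -1` the base of the power would be negative. Cutting it off at `0` makes the integrand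
  -- continuous and bounded on all of `ℝ` without changing it at the nodes.
  have hden (C' x : ℝ) (hC' : 0 < C') : C' + max 0 ((x + 1) / 2) ^ β ≠ 0 := by
    have := Real.rpow_nonneg (le_max_left 0 ((x + 1) / 2)) β
    linarith
  have hbound (C' x : ℝ) (hC' : 0 < C') :
      |C' / (C' + max 0 ((x + 1) / 2) ^ β)| ≤ 1 * Real.exp (0 * |x|) := by
    have := Real.rpow_nonneg (le_max_left 0 ((x + 1) / 2)) β
    rw [abs_of_nonneg (by positivity)]
    simpa using pathLoss_le_one hC' this
  have hcont : Continuous fun x : ℝ => max 0 ((x + 1) / 2) ^ β :=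
    Continuous.rpow_const (by fun_prop) fun x => Or.inr hβ.le
  have h := isQuadratureSeq_legendre.tendsto_sum (l := atTop ×ˢ 𝓝 C) (n := Prod.fst)
    tendsto_fst (h := fun p x => p.2 / (p.2 + max 0 ((x + 1) / 2) ^ β))
    (f := fun x => C / (C + max 0 ((x + 1) / 2) ^ β)) (B := 1) (κ := 0)
    (continuous_const.div (continuous_const.add hcont) fun x => hden C x hC)
    (fun x => hbound C x hC) ?_ ?_
  · have hint : ∫ x, C / (C + max 0 ((x + 1) / 2) ^ β) ∂legendreMeasure = headInt β C := by
      rw [integral_legendreMeasure]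
      have h1 := intervalIntegral.integral_comp_mul_add (a := -1) (b := 1)
        (fun u : ℝ => C / (C + max 0 u ^ β)) (c := 1 / 2) (by norm_num) (1 / 2)
      have h2 : (fun x : ℝ => C / (C + max 0 ((x + 1) / 2) ^ β)) =
          fun x => C / (C + max 0 (1 / 2 * x + 1 / 2) ^ β) := by
        funext x; congr 4; ring
      rw [h2, h1]
      norm_num
      rw [intervalIntegral.integral_of_le zero_le_one, headInt]
      refine setIntegral_congr_fun measurableSet_Ioc fun u hu => ?_
      simp only [max_eq_right hu.1.le]
    rw [hint] at h
    refine h.congr fun p => ?_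
    refine Finset.sum_congr rfl fun x hx => ?_
    have := (glNodes_mem hx).1
    rw [max_eq_right (by linarith)]
  · filter_upwards [tendsto_snd.eventually (eventually_gt_nhds hC)] with p hp x _
    exact hbound p.2 x hp
  · intro x
    have hca : ContinuousAt (fun q : ℝ × ℝ => q.1 / (q.1 + max 0 ((q.2 + 1) / 2) ^ β)) (C, x) :=
      continuousAt_fst.div (continuousAt_fst.add (hcont.continuousAt.comp continuousAt_snd))
        (hden C x hC)
    have hca' := hca.tendsto
    rw [nhds_prod_eq] at hca'
    exact hca'.comp ((tendsto_snd.comp tendsto_fst).prodMk tendsto_snd)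

lemma tendsto_headSum_sub (hβ : 0 < β) (hC : 0 < C) :
    Tendsto (fun p : ℕ × ℝ => headSum β p.1 p.2 - headInt β p.2) (atTop ×ˢ 𝓝 C) (𝓝 0) := by
  have h1 : Tendsto (headInt β) (𝓝 C) (𝓝 (headInt β C)) :=
    (continuousOn_headInt β).continuousAt (Ioi_mem_nhds hC)
  have h2 : Tendsto (fun p : ℕ × ℝ => headInt β p.2) (atTop ×ˢ 𝓝 C) (𝓝 (headInt β C)) :=
    h1.comp tendsto_snd
  simpa using (tendsto_headSum hβ hC).sub h2

lemma Filter.Tendsto.of_prod_nhds {ι X Y : Type*} [TopologicalSpace X] {l : Filter ι}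
    {m : Filter Y} {x : X} {g : ι → X → Y}
    (h : Tendsto (fun p : ι × X => g p.1 p.2) (l ×ˢ 𝓝 x) m) : Tendsto (fun i => g i x) l m := by
  have h2 : Tendsto (fun i => (i, x)) l (l ×ˢ 𝓝 x) := tendsto_id.prodMk tendsto_const_nhds
  exact h.comp h2

lemma tendsto_headSum_const (hβ : 0 < β) (hC : 0 < C) :
    Tendsto (fun N : ℕ => headSum β N C) atTop (𝓝 (headInt β C)) :=
  Tendsto.of_prod_nhds (g := headSum β) (tendsto_headSum hβ hC)

lemma eventually_headSum_le_Icc (hβ : 0 < β) {δ C₁ C₂ : ℝ} (hδ : 0 < δ) (hC₁ : 0 < C₁) :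
    ∀ᶠ N in atTop, ∀ C ∈ Set.Icc C₁ C₂, headSum β N C ≤ headInt β C + δ := by
  refine eventually_forall_mem_of_isCompact isCompact_Icc
    (p := fun N C => headSum β N C ≤ headInt β C + δ) fun C hC => ?_
  have hC0 : 0 < C := hC₁.trans_le hC.1
  filter_upwards [(tendsto_order.1 (tendsto_headSum_sub hβ hC0)).2 δ hδ] with p hp
  linarith

/-- Uniform one-sided error bound of the Gauss–Legendre approximation of `headInt`. -/
lemma eventually_headSum_le (hβ : 1 < β) {δ : ℝ} (hδ : 0 < δ) :
    ∀ᶠ N in atTop, ∀ C, 0 < C → headSum β N C ≤ headInt β C + δ := by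
  have hβ0 : 0 < β := by linarith
  -- Compactness covers only `[C₁, C₂]`. Below `C₁` the sum is controlled by its value at `C₁`,
  -- since it increases with `C`.
  obtain ⟨C₁, hC₁, hsmall⟩ : ∃ C₁ : ℝ, 0 < C₁ ∧ headInt β C₁ ≤ δ / 2 := by
    have h1 : Tendsto (fun C : ℝ => fullConst β * C ^ (1 / β)) (𝓝[>] 0) (𝓝 0) := by
      have : ContinuousAt (fun C : ℝ => fullConst β * C ^ (1 / β)) 0 :=
        continuousAt_const.mul (Real.continuousAt_rpow_const _ _ (Or.inr (by positivity)))
      have h2 := this.tendsto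
      rw [Real.zero_rpow (by positivity), mul_zero] at h2
      exact h2.mono_left nhdsWithin_le_nhds
    obtain ⟨C₁, h2, h3⟩ := (((tendsto_order.1 h1).2 (δ / 2) (by linarith)).and
      self_mem_nhdsWithin).exists
    exact ⟨C₁, h3, (headInt_le hβ h3).trans h2.le⟩
  obtain ⟨C₂, hC₂, hlarge⟩ : ∃ C₂ : ℝ, 0 < C₂ ∧ ∀ C, C₂ ≤ C → 1 ≤ headInt β C + δ := by
    -- For `C ≥ 1 / δ` the integral is at least `C / (C + 1) ≥ 1 - δ`, while the quadrature sum
    -- never exceeds `1`.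
    refine ⟨1 / δ, by positivity, fun C hC => ?_⟩
    have hC0 : 0 < C := lt_of_lt_of_le (by positivity) hC
    have h1 := le_headInt hβ0 hC0
    have h2 : 1 - δ ≤ C / (C + 1) := by
      rw [le_div_iff₀ (by linarith)]
      rw [div_le_iff₀ hδ] at hC
      nlinarith
    linarith
  have hmid := eventually_headSum_le_Icc (C₂ := C₂) hβ0 hδ hC₁
  have hC1 : ∀ᶠ N in atTop, headSum β N C₁ ≤ headInt β C₁ + δ / 2 :=
    ((tendsto_order.1 (tendsto_headSum_const hβ0 hC₁)).2 _ (by linarith)).mono fun _ h => h.le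
  filter_upwards [hmid, hC1, eventually_ne_atTop 0] with N h1 h2 hN C hC
  rcases le_total C C₁ with h | h
  · have := headInt_nonneg (β := β) hC
    linarith [headSum_mono (β := β) N hC h]
  · rcases le_total C C₂ with h' | h'
    · exact h1 C ⟨h, h'⟩
    · exact (headSum_le_one hN hC).trans (hlarge C h')

end PathLossIntegral

/-! ### The exponential distribution and the channel gains -/

instance : IsProbabilityMeasure (expMeasure 1) := isProbabilityMeasure_expMeasure one_pos

lemma expMeasure_one_eq :
    expMeasure 1 = (volume.restrict (Set.Ioi 0)).withDensity
      fun x => ENNReal.ofReal (Real.exp (-x)) := by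
  have h : exponentialPDF 1 =ᵐ[volume]
      (Set.Ioi 0).indicator fun x : ℝ => ENNReal.ofReal (Real.exp (-x)) := by
    filter_upwards [compl_mem_ae_iff.2 (measure_singleton (0 : ℝ))] with x hx
    rw [exponentialPDF_eq]
    rcases lt_or_ge 0 x with h0 | h0
    · rw [if_pos h0.le, Set.indicator_of_mem (Set.mem_Ioi.2 h0)]; simp
    · have hx' : x < 0 := lt_of_le_of_ne h0 hx
      rw [if_neg (not_le.2 hx'), Set.indicator_of_notMem (by simpa using h0)]; simp
  have h2 : expMeasure 1 = volume.withDensity (exponentialPDF 1) := rfl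
  rw [h2, withDensity_congr_ae h, withDensity_indicator measurableSet_Ioi]

lemma ae_pos_expMeasure : ∀ᵐ e ∂(expMeasure 1), 0 < e := by
  rw [expMeasure_one_eq]
  exact (withDensity_absolutelyContinuous _ _).ae_le (ae_restrict_mem measurableSet_Ioi)

/-- Allowing `y = ∞` spares a proof that the interference is almost surely finite. -/
lemma expMeasure_ge (y : ℝ≥0∞) :
    expMeasure 1 {e : ℝ | y ≤ ENNReal.ofReal e} = ENNReal.ofReal (negExp y) := by
  rcases eq_or_ne y ∞ with rfl | hy
  · simp [negExp_top]
  lift y to ℝ≥0 using hy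
  rw [expMeasure_one_eq, withDensity_apply _ (measurableSet_le measurable_const
    ENNReal.measurable_ofReal), Measure.restrict_restrict (measurableSet_le measurable_const
    ENNReal.measurable_ofReal)]
  have hset : ({e : ℝ | (y : ℝ≥0∞) ≤ ENNReal.ofReal e} ∩ Set.Ioi 0 : Set ℝ) =ᵐ[volume]
      Set.Ioi (y : ℝ) := by
    filter_upwards [compl_mem_ae_iff.2 (measure_singleton (y : ℝ))] with x hx
    have hx' : x ≠ y := hx
    refine propext ?_
    change ((y : ℝ≥0∞) ≤ ENNReal.ofReal x ∧ 0 < x) ↔ (y : ℝ) < x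
    constructor
    · rintro ⟨h1, h2⟩
      rw [ENNReal.le_ofReal_iff_toReal_le (by simp) h2.le] at h1
      exact lt_of_le_of_ne (by simpa using h1) hx'.symm
    · intro h
      have h2 : 0 < x := y.2.trans_lt h
      refine ⟨?_, h2⟩
      rw [ENNReal.le_ofReal_iff_toReal_le (by simp) h2.le]
      simpa using h.le
  have h1 := integral_exp_mul_Ioi (a := -1) (by norm_num) (y : ℝ)
  have h2 : ∫ x in Set.Ioi (y : ℝ), Real.exp (-x) = Real.exp (-y) := by
    simpa [neg_div_neg_eq] using h1
  rw [setLIntegral_congr hset, ← ofReal_integral_eq_lintegral_ofReal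
    (.of_integral_ne_zero (by rw [h2]; positivity)) (ae_of_all _ fun x => (Real.exp_pos _).le), h2,
    ← ENNReal.ofReal_coe_nnreal, negExp_ofReal y.coe_nonneg]

lemma lintegral_one_sub_exp_expMeasure {b : ℝ} (hb : 0 ≤ b) :
    ∫⁻ e, ENNReal.ofReal (1 - Real.exp (-(b * e))) ∂(expMeasure 1) =
      ENNReal.ofReal (b / (1 + b)) := by
  have hi (c : ℝ) (hc : 0 < c) : ∫ e in Set.Ioi (0 : ℝ), Real.exp (-(c * e)) = 1 / c := by
    have := integral_exp_mul_Ioi (neg_neg_of_pos hc) 0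
    simp only [mul_zero, Real.exp_zero, neg_div_neg_eq] at this
    rw [← this]
    congr with t
    ring_nf
  have hint (c : ℝ) (hc : 0 < c) : IntegrableOn (fun e => Real.exp (-(c * e))) (Set.Ioi (0 : ℝ)) :=
    .of_integral_ne_zero (by rw [hi c hc]; positivity)
  rw [expMeasure_one_eq, lintegral_withDensity_eq_lintegral_mul _ (by fun_prop) (by fun_prop)]
  have hcongr (e : ℝ) (he : e ∈ Set.Ioi (0 : ℝ)) :
      ((fun x => ENNReal.ofReal (Real.exp (-x))) *
        fun e => ENNReal.ofReal (1 - Real.exp (-(b * e)))) e =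
      ENNReal.ofReal (Real.exp (-(1 * e)) - Real.exp (-((1 + b) * e))) := by
    rw [Pi.mul_apply, ← ENNReal.ofReal_mul (Real.exp_pos _).le, mul_sub, mul_one, ← Real.exp_add]
    ring_nf
  rw [setLIntegral_congr_fun measurableSet_Ioi hcongr, ← ofReal_integral_eq_lintegral_ofReal,
    integral_sub (hint 1 one_pos) (hint (1 + b) (by linarith)), hi 1 one_pos,
    hi (1 + b) (by linarith)]
  · congr 1
    field_simp
    ring
  · exact (hint 1 one_pos).sub (hint (1 + b) (by linarith))
  · filter_upwards [ae_restrict_mem measurableSet_Ioi] with e he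
    have he' : 0 < e := he
    rw [Pi.zero_apply, sub_nonneg]
    gcongr
    linarith

namespace NetworkParams

variable {K : ℕ} (prm : NetworkParams K)

lemma gam_pos (a : ℝ) : 0 < prm.gam a := by
  unfold gam; positivity

lemma continuous_gam : Continuous prm.gam := by
  unfold gam
  exact Continuous.rpow continuous_const (by fun_prop) fun _ => Or.inl (by norm_num)

/-- The substitution `Z = √2 σ_z a + μ_z` moves the shadowing to the weight `exp (-a²)` and turns
`10^(Z/10)` into `γ(a)`. -/
lemma gaussian_eq_map_hermiteMeasure :
    gaussianReal prm.muZ (prm.sigmaZ ^ 2).toNNReal =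
      hermiteMeasure.map fun a => √2 * prm.sigmaZ * a + prm.muZ := by
  have h : (fun a : ℝ => √2 * prm.sigmaZ * a + prm.muZ) =
      (fun x => x + prm.muZ) ∘ (fun x => (√2 * prm.sigmaZ) * x) := rfl
  rw [h, ← Measure.map_map (by fun_prop) (by fun_prop), gaussianReal_map_const_mul,
    gaussianReal_map_add_const]
  congr 1
  · simp
  · ext
    simp only [NNReal.coe_mul, NNReal.coe_mk, Real.coe_toNNReal _ (sq_nonneg prm.sigmaZ)]
    rw [mul_pow, Real.sq_sqrt (by norm_num)]
    push_cast
    ring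

lemma gainLaw_eq :
    prm.gainLaw = (hermiteMeasure.prod (expMeasure 1)).map fun p => prm.gam p.1 * p.2 := by
  have hid : expMeasure 1 = (expMeasure 1).map id := Measure.map_id.symm
  rw [gainLaw, gaussian_eq_map_hermiteMeasure]
  conv_lhs => rw [hid]
  have h10 : Measurable fun x : ℝ => (10 : ℝ) ^ (x / 10) :=
    (Continuous.rpow continuous_const (by fun_prop) fun _ => Or.inl (by norm_num)).measurable
  rw [Measure.map_prod_map _ _ (by fun_prop) measurable_id,
    Measure.map_map (g := fun p : ℝ × ℝ => (10 : ℝ) ^ (p.1 / 10) * p.2)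
      ((h10.comp measurable_fst).mul measurable_snd) (by fun_prop)]
  rfl

lemma measurable_gam_mul : Measurable fun p : ℝ × ℝ => prm.gam p.1 * p.2 :=
  (prm.continuous_gam.measurable.comp measurable_fst).mul measurable_snd

instance : IsProbabilityMeasure prm.gainLaw := by
  rw [gainLaw_eq]
  exact Measure.isProbabilityMeasure_map prm.measurable_gam_mul.aemeasurable

lemma lintegral_gainLaw {f : ℝ → ℝ≥0∞} (hf : Measurable f) :
    ∫⁻ g, f g ∂prm.gainLaw = ∫⁻ a, ∫⁻ e, f (prm.gam a * e) ∂(expMeasure 1) ∂hermiteMeasure := by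
  rw [gainLaw_eq, lintegral_map hf prm.measurable_gam_mul]
  exact lintegral_prod _ (hf.comp prm.measurable_gam_mul).aemeasurable

end NetworkParams

/-! ### Radial integration in the plane -/

/-- The area of a disc is linear in its squared radius, so the squared distance pushes planar
Lebesgue measure to a multiple of Lebesgue measure on the half-line. It suffices to compare
intervals with rational endpoints, that is, areas of annuli. -/
lemma map_normSq_volume {r : ℝ} (hr : 0 < r) :
    (volume : Measure Plane).map (fun x => ‖x‖ ^ 2 / r ^ 2) =
      ENNReal.ofReal (Real.pi * r ^ 2) • (volume.restrict (Set.Ioi 0) : Measure ℝ) := by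
  have hmeas : Measurable fun x : Plane => ‖x‖ ^ 2 / r ^ 2 := by fun_prop
  symm
  have : IsLocallyFiniteMeasure
      (ENNReal.ofReal (Real.pi * r ^ 2) • (volume.restrict (Set.Ioi 0) : Measure ℝ)) := by
    change IsLocallyFiniteMeasure
      ((Real.pi * r ^ 2).toNNReal • (volume.restrict (Set.Ioi 0) : Measure ℝ))
    infer_instance
  refine Real.measure_ext_Ioo_rat fun a b => ?_
  rw [Measure.map_apply hmeas measurableSet_Ioo, Measure.smul_apply,
    Measure.restrict_apply measurableSet_Ioo, smul_eq_mul]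
  generalize (a : ℝ) = a
  generalize (b : ℝ) = b
  have hball (t : ℝ) (ht : 0 ≤ t) (x : Plane) : ‖x‖ < r * √t ↔ ‖x‖ ^ 2 / r ^ 2 < t := by
    rw [div_lt_iff₀ (by positivity), ← Real.sqrt_sq hr.le, ← Real.sqrt_mul (by positivity),
      Real.lt_sqrt (norm_nonneg _), Real.sqrt_sq hr.le, mul_comm]
  have hvol (t : ℝ) (ht : 0 ≤ t) :
      ENNReal.ofReal (r * √t) ^ 2 * ENNReal.ofReal Real.pi =
        ENNReal.ofReal (Real.pi * r ^ 2) * ENNReal.ofReal t := by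
    rw [← ENNReal.ofReal_pow (by positivity), ← ENNReal.ofReal_mul (by positivity),
      ← ENNReal.ofReal_mul (by positivity), mul_pow, Real.sq_sqrt ht]
    ring_nf
  rcases le_or_gt b 0 with hb | hb
  · have h1 : Set.Ioo a b ∩ Set.Ioi 0 = ∅ := by
      ext x; simp only [Set.mem_inter_iff, Set.mem_Ioo, Set.mem_Ioi, Set.mem_empty_iff_false, iff_false]
      rintro ⟨⟨-, h⟩, h'⟩; linarith
    have h2 : (fun x : Plane => ‖x‖ ^ 2 / r ^ 2) ⁻¹' Set.Ioo a b = ∅ := by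
      ext x; simp only [Set.mem_preimage, Set.mem_Ioo, Set.mem_empty_iff_false, iff_false, not_and]
      intro _ h
      have : 0 ≤ ‖x‖ ^ 2 / r ^ 2 := by positivity
      linarith
    rw [h1, h2]; simp
  rcases lt_or_ge a 0 with ha | ha
  · have h1 : Set.Ioo a b ∩ Set.Ioi 0 = Set.Ioo 0 b := by
      ext x; simp only [Set.mem_inter_iff, Set.mem_Ioo, Set.mem_Ioi]
      constructor
      · rintro ⟨⟨-, h⟩, h'⟩; exact ⟨h', h⟩
      · rintro ⟨h', h⟩; exact ⟨⟨by linarith, h⟩, h'⟩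
    have h2 : (fun x : Plane => ‖x‖ ^ 2 / r ^ 2) ⁻¹' Set.Ioo a b = Metric.ball 0 (r * √b) := by
      ext x
      rw [mem_ball_zero_iff, hball b hb.le]
      have : 0 ≤ ‖x‖ ^ 2 / r ^ 2 := by positivity
      exact ⟨fun h => h.2, fun h => ⟨by linarith, h⟩⟩
    rw [h1, h2, EuclideanSpace.volume_ball_fin_two, hvol b hb.le, Real.volume_Ioo, sub_zero]
  · have h1 : Set.Ioo a b ∩ Set.Ioi 0 = Set.Ioo a b := by
      refine Set.inter_eq_left.2 fun x hx => lt_of_le_of_lt ha hx.1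
    rcases le_or_gt b a with hab | hab
    · rw [h1, Set.Ioo_eq_empty (not_lt.2 hab)]; simp
    have hcball (x : Plane) : ‖x‖ ≤ r * √a ↔ ‖x‖ ^ 2 / r ^ 2 ≤ a := by
      rw [div_le_iff₀ (by positivity), ← Real.sqrt_sq hr.le, ← Real.sqrt_mul (by positivity),
        Real.le_sqrt (by positivity), Real.sqrt_sq hr.le, mul_comm]
      positivity
    have h2 : (fun x : Plane => ‖x‖ ^ 2 / r ^ 2) ⁻¹' Set.Ioo a b =
        Metric.ball 0 (r * √b) \ Metric.closedBall 0 (r * √a) := by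
      ext x
      rw [Set.mem_sdiff, mem_ball_zero_iff, mem_closedBall_zero_iff, hball b hb.le, hcball,
        Set.mem_preimage, Set.mem_Ioo, and_comm, not_le]
    have h3 : Metric.closedBall (0 : Plane) (r * √a) ⊆ Metric.ball 0 (r * √b) := by
      refine Metric.closedBall_subset_ball ?_
      gcongr
    rw [h1, h2, measure_sdiff h3 measurableSet_closedBall.nullMeasurableSet
      measure_closedBall_lt_top.ne, EuclideanSpace.volume_ball_fin_two,
      EuclideanSpace.volume_closedBall_fin_two, hvol b hb.le, hvol a ha, Real.volume_Ioo,
      ← ENNReal.mul_sub (fun _ _ => ENNReal.ofReal_ne_top), ENNReal.ofReal_sub b ha]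

lemma lintegral_norm_gt {r : ℝ} (hr : 0 < r) {f : ℝ → ℝ≥0∞} (hf : Measurable f) :
    ∫⁻ x : Plane in {x | r < ‖x‖}, f (‖x‖ ^ 2 / r ^ 2) =
      ENNReal.ofReal (Real.pi * r ^ 2) * ∫⁻ v in Set.Ioi (1 : ℝ), f v := by
  have hmeas : Measurable fun x : Plane => ‖x‖ ^ 2 / r ^ 2 := by fun_prop
  have hset : {x : Plane | r < ‖x‖} = (fun x : Plane => ‖x‖ ^ 2 / r ^ 2) ⁻¹' Set.Ioi 1 := by
    ext x
    rw [Set.mem_preimage, Set.mem_Ioi, lt_div_iff₀ (by positivity), one_mul,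
      sq_lt_sq₀ hr.le (norm_nonneg x)]
    rfl
  rw [hset, ← setLIntegral_map measurableSet_Ioi hf hmeas, map_normSq_volume hr,
    Measure.restrict_smul, lintegral_smul_measure, Measure.restrict_restrict measurableSet_Ioi,
    Set.inter_eq_left.2 (Set.Ioi_subset_Ioi zero_le_one), smul_eq_mul]

/-! ### The Laplace transform of the interference -/

namespace NetworkParams

variable {K : ℕ} (prm : NetworkParams K)

lemma zoneLam_nonneg (j : Fin K) (z : Zone) : 0 ≤ prm.zoneLam j z := by
  have h1 : (1 : ℝ) ≤ prm.reuse j := by exact_mod_cast prm.one_le_reuse j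
  have h2 := (prm.lam_pos j).le
  cases z
  · have : 0 ≤ (prm.reuse j : ℝ) - 1 := by linarith
    simp only [zoneLam]; positivity
  · simp only [zoneLam]; positivity

lemma zoneLam_add (j : Fin K) : prm.zoneLam j .center + prm.zoneLam j .edge = prm.lam j := by
  have h1 : (1 : ℝ) ≤ prm.reuse j := by exact_mod_cast prm.one_le_reuse j
  simp only [zoneLam]
  field_simp
  ring

lemma zoneRatio_pos (j : Fin K) (z : Zone) : 0 < prm.zoneRatio j z := by
  cases z
  · exact one_pos
  · exact prm.phi_pos j

instance (j : Fin K) : IsFiniteMeasure (prm.activityLaw j) := by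
  have h1 : IsFiniteMeasure (ENNReal.ofReal (prm.eps j) • Measure.dirac true) :=
    Measure.smul_finite _ ENNReal.ofReal_ne_top
  have h2 : IsFiniteMeasure (ENNReal.ofReal (1 - prm.eps j) • Measure.dirac false) :=
    Measure.smul_finite _ ENNReal.ofReal_ne_top
  unfold activityLaw
  infer_instance

instance (j : Fin K) (z : Zone) : SigmaFinite (prm.markedIntensity j z) := by
  have h1 : SigmaFinite (ENNReal.ofReal (prm.zoneLam j z) • (volume : Measure Plane)) := by
    change SigmaFinite ((prm.zoneLam j z).toNNReal • (volume : Measure Plane))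
    infer_instance
  unfold markedIntensity
  infer_instance

lemma lintegral_activityLaw (j : Fin K) (f : Bool → ℝ≥0∞) :
    ∫⁻ b, f b ∂prm.activityLaw j =
      ENNReal.ofReal (prm.eps j) * f true + ENNReal.ofReal (1 - prm.eps j) * f false := by
  rw [activityLaw, lintegral_add_measure, lintegral_smul_measure, lintegral_smul_measure,
    lintegral_dirac, lintegral_dirac]
  rfl

/-- The limit of `fI` for increasing quadrature orders. -/
noncomputable def fLim (i j : Fin K) (ψ a r : ℝ) : ℝ :=
  ∫ a₁, tailInt (prm.alpha j / 2) (prm.cFactor i j ψ a a₁ r) ∂hermiteMeasure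

lemma one_lt_alpha_div_two (j : Fin K) : 1 < prm.alpha j / 2 := by
  linarith [prm.two_lt_alpha j]

lemma cFactor_pos (i j : Fin K) {ψ : ℝ} (hψ : 0 < ψ) (a a₁ : ℝ) {r : ℝ} (hr : 0 < r) :
    0 < prm.cFactor i j ψ a a₁ r := by
  have h1 := prm.thr_pos i
  have h2 := prm.gam_pos a
  have h3 := prm.gam_pos a₁
  have h4 := prm.power_pos j
  have h5 := prm.power_pos i
  have h6 := prm.phi_pos i
  unfold cFactor
  positivity

lemma cFactor_eq (i j : Fin K) (ψ a a₁ r : ℝ) :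
    prm.cFactor i j ψ a a₁ r = prm.cFactor i j ψ a 0 r / prm.gam 0 * prm.gam a₁ := by
  have h := (prm.gam_pos 0).ne'
  unfold cFactor
  field_simp

lemma gam_le : ∃ B κ : ℝ, 0 ≤ κ ∧ ∀ a, prm.gam a ≤ B * Real.exp (κ * |a|) := by
  have hl : 0 < Real.log 10 := Real.log_pos (by norm_num)
  have hs := prm.sigmaZ_pos
  refine ⟨Real.exp (Real.log 10 * (prm.muZ / 10)), Real.log 10 * (√2 * prm.sigmaZ / 10),
    by positivity, fun a => ?_⟩
  rw [gam, Real.rpow_def_of_pos (by norm_num), ← Real.exp_add]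
  refine Real.exp_le_exp.2 ?_
  have : √2 * prm.sigmaZ * a ≤ √2 * prm.sigmaZ * |a| := by gcongr; exact le_abs_self a
  have h3 : (√2 * prm.sigmaZ * a + prm.muZ) / 10 ≤
      prm.muZ / 10 + √2 * prm.sigmaZ / 10 * |a| := by linarith
  calc _ ≤ Real.log 10 * (prm.muZ / 10 + √2 * prm.sigmaZ / 10 * |a|) := by gcongr
    _ = _ := by ring

end NetworkParams

/-! ### Growth of the tail integral in the shadowing variable, and the Laplace exponent -/

namespace NetworkParams

variable {K : ℕ} (prm : NetworkParams K)

lemma continuous_cFactor (i j : Fin K) (ψ a r : ℝ) :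
    Continuous fun a₁ => prm.cFactor i j ψ a a₁ r := by
  unfold cFactor
  have := prm.continuous_gam
  fun_prop

lemma continuous_tailInt_cFactor (i j : Fin K) {ψ : ℝ} (hψ : 0 < ψ) (a : ℝ) {r : ℝ} (hr : 0 < r) :
    Continuous fun a₁ => tailInt (prm.alpha j / 2) (prm.cFactor i j ψ a a₁ r) :=
  (continuousOn_tailInt (prm.one_lt_alpha_div_two j)).comp_continuous
    (prm.continuous_cFactor i j ψ a r) fun a₁ => prm.cFactor_pos i j hψ a a₁ hr

lemma rpow_le_one_add {x p : ℝ} (hx : 0 < x) (hp : 0 ≤ p) (hp1 : p ≤ 1) : x ^ p ≤ 1 + x := by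
  rcases le_total x 1 with h | h
  · have := Real.rpow_le_one hx.le h hp
    linarith
  · have := Real.rpow_le_rpow_of_exponent_le h hp1
    rw [Real.rpow_one] at this
    linarith

lemma tailInt_le_mul_one_add {β C : ℝ} (hβ : 1 < β) (hC : 0 < C) :
    tailInt β C ≤ fullConst β * (1 + C) := by
  refine (tailInt_le hβ hC).trans (mul_le_mul_of_nonneg_left ?_ (fullConst_pos hβ).le)
  refine rpow_le_one_add hC (by positivity) ?_
  rw [div_le_one (by linarith)]; exact hβ.le

/-- `C` depends on `a₁` only through the factor `γ(a₁)`, and the tail integral grows at most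
linearly in `C`. The dependence on `a` and `r` is thus isolated in the value of `C` at `a₁ = 0`. -/
lemma tailInt_cFactor_le (i j : Fin K) {ψ : ℝ} (hψ : 0 < ψ) :
    ∃ B κ : ℝ, 0 ≤ B ∧ ∀ a a₁ r, 0 < r →
      tailInt (prm.alpha j / 2) (prm.cFactor i j ψ a a₁ r) ≤
        B * (1 + prm.cFactor i j ψ a 0 r) * Real.exp (κ * |a₁|) := by
  obtain ⟨B, κ, hκ, hB⟩ := prm.gam_le
  have hf := fullConst_pos (prm.one_lt_alpha_div_two j)
  have hg0 := prm.gam_pos 0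
  have hB0 : 0 ≤ B := by
    have h1 := hB 0
    rw [abs_zero, mul_zero, Real.exp_zero, mul_one] at h1
    linarith
  refine ⟨fullConst (prm.alpha j / 2) * (1 + B / prm.gam 0), κ, by positivity,
    fun a a₁ r hr => ?_⟩
  have hC := prm.cFactor_pos i j hψ a a₁ hr
  have hC0 := prm.cFactor_pos i j hψ a 0 hr
  refine (tailInt_le_mul_one_add (prm.one_lt_alpha_div_two j) hC).trans ?_
  have he : 1 ≤ Real.exp (κ * |a₁|) := Real.one_le_exp (by positivity)
  have h1 : 1 + prm.cFactor i j ψ a a₁ r ≤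
      (1 + B / prm.gam 0) * (1 + prm.cFactor i j ψ a 0 r) * Real.exp (κ * |a₁|) := by
    rw [prm.cFactor_eq i j ψ a a₁ r]
    have h2 : prm.cFactor i j ψ a 0 r / prm.gam 0 * prm.gam a₁ ≤
        prm.cFactor i j ψ a 0 r / prm.gam 0 * (B * Real.exp (κ * |a₁|)) := by
      gcongr; exact hB a₁
    calc _ ≤ Real.exp (κ * |a₁|) + prm.cFactor i j ψ a 0 r / prm.gam 0 *
          (B * Real.exp (κ * |a₁|)) := add_le_add he h2
      _ = (1 + B / prm.gam 0 * prm.cFactor i j ψ a 0 r) * Real.exp (κ * |a₁|) := by ring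
      _ ≤ _ := by
        gcongr
        have h3 : 0 ≤ B / prm.gam 0 := by positivity
        nlinarith
  calc _ ≤ fullConst (prm.alpha j / 2) *
        ((1 + B / prm.gam 0) * (1 + prm.cFactor i j ψ a 0 r) * Real.exp (κ * |a₁|)) := by gcongr
    _ = _ := by ring

lemma integrable_tailInt_cFactor (i j : Fin K) {ψ : ℝ} (hψ : 0 < ψ) (a : ℝ) {r : ℝ}
    (hr : 0 < r) :
    Integrable (fun a₁ => tailInt (prm.alpha j / 2) (prm.cFactor i j ψ a a₁ r)) hermiteMeasure := by
  obtain ⟨B, κ, hB0, hB⟩ := prm.tailInt_cFactor_le i j hψ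
  refine isQuadratureSeq_hermite.integrable_of_le (B := B * (1 + prm.cFactor i j ψ a 0 r))
    (κ := κ) (prm.continuous_tailInt_cFactor i j hψ a hr).aestronglyMeasurable fun a₁ => ?_
  rw [abs_of_nonneg (tailInt_nonneg (prm.cFactor_pos i j hψ a a₁ hr))]
  exact hB a a₁ r hr

lemma fLim_nonneg (i j : Fin K) {ψ : ℝ} (hψ : 0 < ψ) (a : ℝ) {r : ℝ} (hr : 0 < r) :
    0 ≤ prm.fLim i j ψ a r :=
  integral_nonneg fun a₁ => tailInt_nonneg (prm.cFactor_pos i j hψ a a₁ hr)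

/-- The received interference from the points of a configuration `m` which are farther than
`r`. -/
noncomputable def interfTerm (j : Fin K) (z : Zone) (r : ℝ) (m : Measure (Plane × ℝ × Bool)) :
    ℝ≥0∞ :=
  ∫⁻ s in {s : Plane × ℝ × Bool | r < ‖s.1‖ ∧ s.2.2 = true},
    ENNReal.ofReal (prm.zoneRatio j z * prm.power j * s.2.1 * ‖s.1‖ ^ (-prm.alpha j)) ∂m

lemma measurableSet_active (r : ℝ) :
    MeasurableSet {s : Plane × ℝ × Bool | r < ‖s.1‖ ∧ s.2.2 = true} :=
  (measurableSet_lt measurable_const measurable_fst.norm).inter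
    (measurable_snd.snd (measurableSet_singleton true))

lemma measurable_received (j : Fin K) (z : Zone) :
    Measurable fun s : Plane × ℝ × Bool =>
      ENNReal.ofReal (prm.zoneRatio j z * prm.power j * s.2.1 * ‖s.1‖ ^ (-prm.alpha j)) := by
  fun_prop

lemma measurable_interfTerm (j : Fin K) (z : Zone) (r : ℝ) : Measurable (prm.interfTerm j z r) := by
  unfold interfTerm
  simp only [← lintegral_indicator (measurableSet_active r)]
  exact Measure.measurable_lintegral ((prm.measurable_received j z).indicator
    (measurableSet_active r))

/-- The rate `s` for which the coverage probability is the Laplace transform of the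
interference plus noise at `s`. -/
noncomputable def rate (i : Fin K) (a r : ℝ) : ℝ :=
  prm.thr i * r ^ prm.alpha i / (prm.gam a * (prm.phi i * prm.power i))

lemma rate_pos (i : Fin K) (a : ℝ) {r : ℝ} (hr : 0 < r) : 0 < prm.rate i a r := by
  have h1 := prm.thr_pos i
  have h2 := prm.gam_pos a
  have h5 := prm.power_pos i
  have h6 := prm.phi_pos i
  unfold rate
  positivity

/-- The rate times the mean received power from distance `ρ` equals `C / v^(α_j / 2)` with `v = ρ² /
r²`. This is where `C` comes from, and `v` is the variable in which area is linear. -/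
lemma rate_ratio (i j : Fin K) {ψ : ℝ} (hψ : 0 < ψ) (a a₁ : ℝ) {r ρ : ℝ} (hr : 0 < r)
    (hρ : 0 < ρ) :
    prm.rate i a r * (ψ * prm.power j) * ρ ^ (-prm.alpha j) * prm.gam a₁ /
        (1 + prm.rate i a r * (ψ * prm.power j) * ρ ^ (-prm.alpha j) * prm.gam a₁) =
      prm.cFactor i j ψ a a₁ r / (prm.cFactor i j ψ a a₁ r + (ρ ^ 2 / r ^ 2) ^ (prm.alpha j / 2)) := by
  have h1 := prm.thr_pos i
  have h2 := prm.gam_pos a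
  have h3 := prm.gam_pos a₁
  have h4 := prm.power_pos j
  have h5 := prm.power_pos i
  have h6 := prm.phi_pos i
  have hpow : (ρ ^ 2 / r ^ 2) ^ (prm.alpha j / 2) = ρ ^ prm.alpha j / r ^ prm.alpha j := by
    rw [← div_pow, ← Real.rpow_natCast, ← Real.rpow_mul (by positivity), ← Real.div_rpow hρ.le hr.le]
    congr 1
    push_cast
    ring
  have hr1 : 0 < r ^ prm.alpha i := Real.rpow_pos_of_pos hr _
  have hr2 : 0 < r ^ prm.alpha j := Real.rpow_pos_of_pos hr _
  have hρ2 : 0 < ρ ^ prm.alpha j := Real.rpow_pos_of_pos hρ _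
  rw [hpow, rate, cFactor, Real.rpow_neg hρ.le, Real.rpow_sub hr]
  field_simp
  ring

/-- The variables are integrated out one by one. The activity mark leaves the factor `ε_j`; the
exponential part of the gain turns `1 - exp (-b e)` into `b / (1 + b)`; the position, in the
variable `ρ² / r² > 1`, yields `π r²` times the tail integral; the shadowing of the interferer gives
the outer Gaussian average. -/
lemma lintegral_laplace_exponent (i j : Fin K) (z : Zone) (a : ℝ) {r : ℝ} (hr : 0 < r) :
    ∫⁻ s, ENNReal.ofReal (1 - negExp
        ({s : Plane × ℝ × Bool | r < ‖s.1‖ ∧ s.2.2 = true}.indicator (fun s =>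
          ENNReal.ofReal (prm.rate i a r) * ENNReal.ofReal
            (prm.zoneRatio j z * prm.power j * s.2.1 * ‖s.1‖ ^ (-prm.alpha j))) s))
        ∂prm.markedIntensity j z =
      ENNReal.ofReal (prm.eps j * prm.zoneLam j z * (Real.pi * r ^ 2) *
        prm.fLim i j (prm.zoneRatio j z) a r) := by
  have hrate := prm.rate_pos i a hr
  have hψ := prm.zoneRatio_pos j z
  have hP := prm.power_pos j
  set S := {s : Plane × ℝ × Bool | r < ‖s.1‖ ∧ s.2.2 = true}
  set β := prm.alpha j / 2
  have hβ : 1 < β := prm.one_lt_alpha_div_two j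
  have hFm : Measurable fun s : Plane × ℝ × Bool => ENNReal.ofReal (1 - negExp
      (S.indicator (fun s => ENNReal.ofReal (prm.rate i a r) * ENNReal.ofReal
        (prm.zoneRatio j z * prm.power j * s.2.1 * ‖s.1‖ ^ (-prm.alpha j))) s)) :=
    ENNReal.measurable_ofReal.comp (measurable_const.sub (measurable_negExp.comp
      (((prm.measurable_received j z).const_mul _).indicator (measurableSet_active r))))
  have hin (x : Plane) : ∫⁻ y, ENNReal.ofReal (1 - negExp
      (S.indicator (fun s => ENNReal.ofReal (prm.rate i a r) * ENNReal.ofReal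
        (prm.zoneRatio j z * prm.power j * s.2.1 * ‖s.1‖ ^ (-prm.alpha j))) (x, y)))
        ∂(prm.gainLaw.prod (prm.activityLaw j)) =
      {x : Plane | r < ‖x‖}.indicator (fun x => ENNReal.ofReal (prm.eps j) *
        ∫⁻ a₁, ENNReal.ofReal (prm.cFactor i j (prm.zoneRatio j z) a a₁ r /
          (prm.cFactor i j (prm.zoneRatio j z) a a₁ r + (‖x‖ ^ 2 / r ^ 2) ^ β))
            ∂hermiteMeasure) x := by
    refine (lintegral_prod _ (hFm.comp measurable_prodMk_left).aemeasurable).trans ?_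
    simp only [Function.comp]
    by_cases hx : r < ‖x‖
    · rw [Set.indicator_of_mem (show x ∈ {x : Plane | r < ‖x‖} from hx)]
      have hb (g : ℝ) : ∫⁻ b, ENNReal.ofReal (1 - negExp
          (S.indicator (fun s => ENNReal.ofReal (prm.rate i a r) * ENNReal.ofReal
            (prm.zoneRatio j z * prm.power j * s.2.1 * ‖s.1‖ ^ (-prm.alpha j))) (x, g, b)))
            ∂(prm.activityLaw j) = ENNReal.ofReal (prm.eps j) * ENNReal.ofReal (1 - negExp
            (ENNReal.ofReal (prm.rate i a r) * ENNReal.ofReal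
              (prm.zoneRatio j z * prm.power j * g * ‖x‖ ^ (-prm.alpha j)))) := by
        rw [lintegral_activityLaw, Set.indicator_of_mem (show (x, g, true) ∈ S from ⟨hx, rfl⟩),
          Set.indicator_of_notMem (show (x, g, false) ∉ S from fun h => by simp [S] at h)]
        simp [negExp_zero]
      simp only [hb]
      have hgm : Measurable fun g : ℝ => ENNReal.ofReal (1 - negExp
          (ENNReal.ofReal (prm.rate i a r) * ENNReal.ofReal
            (prm.zoneRatio j z * prm.power j * g * ‖x‖ ^ (-prm.alpha j)))) :=
        ENNReal.measurable_ofReal.comp (measurable_const.sub (measurable_negExp.comp (by fun_prop)))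
      rw [lintegral_const_mul _ hgm, prm.lintegral_gainLaw hgm]
      congr 1
      refine lintegral_congr fun a₁ => ?_
      have hx0 : 0 < ‖x‖ := hr.trans hx
      have hga := prm.gam_pos a₁
      have hxp : 0 < ‖x‖ ^ (-prm.alpha j) := Real.rpow_pos_of_pos hx0 _
      rw [← prm.rate_ratio i j hψ a a₁ hr hx0, ← lintegral_one_sub_exp_expMeasure (by positivity)]
      refine lintegral_congr_ae ?_
      filter_upwards [ae_pos_expMeasure] with e he
      rw [← ENNReal.ofReal_mul hrate.le, negExp_ofReal (by positivity)]
      congr 4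
      ring
    · rw [Set.indicator_of_notMem (show x ∉ {x : Plane | r < ‖x‖} from hx)]
      have hb (g : ℝ) (b : Bool) : S.indicator (fun s => ENNReal.ofReal (prm.rate i a r) *
          ENNReal.ofReal (prm.zoneRatio j z * prm.power j * s.2.1 * ‖s.1‖ ^ (-prm.alpha j)))
            (x, g, b) = 0 :=
        Set.indicator_of_notMem (fun h => hx h.1) _
      simp [hb, negExp_zero]
  have hcm : Measurable fun a₁ => prm.cFactor i j (prm.zoneRatio j z) a a₁ r :=
    (prm.continuous_cFactor i j _ a r).measurable
  have hjm : Measurable fun p : Plane × ℝ =>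
      ENNReal.ofReal (prm.cFactor i j (prm.zoneRatio j z) a p.2 r /
        (prm.cFactor i j (prm.zoneRatio j z) a p.2 r + (‖p.1‖ ^ 2 / r ^ 2) ^ β)) := by
    have h1 : Measurable fun p : Plane × ℝ => prm.cFactor i j (prm.zoneRatio j z) a p.2 r :=
      hcm.comp measurable_snd
    fun_prop
  rw [markedIntensity, lintegral_prod _ hFm.aemeasurable]
  simp only [hin]
  have hset : MeasurableSet {x : Plane | r < ‖x‖} :=
    measurableSet_lt measurable_const measurable_norm
  rw [lintegral_smul_measure, lintegral_indicator hset,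
    lintegral_const_mul _ hjm.lintegral_prod_right, lintegral_lintegral_swap hjm.aemeasurable]
  have hrad (a₁ : ℝ) : ∫⁻ x : Plane in {x | r < ‖x‖},
      ENNReal.ofReal (prm.cFactor i j (prm.zoneRatio j z) a a₁ r /
        (prm.cFactor i j (prm.zoneRatio j z) a a₁ r + (‖x‖ ^ 2 / r ^ 2) ^ β)) =
      ENNReal.ofReal (Real.pi * r ^ 2) *
        ENNReal.ofReal (tailInt β (prm.cFactor i j (prm.zoneRatio j z) a a₁ r)) := by
    rw [ofReal_tailInt hβ (prm.cFactor_pos i j hψ a a₁ hr)]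
    exact lintegral_norm_gt hr (f := fun v => ENNReal.ofReal
      (prm.cFactor i j (prm.zoneRatio j z) a a₁ r /
        (prm.cFactor i j (prm.zoneRatio j z) a a₁ r + v ^ β))) (by fun_prop)
  have htm : Measurable fun a₁ =>
      ENNReal.ofReal (tailInt β (prm.cFactor i j (prm.zoneRatio j z) a a₁ r)) :=
    ENNReal.measurable_ofReal.comp (prm.continuous_tailInt_cFactor i j hψ a hr).measurable
  simp only [hrad]
  rw [lintegral_const_mul _ htm,
    ← ofReal_integral_eq_lintegral_ofReal (prm.integrable_tailInt_cFactor i j hψ a hr)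
      (ae_of_all _ fun a₁ => tailInt_nonneg (prm.cFactor_pos i j hψ a a₁ hr)),
    ← ENNReal.ofReal_mul (by positivity), ← ENNReal.ofReal_mul (prm.eps_nonneg j), smul_eq_mul,
    ← ENNReal.ofReal_mul (prm.zoneLam_nonneg j z), fLim]
  congr 1
  ring

end NetworkParams

lemma IsNetwork.integral_negExp_interfTerm {K : ℕ} {prm : NetworkParams K} {Ω : Type*}
    [MeasurableSpace Ω] {P : Measure Ω} [IsProbabilityMeasure P] {Φ : Fin K → Ω → Measure Plane}
    {Θ : Fin K → Zone → Ω → Measure (Plane × ℝ × Bool)} {G : Fin K → Ω → ℝ}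
    (hN : IsNetwork prm P Φ Θ G) (i j : Fin K) (z : Zone) (a : ℝ) {r : ℝ} (hr : 0 < r) :
    ∫ ω, negExp (ENNReal.ofReal (prm.rate i a r) * prm.interfTerm j z r (Θ j z ω)) ∂P =
      Real.exp (-(prm.eps j * prm.zoneLam j z * (Real.pi * r ^ 2) *
        prm.fLim i j (prm.zoneRatio j z) a r)) := by
  have h := (hN.poisson_interf j z).integral_negExp_lintegral
    (((prm.measurable_received j z).const_mul (ENNReal.ofReal (prm.rate i a r))).indicator
      (NetworkParams.measurableSet_active r))
  rw [prm.lintegral_laplace_exponent i j z a hr, negExp_ofReal] at h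
  · rw [← h]
    congr with ω
    rw [lintegral_indicator (NetworkParams.measurableSet_active r),
      lintegral_const_mul _ (prm.measurable_received j z)]
    rfl
  · have h1 := prm.eps_nonneg j
    have h2 := prm.zoneLam_nonneg j z
    have h3 := prm.fLim_nonneg i j (prm.zoneRatio_pos j z) a hr
    positivity

/-! ### The conditional coverage probability -/

/-- The two kinds of cells as truth values. -/
def zoneEquiv : Bool ≃ Zone where
  toFun b := cond b .center .edge
  invFun z := match z with
    | .center => true
    | .edge => false
  left_inv b := by cases b <;> rfl
  right_inv z := by cases z <;> rfl

instance : Fintype Zone := Fintype.ofEquiv Bool zoneEquiv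

lemma sum_zone {M : Type*} [AddCommMonoid M] (f : Zone → M) :
    ∑ z, f z = f .center + f .edge := by
  rw [← zoneEquiv.sum_comp, Fintype.sum_bool]; rfl

namespace NetworkParams

variable {K : ℕ} (prm : NetworkParams K)

/-- The limit of the summands of `condCoverageClosed` for increasing quadrature orders. -/
noncomputable def coverageTerm (i : Fin K) (a r : ℝ) : ℝ :=
  Real.exp (-(prm.thr i * r ^ prm.alpha i / prm.gam a * prm.invEdgeSnr i)) *
    Real.exp (-Real.pi * r ^ 2 * ∑ j, prm.eps j *
      (prm.zoneLam j .center * prm.fLim i j 1 a r +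
        prm.zoneLam j .edge * prm.fLim i j (prm.phi j) a r))

lemma coverageTerm_pos (i : Fin K) (a r : ℝ) : 0 < prm.coverageTerm i a r := by
  unfold coverageTerm; positivity

end NetworkParams

section Coverage

variable {K : ℕ} {prm : NetworkParams K} {Ω : Type*} [MeasurableSpace Ω] {P : Measure Ω}
  {Φ : Fin K → Ω → Measure Plane} {Θ : Fin K → Zone → Ω → Measure (Plane × ℝ × Bool)}
  {G : Fin K → Ω → ℝ}

lemma interference_eq_sum {Ω : Type*} (prm : NetworkParams K)
    (Θ : Fin K → Zone → Ω → Measure (Plane × ℝ × Bool)) (r : ℝ) (ω : Ω) :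
    interference prm Θ r ω = ∑ k : Fin K × Zone, prm.interfTerm k.1 k.2 r (Θ k.1 k.2 ω) := by
  rw [Fintype.sum_prod_type]
  simp only [sum_zone]
  rw [Finset.sum_add_distrib]
  rfl

/-- The interference as a function of the configurations of base stations. -/
noncomputable def interfFun (prm : NetworkParams K) (r : ℝ)
    (θ : Fin K → Zone → Measure (Plane × ℝ × Bool)) : ℝ≥0∞ :=
  interference prm (fun j z θ => θ j z) r θ

lemma measurable_interfFun (prm : NetworkParams K) (r : ℝ) : Measurable (interfFun prm r) := by
  have h : interfFun prm r = fun θ => ∑ k : Fin K × Zone, prm.interfTerm k.1 k.2 r (θ k.1 k.2) := by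
    funext θ; exact interference_eq_sum prm _ r θ
  rw [h]
  refine Finset.measurable_sum _ fun k _ => (prm.measurable_interfTerm k.1 k.2 r).comp ?_
  exact (measurable_pi_apply k.2).comp (measurable_pi_apply k.1)

namespace IsNetwork

lemma measurable_interf (hN : IsNetwork prm P Φ Θ G) : Measurable fun ω j z => Θ j z ω :=
  measurable_pi_lambda _ fun j => measurable_pi_lambda _ fun z => (hN.poisson_interf j z).measurable

/-- The noise is deterministic and the fields of the different tiers and kinds of cells are
independent, so the transform factorises and the exponents add. -/
lemma integral_negExp_interference [IsProbabilityMeasure P] (hN : IsNetwork prm P Φ Θ G)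
    (i : Fin K) (a : ℝ) {r : ℝ} (hr : 0 < r) :
    ∫ ω, negExp (ENNReal.ofReal (prm.rate i a r) *
      (interference prm Θ r ω + ENNReal.ofReal prm.noise)) ∂P = prm.coverageTerm i a r := by
  have hind : iIndepFun (fun (k : Fin K × Zone) ω =>
      negExp (ENNReal.ofReal (prm.rate i a r) * prm.interfTerm k.1 k.2 r (Θ k.1 k.2 ω))) P :=
    hN.indep_interf.comp (fun k m => negExp (ENNReal.ofReal (prm.rate i a r) *
      prm.interfTerm k.1 k.2 r m)) fun k => measurable_negExp.comp
        ((prm.measurable_interfTerm k.1 k.2 r).const_mul _)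
  have hpt (ω : Ω) : negExp (ENNReal.ofReal (prm.rate i a r) *
      (interference prm Θ r ω + ENNReal.ofReal prm.noise)) =
      Real.exp (-(prm.rate i a r * prm.noise)) * ∏ k : Fin K × Zone,
        negExp (ENNReal.ofReal (prm.rate i a r) * prm.interfTerm k.1 k.2 r (Θ k.1 k.2 ω)) := by
    have hr0 := (prm.rate_pos i a hr).le
    rw [interference_eq_sum, mul_add, negExp_add, Finset.mul_sum, negExp_sum,
      ← ENNReal.ofReal_mul hr0, negExp_ofReal (mul_nonneg hr0 prm.noise_nonneg), mul_comm]
  simp only [hpt]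
  rw [integral_const_mul, hind.integral_fun_prod_eq_prod_integral fun k =>
    (measurable_negExp.comp (((prm.measurable_interfTerm k.1 k.2 r).comp
      (hN.poisson_interf k.1 k.2).measurable).const_mul _)).aestronglyMeasurable]
  simp only [hN.integral_negExp_interfTerm i _ _ a hr]
  rw [← Real.exp_sum, Fintype.sum_prod_type]
  simp only [sum_zone, NetworkParams.zoneRatio]
  rw [NetworkParams.coverageTerm, NetworkParams.rate, NetworkParams.invEdgeSnr]
  congr 2
  · have h1 := (prm.gam_pos a).ne'
    have h2 := (prm.phi_pos i).ne'
    have h3 := (prm.power_pos i).ne'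
    field_simp
  · rw [Finset.mul_sum]
    exact Finset.sum_congr rfl fun j _ => by ring

/-- The ratio is taken in `[0, ∞]`; since the received power is positive and finite, the inequality
can be solved for `e` even when `y` is `0` or `∞`. -/
lemma le_sinr_iff {r g : ℝ} (i : Fin K) (hr : 0 < r) (a e : ℝ) (he : 0 < e) (y : ℝ≥0∞)
    (hg : g = prm.gam a * e) :
    ENNReal.ofReal (prm.thr i) ≤
      ENNReal.ofReal (prm.phi i * prm.power i * g * r ^ (-prm.alpha i)) / y ↔
      ENNReal.ofReal (prm.rate i a r) * y ≤ ENNReal.ofReal e := by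
  have h1 := prm.thr_pos i
  have h2 := prm.gam_pos a
  have h5 := prm.power_pos i
  have h6 := prm.phi_pos i
  have hra : 0 < r ^ prm.alpha i := Real.rpow_pos_of_pos hr _
  set c := prm.gam a * prm.phi i * prm.power i / r ^ prm.alpha i with hc
  have hc0 : 0 < c := by positivity
  have e1 : prm.phi i * prm.power i * g * r ^ (-prm.alpha i) = c * e := by
    rw [hg, Real.rpow_neg hr.le, hc]; field_simp
  have e2 : prm.rate i a r = prm.thr i / c := by
    rw [NetworkParams.rate, hc]; field_simp
  have hce : 0 < c * e := by positivity
  rw [ENNReal.le_div_iff_mul_le (Or.inr (by rw [e1]; simpa using hce))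
    (Or.inr ENNReal.ofReal_ne_top), e1, e2, ENNReal.ofReal_mul hc0.le,
    ENNReal.ofReal_div_of_pos hc0]
  have hct : ENNReal.ofReal c ≠ ∞ := ENNReal.ofReal_ne_top
  have hcz : ENNReal.ofReal c ≠ 0 := by simpa using hc0
  rw [← ENNReal.mul_le_mul_iff_right hcz hct (b := ENNReal.ofReal (prm.thr i) / _ * y),
    ← mul_assoc, ENNReal.mul_div_cancel hcz hct]

lemma measurableSet_sinr_ge (prm : NetworkParams K) (i : Fin K) (r : ℝ) :
    MeasurableSet {p : ℝ≥0∞ × ℝ | ENNReal.ofReal (prm.thr i) ≤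
      ENNReal.ofReal (prm.phi i * prm.power i * p.2 * r ^ (-prm.alpha i)) /
        (p.1 + ENNReal.ofReal prm.noise)} :=
  measurableSet_le measurable_const (by fun_prop)

lemma gainLaw_sinr_ge (i : Fin K) {r : ℝ} (hr : 0 < r) (y : ℝ≥0∞) :
    prm.gainLaw (Prod.mk y ⁻¹' {p : ℝ≥0∞ × ℝ | ENNReal.ofReal (prm.thr i) ≤
      ENNReal.ofReal (prm.phi i * prm.power i * p.2 * r ^ (-prm.alpha i)) /
        (p.1 + ENNReal.ofReal prm.noise)}) =
      ∫⁻ a, ENNReal.ofReal (negExp (ENNReal.ofReal (prm.rate i a r) *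
        (y + ENNReal.ofReal prm.noise))) ∂hermiteMeasure := by
  have hSy := measurable_prodMk_left (x := y) (measurableSet_sinr_ge prm i r)
  rw [← lintegral_indicator_one hSy, prm.lintegral_gainLaw (measurable_one.indicator hSy)]
  refine lintegral_congr fun a => ?_
  rw [← expMeasure_ge, ← lintegral_indicator_one
    (measurableSet_le measurable_const ENNReal.measurable_ofReal)]
  refine lintegral_congr_ae ?_
  filter_upwards [ae_pos_expMeasure] with e he
  refine Set.indicator_eq_indicator ?_ rfl
  exact le_sinr_iff i hr a e he _ rfl

lemma measurable_rate (prm : NetworkParams K) (i : Fin K) (r : ℝ) :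
    Measurable fun a => prm.rate i a r := by
  unfold NetworkParams.rate
  have := prm.continuous_gam.measurable
  fun_prop

lemma measurable_negExp_rate (prm : NetworkParams K) (i : Fin K) (r : ℝ) {β : Type*}
    [MeasurableSpace β] {I : β → ℝ≥0∞} {f : β → ℝ} (hI : Measurable I) (hf : Measurable f) :
    Measurable fun b => ENNReal.ofReal (negExp
      (ENNReal.ofReal (prm.rate i (f b) r) * (I b + ENNReal.ofReal prm.noise))) := by
  refine ENNReal.measurable_ofReal.comp (measurable_negExp.comp ?_)
  have h2 : Measurable fun b => prm.rate i (f b) r := (measurable_rate prm i r).comp hf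
  fun_prop

/-- The probability that the signal-to-interference ratio at distance `r` reaches the threshold,
for a gain independent of the interference `I`, in terms of the Laplace transform of `I`. -/
theorem measureReal_sinr_ge [IsProbabilityMeasure P] {I : Ω → ℝ≥0∞} {g : Ω → ℝ}
    (hI : Measurable I) (hg : Measurable g) (hgl : P.map g = prm.gainLaw) (hind : IndepFun I g P)
    (i : Fin K) {r : ℝ} (hr : 0 < r) {c : ℝ → ℝ} (hc : ∀ a, 0 ≤ c a)
    (hL : ∀ a, ∫ ω, negExp (ENNReal.ofReal (prm.rate i a r) *
      (I ω + ENNReal.ofReal prm.noise)) ∂P = c a) :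
    Integrable c hermiteMeasure ∧
      P.real {ω | ENNReal.ofReal (prm.thr i) ≤
        ENNReal.ofReal (prm.phi i * prm.power i * g ω * r ^ (-prm.alpha i)) /
          (I ω + ENNReal.ofReal prm.noise)} = ∫ a, c a ∂hermiteMeasure := by
  have hS := measurableSet_sinr_ge prm i r
  have hlaw : P.map (fun ω => (I ω, g ω)) = (P.map I).prod prm.gainLaw := by
    rw [← hgl]
    exact (indepFun_iff_map_prod_eq_prod_map_map hI.aemeasurable hg.aemeasurable).1 hind
  have hjm := measurable_negExp_rate prm i r (measurable_fst (α := ℝ≥0∞) (β := ℝ)) measurable_snd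
  have hjm2 := measurable_negExp_rate prm i r (hI.comp (measurable_fst (α := Ω) (β := ℝ)))
    measurable_snd
  have hterm (a : ℝ) : ∫⁻ ω, ENNReal.ofReal (negExp (ENNReal.ofReal (prm.rate i a r) *
        (I ω + ENNReal.ofReal prm.noise))) ∂P = ENNReal.ofReal (c a) := by
    rw [← hL a, ofReal_integral_eq_lintegral_ofReal]
    · exact integrable_negExp_comp ((hI.add_const _).const_mul _)
    · exact ae_of_all _ fun ω => negExp_nonneg _
  have hmain : P {ω | ENNReal.ofReal (prm.thr i) ≤
        ENNReal.ofReal (prm.phi i * prm.power i * g ω * r ^ (-prm.alpha i)) /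
          (I ω + ENNReal.ofReal prm.noise)} = ∫⁻ a, ENNReal.ofReal (c a) ∂hermiteMeasure := by
    have h1 := Measure.map_apply (μ := P) (hI.prodMk hg) hS
    rw [hlaw, Measure.prod_apply hS] at h1
    refine h1.symm.trans ?_
    simp only [gainLaw_sinr_ge i hr]
    -- Tonelli brings the shadowing `a` outside, so that the inner integral is the Laplace transform
    -- at the rate belonging to `a`.
    rw [lintegral_map hjm.lintegral_prod_right hI, lintegral_lintegral_swap hjm2.aemeasurable]
    simp only [hterm]
  -- `c` is given only through its values, so its measurability is read off from that of the
  -- parametrised integral.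
  have hmeas : Measurable c := by
    have h1 := hjm2.lintegral_prod_left' (μ := P)
    simp only [Function.comp_apply, hterm] at h1
    have h2 := h1.ennreal_toReal
    simpa only [ENNReal.toReal_ofReal (hc _)] using h2
  have hpos : 0 ≤ᵐ[hermiteMeasure] c := ae_of_all _ hc
  refine ⟨⟨hmeas.aestronglyMeasurable, ?_⟩, ?_⟩
  · rw [hasFiniteIntegral_iff_ofReal hpos, ← hmain]
    exact measure_lt_top _ _
  · rw [measureReal_def, hmain,
      integral_eq_lintegral_of_nonneg_ae hpos hmeas.aestronglyMeasurable]

/-- The conditional coverage probability as a Gaussian integral. -/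
theorem condCoverage_eq [IsProbabilityMeasure P] (hN : IsNetwork prm P Φ Θ G) (i : Fin K) {r : ℝ}
    (hr : 0 < r) :
    Integrable (fun a => prm.coverageTerm i a r) hermiteMeasure ∧
      condCoverage prm P Θ G i r = ∫ a, prm.coverageTerm i a r ∂hermiteMeasure :=
  measureReal_sinr_ge ((measurable_interfFun prm r).comp hN.measurable_interf)
    (hN.measurable_gain i) (hN.law_gain i)
    (hN.indep_interf_gain.comp (measurable_interfFun prm r) (measurable_pi_apply i)) i hr
    (fun a => (prm.coverageTerm_pos i a r).le) fun a => hN.integral_negExp_interference i a hr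

end IsNetwork

end Coverage

/-! ### The distance to the nearest point of a Poisson process -/

lemma IsPoissonProcess.measure_eq_zero {Ω E : Type*} [MeasurableSpace Ω] [MeasurableSpace E]
    {P : Measure Ω} {μ : Measure E} {N : Ω → Measure E} (hN : IsPoissonProcess P μ N) {B : Set E}
    (hB : MeasurableSet B) (hfin : μ B ≠ ∞) :
    P {ω | N ω B = 0} = ENNReal.ofReal (Real.exp (-(μ B).toReal)) := by
  have hm : Measurable fun ω => N ω B := (Measure.measurable_coe hB).comp hN.measurable
  have h := congrArg (fun ν : Measure ℝ≥0∞ => ν {0}) (hN.law B hB hfin)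
  rw [Measure.map_apply hm (measurableSet_singleton 0),
    Measure.map_apply (by fun_prop) (measurableSet_singleton 0)] at h
  refine h.trans ?_
  have : (fun k : ℕ => (k : ℝ≥0∞)) ⁻¹' {0} = {0} := by ext k; simp
  rw [this, poissonMeasure_singleton]
  simp
  rfl

/-- The distance from the origin to the nearest point of a configuration. -/
noncomputable def nearestRadius (m : Measure Plane) : ℝ :=
  sInf {r : ℝ | 0 ≤ r ∧ m (Metric.closedBall 0 r) ≠ 0}

lemma nearestRadius_nonneg (m : Measure Plane) : 0 ≤ nearestRadius m :=
  Real.sInf_nonneg fun _ h => h.1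

lemma nearestRadius_le {m : Measure Plane} {r : ℝ} (hr : 0 ≤ r)
    (h : m (Metric.closedBall 0 r) ≠ 0) : nearestRadius m ≤ r :=
  csInf_le ⟨0, fun _ h => h.1⟩ ⟨hr, h⟩

/-- Rational radii suffice, which makes the nearest distance measurable. The zero configuration is
excluded because the infimum of the empty set is `0` by convention. -/
lemma nearestRadius_lt_iff {m : Measure Plane} {x : ℝ} (hm : m ≠ 0) :
    nearestRadius m < x ↔ ∃ q : ℚ, 0 ≤ (q : ℝ) ∧ (q : ℝ) < x ∧ m (Metric.closedBall 0 q) ≠ 0 := by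
  constructor
  · intro h
    have hne : {r : ℝ | 0 ≤ r ∧ m (Metric.closedBall 0 r) ≠ 0}.Nonempty := by
      by_contra hcon
      rw [Set.not_nonempty_iff_eq_empty] at hcon
      refine hm (Measure.measure_univ_eq_zero.1 ?_)
      rw [← Metric.iUnion_closedBall_nat (0 : Plane)]
      refine measure_iUnion_null fun n => ?_
      by_contra h0
      exact (Set.eq_empty_iff_forall_notMem.1 hcon n) ⟨n.cast_nonneg, h0⟩
    obtain ⟨r, ⟨hr0, hr⟩, hrx⟩ := exists_lt_of_csInf_lt hne h
    obtain ⟨q, hq1, hq2⟩ := exists_rat_btwn hrx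
    exact ⟨q, hr0.trans hq1.le, hq2, fun h0 =>
      hr (measure_mono_null (Metric.closedBall_subset_closedBall hq1.le) h0)⟩
  · rintro ⟨q, h0, h1, h2⟩
    exact (nearestRadius_le h0 h2).trans_lt h1

lemma nearestRadius_zero : nearestRadius 0 = 0 := by
  simp [nearestRadius]

lemma measurable_nearestRadius : Measurable nearestRadius := by
  refine measurable_of_Iio fun x => ?_
  have hz : MeasurableSet {m : Measure Plane | m = 0} := by
    have : {m : Measure Plane | m = 0} = (fun m : Measure Plane => m Set.univ) ⁻¹' {0} := by
      ext m; exact Measure.measure_univ_eq_zero.symm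
    rw [this]
    exact Measure.measurable_coe MeasurableSet.univ (measurableSet_singleton 0)
  have heq : nearestRadius ⁻¹' Set.Iio x =
      ({m | m = 0} ∩ {_m | 0 < x}) ∪ ({m | m = 0}ᶜ ∩ ⋃ q : ℚ,
        ({_m | 0 ≤ (q : ℝ) ∧ (q : ℝ) < x} ∩
          (fun m : Measure Plane => m (Metric.closedBall 0 (q : ℝ))) ⁻¹' {0}ᶜ)) := by
    ext m
    by_cases hm : m = 0
    · simp [hm, nearestRadius_zero]
    · simp [hm, nearestRadius_lt_iff hm, and_assoc]
  rw [heq]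
  refine (hz.inter (MeasurableSet.const _)).union (hz.compl.inter
    (MeasurableSet.iUnion fun q => (MeasurableSet.const _).inter ?_))
  exact Measure.measurable_coe Metric.isClosed_closedBall.measurableSet
    (measurableSet_singleton 0).compl

namespace IsPoissonProcess

variable {Ω : Type*} [MeasurableSpace Ω] {P : Measure Ω} {l : ℝ} {N : Ω → Measure Plane}

lemma measure_closedBall_eq_zero
    (hN : IsPoissonProcess P (ENNReal.ofReal l • (volume : Measure Plane)) N) (hl : 0 < l)
    {r : ℝ} (hr : 0 ≤ r) :
    P {ω | N ω (Metric.closedBall 0 r) = 0} =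
      ENNReal.ofReal (Real.exp (-(Real.pi * l * r ^ 2))) := by
  have h : (ENNReal.ofReal l • (volume : Measure Plane)) (Metric.closedBall 0 r) =
      ENNReal.ofReal (Real.pi * l * r ^ 2) := by
    rw [Measure.smul_apply, EuclideanSpace.volume_closedBall_fin_two, ← ENNReal.ofReal_pow hr,
      ← ENNReal.ofReal_mul (by positivity), smul_eq_mul, ← ENNReal.ofReal_mul hl.le]
    congr 1; ring
  rw [hN.measure_eq_zero Metric.isClosed_closedBall.measurableSet (by simp [h]), h,
    ENNReal.toReal_ofReal (by positivity)]

lemma tendsto_void (l r : ℝ) (f : ℕ → ℝ) (hf : Tendsto f atTop (𝓝 r)) :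
    Tendsto (fun n => ENNReal.ofReal (Real.exp (-(Real.pi * l * f n ^ 2)))) atTop
      (𝓝 (ENNReal.ofReal (Real.exp (-(Real.pi * l * r ^ 2))))) := by
  refine ENNReal.tendsto_ofReal ((Real.continuous_exp.tendsto _).comp ?_)
  exact ((hf.pow 2).const_mul _).neg

/-- The void probabilities of growing discs tend to zero. -/
lemma ae_ne_zero (hN : IsPoissonProcess P (ENNReal.ofReal l • (volume : Measure Plane)) N)
    (hl : 0 < l) : ∀ᵐ ω ∂P, N ω ≠ 0 := by
  have h1 (n : ℕ) : P {ω | N ω = 0} ≤ ENNReal.ofReal (Real.exp (-(Real.pi * l * (n : ℝ) ^ 2))) := by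
    rw [← hN.measure_closedBall_eq_zero hl n.cast_nonneg]
    refine measure_mono fun ω (h : N ω = 0) => ?_
    simp [h]
  have h2 : Tendsto (fun n : ℕ => ENNReal.ofReal (Real.exp (-(Real.pi * l * (n : ℝ) ^ 2)))) atTop
      (𝓝 0) := by
    rw [← ENNReal.ofReal_zero]
    refine ENNReal.tendsto_ofReal (Real.tendsto_exp_neg_atTop_nhds_zero.comp ?_)
    exact ((tendsto_pow_atTop two_ne_zero).comp tendsto_natCast_atTop_atTop).const_mul_atTop
      (by positivity)
  have h3 := ge_of_tendsto' h2 h1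
  rw [ae_iff]
  simpa using h3

lemma measurable_radius (hN : IsPoissonProcess P (ENNReal.ofReal l • (volume : Measure Plane)) N) :
    Measurable fun ω => nearestRadius (N ω) :=
  measurable_nearestRadius.comp hN.measurable

/-- The distance to the nearest point exceeds `r` with probability `exp (-π l r^2)`. -/
lemma measure_le_radius [IsProbabilityMeasure P]
    (hN : IsPoissonProcess P (ENNReal.ofReal l • (volume : Measure Plane)) N)
    (hl : 0 < l) {r : ℝ} (hr : 0 ≤ r) :
    P {ω | r ≤ nearestRadius (N ω)} = ENNReal.ofReal (Real.exp (-(Real.pi * l * r ^ 2))) := by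
  -- Emptiness of the closed disc of radius `s` lies between `s < R` and, up to a null event, `s ≤
  -- R`.
  have hlow {s : ℝ} (hs : 0 ≤ s) : ENNReal.ofReal (Real.exp (-(Real.pi * l * s ^ 2))) ≤
      P {ω | s ≤ nearestRadius (N ω)} := by
    rw [← hN.measure_closedBall_eq_zero hl hs]
    refine measure_mono_ae ?_
    filter_upwards [hN.ae_ne_zero hl] with ω hω h0
    change N ω _ = 0 at h0
    change s ≤ _
    by_contra hcon
    obtain ⟨q, -, hq2, hq3⟩ := (nearestRadius_lt_iff hω).1 (not_le.1 hcon)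
    exact hq3 (measure_mono_null (Metric.closedBall_subset_closedBall hq2.le) h0)
  have hup {s : ℝ} (hs : 0 ≤ s) : P {ω | s < nearestRadius (N ω)} ≤
      ENNReal.ofReal (Real.exp (-(Real.pi * l * s ^ 2))) := by
    rw [← hN.measure_closedBall_eq_zero hl hs]
    refine measure_mono fun ω (h : s < _) => ?_
    change N ω _ = 0
    by_contra hcon
    exact (nearestRadius_le hs hcon).not_gt h
  refine le_antisymm ?_ (hlow hr)
  rcases hr.eq_or_lt with rfl | hr
  · simpa using prob_le_one
  -- Radii strictly below `r` turn the bound for strict inequalities into one for `r ≤ R`.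
  · have hseq : Tendsto (fun n : ℕ => r * (1 - 1 / ((n : ℝ) + 1))) atTop (𝓝 r) := by
      simpa using ((tendsto_one_div_add_atTop_nhds_zero_nat (𝕜 := ℝ)).const_sub 1).const_mul r
    refine ge_of_tendsto' (tendsto_void l r _ hseq) fun n => ?_
    have h0 : 0 < 1 / ((n : ℝ) + 1) := by positivity
    have h1 : 1 / ((n : ℝ) + 1) ≤ 1 := by
      rw [div_le_one (by positivity)]; linarith [(n.cast_nonneg : (0 : ℝ) ≤ n)]
    refine le_trans (measure_mono fun ω (h : r ≤ _) => ?_) (hup (mul_nonneg hr.le (by linarith)))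
    change r * (1 - 1 / ((n : ℝ) + 1)) < nearestRadius (N ω)
    nlinarith

lemma lintegral_Ioi_radius {l a : ℝ} (hl : 0 < l) (ha : 0 ≤ a) :
    ∫⁻ r in Set.Ioi a, ENNReal.ofReal (2 * Real.pi * l * r * Real.exp (-(Real.pi * l * r ^ 2))) =
      ENNReal.ofReal (Real.exp (-(Real.pi * l * a ^ 2))) := by
  have hd (x : ℝ) : HasDerivAt (fun r => -Real.exp (-(Real.pi * l * r ^ 2)))
      (2 * Real.pi * l * x * Real.exp (-(Real.pi * l * x ^ 2))) x := by
    have h := (((hasDerivAt_pow 2 x).const_mul (Real.pi * l)).neg.exp).neg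
    refine h.congr_deriv ?_
    simp
    ring
  have hnn (x : ℝ) (hx : x ∈ Set.Ioi a) :
      0 ≤ 2 * Real.pi * l * x * Real.exp (-(Real.pi * l * x ^ 2)) := by
    have : 0 < x := ha.trans_lt hx
    positivity
  have ht : Tendsto (fun r => -Real.exp (-(Real.pi * l * r ^ 2))) atTop (𝓝 0) := by
    rw [← neg_zero]
    refine (Real.tendsto_exp_neg_atTop_nhds_zero.comp ?_).neg
    exact (tendsto_pow_atTop two_ne_zero).const_mul_atTop (by positivity)
  have hc : ContinuousWithinAt (fun r => -Real.exp (-(Real.pi * l * r ^ 2))) (Set.Ici a) a :=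
    (hd a).continuousAt.continuousWithinAt
  rw [← ofReal_integral_eq_lintegral_ofReal
    (integrableOn_Ioi_deriv_of_nonneg hc (fun x _ => hd x) hnn ht)
    (ae_restrict_of_forall_mem measurableSet_Ioi hnn),
    integral_Ioi_of_hasDerivAt_of_nonneg hc (fun x _ => hd x) hnn ht]
  simp

/-- The law of the distance to the nearest point. -/
lemma map_radius [IsProbabilityMeasure P]
    (hN : IsPoissonProcess P (ENNReal.ofReal l • (volume : Measure Plane)) N) (hl : 0 < l) :
    P.map (fun ω => nearestRadius (N ω)) = (volume.restrict (Set.Ioi 0)).withDensity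
      fun r => ENNReal.ofReal (2 * Real.pi * l * r * Real.exp (-(Real.pi * l * r ^ 2))) := by
  have : IsProbabilityMeasure (P.map fun ω => nearestRadius (N ω)) :=
    Measure.isProbabilityMeasure_map hN.measurable_radius.aemeasurable
  refine Measure.ext_of_Ici _ _ fun a => ?_
  rw [Measure.map_apply hN.measurable_radius measurableSet_Ici,
    withDensity_apply _ measurableSet_Ici, Measure.restrict_restrict measurableSet_Ici]
  rcases le_or_gt 0 a with ha | ha
  · refine (hN.measure_le_radius hl ha).trans ?_
    rw [← lintegral_Ioi_radius hl ha]
    refine setLIntegral_congr ?_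
    have h1 : (Set.Ioi a : Set ℝ) = Set.Ioi a ∩ Set.Ioi 0 := by
      ext x; simp only [Set.mem_Ioi, Set.mem_inter_iff]; exact ⟨fun h => ⟨h, ha.trans_lt h⟩, And.left⟩
    rw [h1]
    exact Ioi_ae_eq_Ici.inter (ae_eq_refl _)
  · have h1 : (Set.Ici a ∩ Set.Ioi 0 : Set ℝ) = Set.Ioi 0 :=
      Set.inter_eq_right.2 fun x hx => (ha.trans hx).le
    have h2 : (fun ω => nearestRadius (N ω)) ⁻¹' Set.Ici a = Set.univ :=
      Set.eq_univ_of_forall fun ω => ha.le.trans (nearestRadius_nonneg _)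
    rw [h1, h2, lintegral_Ioi_radius hl le_rfl]
    simp

end IsPoissonProcess

/-! ### The tier of least path loss -/

section LeastPathLoss

variable {Ω ι : Type*} [MeasurableSpace Ω] {P : Measure Ω}
  {R : ι → Ω → ℝ} {l α : ι → ℝ}

lemma rpow_le_rpow_iff_le {x y p q : ℝ} (hx : 0 ≤ x) (hy : 0 ≤ y) (hq : 0 < q) :
    x ^ p ≤ y ^ q ↔ x ^ (p / q) ≤ y := by
  have h : x ^ p = (x ^ (p / q)) ^ q := by
    rw [← Real.rpow_mul hx, div_mul_cancel₀ _ hq.ne']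
  rw [h, Real.rpow_le_rpow_iff (by positivity) hy hq]

lemma measurableSet_leastPathLoss [Countable ι] (hm : ∀ j, Measurable (R j)) (i : ι) :
    MeasurableSet {ω | ∀ j, R i ω ^ α i ≤ R j ω ^ α j} := by
  rw [Set.ofPred_forall]
  exact MeasurableSet.iInter fun j =>
    measurableSet_le ((hm i).pow_const _) ((hm j).pow_const _)

/-- For a fixed value `x` of `R i`, each competitor must satisfy `R j ≥ x^(α_i / α_j)`; by
independence the void probabilities multiply. -/
lemma measure_forall_erase [Fintype ι] [DecidableEq ι] (hR : iIndepFun R P) (h0 : ∀ j ω, 0 ≤ R j ω)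
    (hge : ∀ j r, 0 ≤ r → P {ω | r ≤ R j ω} =
      ENNReal.ofReal (Real.exp (-(Real.pi * l j * r ^ 2))))
    (hα : ∀ j, 0 < α j) (i : ι) {x : ℝ} (hx : 0 < x) :
    P {ω | ∀ j ∈ Finset.univ.erase i, x ^ α i ≤ R j ω ^ α j} =
      ENNReal.ofReal (Real.exp (-Real.pi * ∑ j ∈ Finset.univ.erase i,
        l j * x ^ (2 * α i / α j))) := by
  have h1 : {ω | ∀ j ∈ Finset.univ.erase i, x ^ α i ≤ R j ω ^ α j} =
      ⋂ j ∈ Finset.univ.erase i, R j ⁻¹' Set.Ici (x ^ (α i / α j)) := by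
    ext ω
    simp only [Set.mem_ofPred_eq, Set.mem_iInter, Set.mem_preimage, Set.mem_Ici]
    exact forall₂_congr fun j _ => rpow_le_rpow_iff_le hx.le (h0 j ω) (hα j)
  rw [h1, hR.measure_inter_preimage_eq_mul _ fun _ _ => measurableSet_Ici]
  have h2 (j : ι) : P (R j ⁻¹' Set.Ici (x ^ (α i / α j))) =
      ENNReal.ofReal (Real.exp (-(Real.pi * (l j * x ^ (2 * α i / α j))))) := by
    refine (hge j _ (by positivity)).trans ?_
    rw [← Real.rpow_natCast, ← Real.rpow_mul hx.le, mul_assoc]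
    congr 6
    push_cast
    ring
  simp only [h2]
  rw [← ENNReal.ofReal_prod_of_nonneg fun _ _ => (Real.exp_pos _).le, ← Real.exp_sum,
    Finset.mul_sum]
  simp

/-- The distribution of `R i` on the event that `R i ^ α i` is least. -/
theorem map_restrict_leastPathLoss [IsProbabilityMeasure P] [Fintype ι] (hR : iIndepFun R P) (hm : ∀ j, Measurable (R j))
    (h0 : ∀ j ω, 0 ≤ R j ω)
    (hge : ∀ j r, 0 ≤ r → P {ω | r ≤ R j ω} =
      ENNReal.ofReal (Real.exp (-(Real.pi * l j * r ^ 2))))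
    (hα : ∀ j, 0 < α j) (i : ι) (hl : 0 < l i)
    (hlaw : P.map (R i) = (volume.restrict (Set.Ioi 0)).withDensity fun r =>
      ENNReal.ofReal (2 * Real.pi * l i * r * Real.exp (-(Real.pi * l i * r ^ 2)))) :
    (P.restrict {ω | ∀ j, R i ω ^ α i ≤ R j ω ^ α j}).map (R i) =
      (volume.restrict (Set.Ioi 0)).withDensity fun r => ENNReal.ofReal
        (2 * Real.pi * l i * r * Real.exp (-Real.pi * ∑ j, l j * r ^ (2 * α i / α j))) := by
  classical
  ext B hB
  set s : Finset ι := Finset.univ.erase i with hs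
  have hXY : IndepFun (R i) (fun ω (j : s) => R j ω) P := by
    have h := hR.indepFun_finset {i} s (by simp [hs]) hm
    exact h.comp (φ := fun f : ({i} : Finset ι) → ℝ => f ⟨i, by simp⟩) (ψ := id)
      (measurable_pi_apply _) measurable_id
  have hYm : Measurable fun ω (j : s) => R j ω := measurable_pi_lambda _ fun j => hm j
  have hT : MeasurableSet {p : ℝ × (s → ℝ) | p.1 ∈ B ∧ ∀ j, p.1 ^ α i ≤ p.2 j ^ α j} := by
    have h1 : MeasurableSet {p : ℝ × (s → ℝ) | ∀ j, p.1 ^ α i ≤ p.2 j ^ α j} := by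
      rw [Set.ofPred_forall]
      refine MeasurableSet.iInter fun j => measurableSet_le (measurable_fst.pow_const _) ?_
      exact ((measurable_pi_apply j).comp measurable_snd).pow_const _
    exact (measurable_fst hB).inter h1
  have hset : R i ⁻¹' B ∩ {ω | ∀ j, R i ω ^ α i ≤ R j ω ^ α j} =
      (fun ω => (R i ω, fun j : s => R j ω)) ⁻¹'
        {p : ℝ × (s → ℝ) | p.1 ∈ B ∧ ∀ j, p.1 ^ α i ≤ p.2 j ^ α j} := by
    ext ω
    simp only [Set.mem_inter_iff, Set.mem_preimage, Set.mem_ofPred_eq, Subtype.forall]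
    refine and_congr_right fun _ => ⟨fun h j _ => h j, fun h j => ?_⟩
    by_cases hj : j = i
    · rw [hj]
    · exact h j (by simp [hs, hj])
  have hslice (x : ℝ) (hx : 0 < x) : P.map (fun ω (j : s) => R j ω) (Prod.mk x ⁻¹'
      {p : ℝ × (s → ℝ) | p.1 ∈ B ∧ ∀ j, p.1 ^ α i ≤ p.2 j ^ α j}) =
      B.indicator (fun x => ENNReal.ofReal (Real.exp (-Real.pi * ∑ j ∈ s,
        l j * x ^ (2 * α i / α j)))) x := by
    rw [Measure.map_apply hYm (measurable_prodMk_left hT)]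
    by_cases hxB : x ∈ B
    · rw [Set.indicator_of_mem hxB, ← measure_forall_erase hR h0 hge hα i hx]
      congr 1
      ext ω
      simp [hxB, hs]
    · rw [Set.indicator_of_notMem hxB]
      convert measure_empty (μ := P)
      ext ω
      simp [hxB]
  rw [Measure.map_apply (hm i) hB, Measure.restrict_apply (hm i hB), hset,
    ← Measure.map_apply ((hm i).prodMk hYm) hT,
    (indepFun_iff_map_prod_eq_prod_map_map (hm i).aemeasurable hYm.aemeasurable).1 hXY,
    Measure.prod_apply hT, hlaw, lintegral_withDensity_eq_lintegral_mul _ (by fun_prop)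
      (measurable_measure_prodMk_left hT), withDensity_apply _ hB, ← lintegral_indicator hB]
  refine setLIntegral_congr_fun measurableSet_Ioi fun x (hx : 0 < x) => ?_
  simp only [Pi.mul_apply]
  rw [hslice x hx]
  by_cases hxB : x ∈ B
  -- The term `j = i` of the full sum, with exponent `2 α_i / α_i = 2`, is supplied by the density
  -- of `R i` itself.
  · rw [Set.indicator_of_mem hxB, Set.indicator_of_mem hxB, ← ENNReal.ofReal_mul (by positivity),
      mul_assoc, ← Real.exp_add, ← Finset.add_sum_erase _ _ (Finset.mem_univ i)]
    congr 3
    rw [mul_div_assoc, div_self (hα i).ne', mul_one, show ((2 : ℝ)) = ((2 : ℕ) : ℝ) by norm_num,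
      Real.rpow_natCast]
    push_cast
    ring
  · rw [Set.indicator_of_notMem hxB, Set.indicator_of_notMem hxB, mul_zero]

/-- A tie forces `R k = R i^(α_i / α_k)`. Given `R i`, this is a single point for the independent,
atomless variable `R k`. -/
lemma measure_leastPathLoss_inter [IsProbabilityMeasure P] (hR : iIndepFun R P) (hm : ∀ j, Measurable (R j))
    (h0 : ∀ j ω, 0 ≤ R j ω) (hα : ∀ j, 0 < α j) {i k : ι} (hik : i ≠ k)
    (hna : NullSingletonClass (P.map (R k))) :
    P ({ω | ∀ j, R i ω ^ α i ≤ R j ω ^ α j} ∩ {ω | ∀ j, R k ω ^ α k ≤ R j ω ^ α j}) = 0 := by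
  have hT : MeasurableSet {p : ℝ × ℝ | 0 ≤ p.1 ∧ 0 ≤ p.2 ∧ p.2 = p.1 ^ (α i / α k)} :=
    (measurableSet_le measurable_const measurable_fst).inter
      ((measurableSet_le measurable_const measurable_snd).inter
        (measurableSet_eq_fun measurable_snd (measurable_fst.pow_const _)))
  have h1 : P.map (fun ω => (R i ω, R k ω))
      {p : ℝ × ℝ | 0 ≤ p.1 ∧ 0 ≤ p.2 ∧ p.2 = p.1 ^ (α i / α k)} = 0 := by
    rw [(indepFun_iff_map_prod_eq_prod_map_map (hm i).aemeasurable (hm k).aemeasurable).1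
      (hR.indepFun hik), Measure.prod_apply hT, lintegral_eq_zero_iff (measurable_measure_prodMk_left hT)]
    refine ae_of_all _ fun x => ?_
    refine measure_mono_null (t := {x ^ (α i / α k)}) (fun y hy => hy.2.2) ?_
    exact measure_singleton _
  rw [Measure.map_apply ((hm i).prodMk (hm k)) hT] at h1
  refine measure_mono_null (fun ω hω => ?_) h1
  refine ⟨h0 i ω, h0 k ω, le_antisymm ?_ ((rpow_le_rpow_iff_le (h0 i ω) (h0 k ω) (hα k)).1 (hω.1 k))⟩
  have h2 := le_antisymm (hω.1 k) (hω.2 i)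
  have h3 : R i ω ^ (α i / α k) = R k ω := by
    rw [div_eq_mul_inv, Real.rpow_mul (h0 i ω), h2, Real.rpow_rpow_inv (h0 k ω) (hα k).ne']
  exact h3.ge

end LeastPathLoss

/-! ### Averaging an independent field over a random distance -/

/-- Integration of an event over the value of an independent random variable. -/
lemma measure_inter_of_indepFun {Ω E F : Type*} [MeasurableSpace Ω] [MeasurableSpace E]
    [MeasurableSpace F] {P : Measure Ω} [IsProbabilityMeasure P] {X : Ω → E} {Y : Ω → F}
    (hX : Measurable X) (hY : Measurable Y) (hXY : IndepFun X Y P) {A : Set E}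
    (hA : MeasurableSet A) {d : E → ℝ} (hd : Measurable d) {S : Set (ℝ × F)}
    (hS : MeasurableSet S) :
    P {ω | X ω ∈ A ∧ (d (X ω), Y ω) ∈ S} =
      ∫⁻ r, P {ω | (r, Y ω) ∈ S} ∂((P.restrict (X ⁻¹' A)).map fun ω => d (X ω)) := by
  have hT : MeasurableSet {p : E × F | p.1 ∈ A ∧ (d p.1, p.2) ∈ S} :=
    (measurable_fst hA).inter (((hd.comp measurable_fst).prodMk measurable_snd) hS)
  have h1 := Measure.map_apply (μ := P) (hX.prodMk hY) hT
  rw [(indepFun_iff_map_prod_eq_prod_map_map hX.aemeasurable hY.aemeasurable).1 hXY,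
    Measure.prod_apply hT] at h1
  have hF : Measurable fun r : ℝ => P {ω | (r, Y ω) ∈ S} := by
    have h2 := measurable_measure_prodMk_left (ν := P.map Y) hS
    simp only [Measure.map_apply hY (measurable_prodMk_left hS)] at h2
    exact h2
  have hdX : Measurable fun ω => d (X ω) := hd.comp hX
  refine h1.symm.trans ?_
  rw [lintegral_map hF hdX, ← lintegral_indicator (hX hA)]
  rw [lintegral_map (measurable_measure_prodMk_left hT) hX]
  refine lintegral_congr fun ω => ?_
  rw [Measure.map_apply hY (measurable_prodMk_left hT)]
  by_cases h : X ω ∈ A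
  · rw [Set.indicator_of_mem (show ω ∈ X ⁻¹' A from h)]
    congr 1
    ext ω'
    simp [h]
  · rw [Set.indicator_of_notMem (show ω ∉ X ⁻¹' A from h)]
    convert measure_empty (μ := P)
    ext ω'
    simp [h]

/-! ### The average coverage probability -/

namespace NetworkParams

variable {K : ℕ} (prm : NetworkParams K)

lemma interfTerm_antitone (j : Fin K) (z : Zone) (m : Measure (Plane × ℝ × Bool)) :
    Antitone fun r => prm.interfTerm j z r m := fun _ _ h =>
  lintegral_mono_set fun _ hs => ⟨h.trans_lt hs.1, hs.2⟩

/-- Because interferers are strictly farther than `r`, the interference is the supremum over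
rational radii above `r`. This countable formula gives measurability jointly in distance and
configuration, needed once the distance is random. -/
lemma interfTerm_eq_iSup (j : Fin K) (z : Zone) (r : ℝ) (m : Measure (Plane × ℝ × Bool)) :
    prm.interfTerm j z r m = ⨆ q : ℚ, {r : ℝ | r < q}.indicator
      (fun _ => prm.interfTerm j z q m) r := by
  refine le_antisymm ?_ (iSup_le fun q => ?_)
  · have hset : {s : Plane × ℝ × Bool | r < ‖s.1‖ ∧ s.2.2 = true} =
        ⋃ q : {q : ℚ // r < q}, {s : Plane × ℝ × Bool | (q : ℝ) < ‖s.1‖ ∧ s.2.2 = true} := by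
      ext s
      simp only [Set.mem_ofPred_eq, Set.mem_iUnion]
      constructor
      · rintro ⟨h1, h2⟩
        obtain ⟨q, hq1, hq2⟩ := exists_rat_btwn h1
        exact ⟨⟨q, hq1⟩, hq2, h2⟩
      · rintro ⟨q, h1, h2⟩
        exact ⟨q.2.trans h1, h2⟩
    have hd : Directed (· ⊆ ·) fun q : {q : ℚ // r < q} =>
        {s : Plane × ℝ × Bool | (q : ℝ) < ‖s.1‖ ∧ s.2.2 = true} :=
      directed_of_isDirected_ge fun p q hpq s hs => ⟨lt_of_le_of_lt (by exact_mod_cast hpq) hs.1, hs.2⟩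
    unfold interfTerm
    rw [hset, setLIntegral_iUnion_of_directed _ hd]
    refine iSup_le fun q => le_iSup_of_le (q : ℚ) ?_
    rw [Set.indicator_of_mem (show r ∈ {r : ℝ | r < ((q : ℚ) : ℝ)} from q.2)]
  · refine Set.indicator_apply_le' (fun hr => ?_) fun _ => zero_le
    exact prm.interfTerm_antitone j z m (le_of_lt hr)

lemma measurable_interfTerm_prod (j : Fin K) (z : Zone) :
    Measurable fun p : ℝ × Measure (Plane × ℝ × Bool) => prm.interfTerm j z p.1 p.2 := by
  have heq : (fun p : ℝ × Measure (Plane × ℝ × Bool) => prm.interfTerm j z p.1 p.2) = fun p =>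
      ⨆ q : ℚ, {r : ℝ | r < q}.indicator (fun _ => prm.interfTerm j z q p.2) p.1 :=
    funext fun p => prm.interfTerm_eq_iSup j z p.1 p.2
  rw [heq]
  refine Measurable.iSup fun q => ?_
  have h : Measurable ({p : ℝ × Measure (Plane × ℝ × Bool) | p.1 < q}.indicator
      fun p => prm.interfTerm j z q p.2) :=
    ((prm.measurable_interfTerm j z q).comp measurable_snd).indicator
      (measurableSet_lt measurable_fst measurable_const)
  exact h

/-- The density of the serving distance on the event of association with tier `i`. -/
noncomputable def servingWeight (i : Fin K) (r : ℝ) : ℝ :=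
  2 * Real.pi * prm.lam i * r *
    Real.exp (-Real.pi * ∑ j, prm.lam j * r ^ (2 * prm.alpha i / prm.alpha j))

lemma servingWeight_pos (i : Fin K) {r : ℝ} (hr : 0 < r) : 0 < prm.servingWeight i r := by
  have := prm.lam_pos i
  unfold servingWeight
  positivity

lemma alpha_pos (j : Fin K) : 0 < prm.alpha j := two_pos.trans (prm.two_lt_alpha j)

lemma measurable_servingWeight (i : Fin K) : Measurable (prm.servingWeight i) := by
  unfold servingWeight
  fun_prop

/-- The event of coverage by tier `i`, in terms of the serving distance, the configurations of
interferers and the channel gains. -/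
def coverageSet (i : Fin K) :
    Set (ℝ × (Fin K → Zone → Measure (Plane × ℝ × Bool)) × (Fin K → ℝ)) :=
  {p | ENNReal.ofReal (prm.thr i) ≤
    ENNReal.ofReal (prm.phi i * prm.power i * p.2.2 i * p.1 ^ (-prm.alpha i)) /
      (interfFun prm p.1 p.2.1 + ENNReal.ofReal prm.noise)}

lemma measurableSet_coverageSet (i : Fin K) : MeasurableSet (prm.coverageSet i) := by
  have h1 : Measurable fun p : ℝ × (Fin K → Zone → Measure (Plane × ℝ × Bool)) × (Fin K → ℝ) =>
      interfFun prm p.1 p.2.1 := by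
    have h : (fun p : ℝ × (Fin K → Zone → Measure (Plane × ℝ × Bool)) × (Fin K → ℝ) =>
        interfFun prm p.1 p.2.1) =
        fun p => ∑ k : Fin K × Zone, prm.interfTerm k.1 k.2 p.1 (p.2.1 k.1 k.2) := by
      funext p; exact interference_eq_sum prm _ p.1 p.2.1
    rw [h]
    refine Finset.measurable_sum _ fun k _ => ?_
    have h2 : Measurable fun p : ℝ × (Fin K → Zone → Measure (Plane × ℝ × Bool)) × (Fin K → ℝ) =>
        (p.1, p.2.1 k.1 k.2) :=
      measurable_fst.prodMk ((measurable_pi_apply k.2).comp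
        ((measurable_pi_apply k.1).comp measurable_snd.fst))
    exact (prm.measurable_interfTerm_prod k.1 k.2).comp h2
  have h2 : Measurable fun p : ℝ × (Fin K → Zone → Measure (Plane × ℝ × Bool)) × (Fin K → ℝ) =>
      p.2.2 i := (measurable_pi_apply i).comp measurable_snd.snd
  have h3 : Measurable fun p : ℝ × (Fin K → Zone → Measure (Plane × ℝ × Bool)) × (Fin K → ℝ) =>
      p.1 := measurable_fst
  refine measurableSet_le measurable_const ?_
  exact ((((h2.const_mul _).mul (h3.pow_const _)).ennreal_ofReal)).div (h1.add_const _)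

end NetworkParams

namespace IsNetwork

variable {K : ℕ} {prm : NetworkParams K} {Ω : Type*} [MeasurableSpace Ω] {P : Measure Ω}
  {Φ : Fin K → Ω → Measure Plane} {Θ : Fin K → Zone → Ω → Measure (Plane × ℝ × Bool)}
  {G : Fin K → Ω → ℝ}

lemma measurable_nearestDist (hN : IsNetwork prm P Φ Θ G) (i : Fin K) :
    Measurable (nearestDist Φ i) := (hN.poisson_serving i).measurable_radius

lemma iIndepFun_nearestDist (hN : IsNetwork prm P Φ Θ G) : iIndepFun (nearestDist Φ) P :=
  hN.indep_serving.comp (fun _ => nearestRadius) fun _ => measurable_nearestRadius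

lemma measurableSet_assocEvent (hN : IsNetwork prm P Φ Θ G) (i : Fin K) :
    MeasurableSet (assocEvent prm Φ i) :=
  measurableSet_leastPathLoss hN.measurable_nearestDist i

lemma servingDensity_eq (i : Fin K) (r : ℝ) :
    servingDensity prm P Φ i r = (assocProb prm P Φ i)⁻¹ * prm.servingWeight i r := by
  rw [servingDensity, NetworkParams.servingWeight]
  ring

lemma condCoverage_eq_coverageSet (prm : NetworkParams K) (P : Measure Ω)
    (Θ : Fin K → Zone → Ω → Measure (Plane × ℝ × Bool)) (G : Fin K → Ω → ℝ) (i : Fin K) (r : ℝ) :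
    condCoverage prm P Θ G i r =
      P.real {ω | (r, (fun j z => Θ j z ω), fun i => G i ω) ∈ prm.coverageSet i} := rfl

lemma measurable_interf_gain (hN : IsNetwork prm P Φ Θ G) :
    Measurable fun ω => ((fun j z => Θ j z ω : Fin K → Zone → Measure (Plane × ℝ × Bool)),
      (fun i => G i ω : Fin K → ℝ)) :=
  hN.measurable_interf.prodMk (measurable_pi_lambda _ hN.measurable_gain)

lemma condCoverage_nonneg (i : Fin K) (r : ℝ) : 0 ≤ condCoverage prm P Θ G i r :=
  measureReal_nonneg

lemma measurable_serving (hN : IsNetwork prm P Φ Θ G) : Measurable fun ω j => Φ j ω :=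
  measurable_pi_lambda _ fun j => (hN.poisson_serving j).measurable

variable [IsProbabilityMeasure P]

lemma map_restrict_assocEvent (hN : IsNetwork prm P Φ Θ G) (i : Fin K) :
    (P.restrict (assocEvent prm Φ i)).map (nearestDist Φ i) =
      (volume.restrict (Set.Ioi 0)).withDensity fun r => ENNReal.ofReal (prm.servingWeight i r) :=
  map_restrict_leastPathLoss hN.iIndepFun_nearestDist hN.measurable_nearestDist
    (fun _ _ => nearestRadius_nonneg _)
    (fun j _ hr => (hN.poisson_serving j).measure_le_radius (prm.lam_pos j) hr) prm.alpha_pos i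
    (prm.lam_pos i) ((hN.poisson_serving i).map_radius (prm.lam_pos i))

lemma measure_assocEvent (hN : IsNetwork prm P Φ Θ G) (i : Fin K) :
    P (assocEvent prm Φ i) = ∫⁻ r in Set.Ioi 0, ENNReal.ofReal (prm.servingWeight i r) := by
  have h := congrArg (fun ν : Measure ℝ => ν Set.univ) (hN.map_restrict_assocEvent i)
  rw [Measure.map_apply (hN.measurable_nearestDist i) MeasurableSet.univ,
    withDensity_apply _ MeasurableSet.univ] at h
  simpa using h

lemma assocProb_pos (hN : IsNetwork prm P Φ Θ G) (i : Fin K) : 0 < assocProb prm P Φ i := by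
  rw [assocProb, measureReal_def, ENNReal.toReal_pos_iff, hN.measure_assocEvent i]
  constructor
  · rw [setLIntegral_pos_iff (prm.measurable_servingWeight i).ennreal_ofReal]
    have : Function.support (fun r => ENNReal.ofReal (prm.servingWeight i r)) ∩ Set.Ioi 0 =
        Set.Ioi 0 := by
      refine Set.inter_eq_right.2 fun r hr => ?_
      simpa using prm.servingWeight_pos i hr
    rw [this]
    simp
  · rw [← hN.measure_assocEvent i]
    exact measure_lt_top _ _

/-- The serving distance of a user connected to tier `i` has density `f_{R_i}`. -/
theorem map_cond_assocEvent (hN : IsNetwork prm P Φ Θ G) (i : Fin K) :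
    (P[|assocEvent prm Φ i]).map (nearestDist Φ i) = (volume.restrict (Set.Ioi 0)).withDensity
      fun r => ENNReal.ofReal (servingDensity prm P Φ i r) := by
  have hp := hN.assocProb_pos i
  simp only [servingDensity_eq, ENNReal.ofReal_mul (inv_nonneg.2 hp.le)]
  rw [ProbabilityTheory.cond, Measure.map_smul, hN.map_restrict_assocEvent i,
    ← withDensity_smul _ (prm.measurable_servingWeight i).ennreal_ofReal,
    ENNReal.ofReal_inv_of_pos hp, assocProb, ofReal_measureReal]
  rfl

lemma integrableOn_servingWeight (hN : IsNetwork prm P Φ Θ G) (i : Fin K) :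
    IntegrableOn (prm.servingWeight i) (Set.Ioi 0) := by
  refine ⟨(prm.measurable_servingWeight i).aestronglyMeasurable, ?_⟩
  rw [hasFiniteIntegral_iff_ofReal (ae_restrict_of_forall_mem measurableSet_Ioi
    fun r hr => (prm.servingWeight_pos i hr).le), ← hN.measure_assocEvent i]
  exact measure_lt_top _ _

lemma measurable_condCoverage (hN : IsNetwork prm P Φ Θ G) (i : Fin K) :
    Measurable (condCoverage prm P Θ G i) := by
  have h := (measurable_measure_prodMk_left (ν := P.map fun ω =>
    ((fun j z => Θ j z ω : Fin K → Zone → Measure (Plane × ℝ × Bool)),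
      (fun i => G i ω : Fin K → ℝ))) (prm.measurableSet_coverageSet i)).ennreal_toReal
  simp only [Measure.map_apply hN.measurable_interf_gain
    (measurable_prodMk_left (prm.measurableSet_coverageSet i))] at h
  exact h

lemma condCoverage_le_one (i : Fin K) (r : ℝ) : condCoverage prm P Θ G i r ≤ 1 :=
  measureReal_le_one

lemma integrableOn_condCoverage_mul (hN : IsNetwork prm P Φ Θ G) (i : Fin K) :
    IntegrableOn (fun r => condCoverage prm P Θ G i r * prm.servingWeight i r) (Set.Ioi 0) := by
  refine (hN.integrableOn_servingWeight i).bdd_mul (c := 1)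
    (hN.measurable_condCoverage i).aestronglyMeasurable (ae_of_all _ fun r => ?_)
  rw [Real.norm_of_nonneg (condCoverage_nonneg i r)]
  exact condCoverage_le_one i r

/-- Association and serving distance depend only on the serving processes, which are independent of
the interferers and gains; the distance may therefore be frozen and integrated afterwards. -/
lemma measure_assoc_inter_coverage (hN : IsNetwork prm P Φ Θ G) (i : Fin K) :
    P {ω | ω ∈ assocEvent prm Φ i ∧
      ENNReal.ofReal (prm.thr i) ≤ sinr prm Θ G i (nearestDist Φ i ω) ω} =
      ENNReal.ofReal (∫ r in Set.Ioi 0, condCoverage prm P Θ G i r * prm.servingWeight i r) := by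
  have hm (j : Fin K) : Measurable fun φ : Fin K → Measure Plane => nearestRadius (φ j) :=
    measurable_nearestRadius.comp (measurable_pi_apply j)
  have h := measure_inter_of_indepFun hN.measurable_serving hN.measurable_interf_gain
    hN.indep_serving_rest (measurableSet_leastPathLoss (α := prm.alpha) hm i) (hm i)
    (prm.measurableSet_coverageSet i)
  refine h.trans ?_
  have hmap : (P.restrict ((fun ω j => Φ j ω) ⁻¹' {φ : Fin K → Measure Plane | ∀ j,
      nearestRadius (φ i) ^ prm.alpha i ≤ nearestRadius (φ j) ^ prm.alpha j})).map
        (fun ω => nearestRadius (Φ i ω)) = _ := hN.map_restrict_assocEvent i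
  have hP (r : ℝ) : P {ω | (r, ((fun j z => Θ j z ω : Fin K → Zone → Measure (Plane × ℝ × Bool)),
      (fun i => G i ω : Fin K → ℝ))) ∈ prm.coverageSet i} =
      ENNReal.ofReal (condCoverage prm P Θ G i r) := by
    rw [condCoverage_eq_coverageSet, ofReal_measureReal]
  rw [hmap]
  simp only [hP]
  rw [lintegral_withDensity_eq_lintegral_mul _ (prm.measurable_servingWeight i).ennreal_ofReal
    (hN.measurable_condCoverage i).ennreal_ofReal, ofReal_integral_eq_lintegral_ofReal
      (hN.integrableOn_condCoverage_mul i) (ae_restrict_of_forall_mem measurableSet_Ioi fun r hr =>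
        mul_nonneg (condCoverage_nonneg i r) (prm.servingWeight_pos i hr).le)]
  refine lintegral_congr fun r => ?_
  rw [Pi.mul_apply, ENNReal.ofReal_mul (condCoverage_nonneg i r), mul_comm]

lemma measure_assocEvent_inter (hN : IsNetwork prm P Φ Θ G) {i k : Fin K} (hik : i ≠ k) :
    P (assocEvent prm Φ i ∩ assocEvent prm Φ k) = 0 := by
  have hna : NullSingletonClass (P.map (nearestDist Φ k)) := by
    have h := (hN.poisson_serving k).map_radius (prm.lam_pos k)
    change P.map (nearestDist Φ k) = _ at h
    rw [h]
    infer_instance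
  exact measure_leastPathLoss_inter hN.iIndepFun_nearestDist hN.measurable_nearestDist
    (fun _ _ => nearestRadius_nonneg _) prm.alpha_pos hik hna

/-- The average coverage probability as an integral over the serving distance. -/
theorem avgCoverage_eq (hN : IsNetwork prm P Φ Θ G) :
    avgCoverage prm P Φ Θ G =
      ∑ i, ∫ r in Set.Ioi 0, condCoverage prm P Θ G i r * prm.servingWeight i r := by
  have hms (i : Fin K) : MeasurableSet {ω | ω ∈ assocEvent prm Φ i ∧
      ENNReal.ofReal (prm.thr i) ≤ sinr prm Θ G i (nearestDist Φ i ω) ω} := by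
    have h := ((hN.measurable_nearestDist i).prodMk hN.measurable_interf_gain)
      (prm.measurableSet_coverageSet i)
    exact (hN.measurableSet_assocEvent i).inter h
  -- The events of different tiers are disjoint only up to ties, which are null.
  rw [avgCoverage, measureReal_def, measure_iUnion₀ _ fun i => (hms i).nullMeasurableSet,
    tsum_fintype, ENNReal.toReal_sum fun i _ => measure_ne_top _ _]
  · refine Finset.sum_congr rfl fun i _ => ?_
    rw [hN.measure_assoc_inter_coverage i, ENNReal.toReal_ofReal]
    exact setIntegral_nonneg measurableSet_Ioi fun r hr =>
      mul_nonneg (condCoverage_nonneg i r) (prm.servingWeight_pos i hr).le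
  · intro i k hik
    refine measure_mono_null (fun ω hω => ?_) (hN.measure_assocEvent_inter hik)
    exact ⟨hω.1.1, hω.2.1⟩

end IsNetwork

/-! ### Convergence of the closed form -/

/-- Continuous convergence forces a continuous limit, with no continuity of the approximants.
Continuity of the Gaussian integrands and of the conditional coverage is obtained this way. -/
lemma ContinuousAt.of_tendsto_prod_nhds {ι X : Type*} [TopologicalSpace X] {l : Filter ι}
    [l.NeBot] {F : ι → X → ℝ} {f : X → ℝ} {x : X}
    (h : ∀ᶠ y in 𝓝 x, Tendsto (fun p : ι × X => F p.1 p.2) (l ×ˢ 𝓝 y) (𝓝 (f y))) :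
    ContinuousAt f x := by
  refine (closed_nhds_basis (f x)).tendsto_right_iff.2 fun V ⟨hV, hVc⟩ => ?_
  obtain ⟨U, hU, W, hW, hUW⟩ := mem_prod_iff.1 (h.self_of_nhds hV)
  filter_upwards [h, hW] with y hy hyW
  refine hVc.mem_of_tendsto (Tendsto.of_prod_nhds (g := F) hy) ?_
  filter_upwards [hU] with k hk using hUW (Set.mk_mem_prod hk hyW)

lemma headSum_nonneg {β : ℝ} (N : ℕ) {C : ℝ} (hC : 0 < C) : 0 ≤ headSum β N C := by
  refine Finset.sum_nonneg fun x hx => mul_nonneg (isQuadratureSeq_legendre.nonneg N x hx) ?_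
  have h := (glNodes_mem hx).1
  have h2 : 0 ≤ ((x + 1) / 2) ^ β := Real.rpow_nonneg (by linarith) _
  positivity

namespace NetworkParams

variable {K : ℕ} (prm : NetworkParams K) {ι : Type*} {l : Filter ι}

/-- Since `π (α_j - 2) / α_j = π - 2π / α_j`, the explicit term of `f_I` is the full integral for `β
= α_j / 2`. -/
lemma fI_eq (NH NL : ℕ) (i j : Fin K) (ψ a r : ℝ) :
    prm.fI NH NL i j ψ a r = ∑ a₁ ∈ ghNodes NH, ghWeight NH a₁ / √Real.pi *
      (fullConst (prm.alpha j / 2) * prm.cFactor i j ψ a a₁ r ^ (1 / (prm.alpha j / 2)) -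
        headSum (prm.alpha j / 2) NL (prm.cFactor i j ψ a a₁ r)) := by
  have hα := (prm.alpha_pos j).ne'
  have hs : Real.sin (Real.pi * (prm.alpha j - 2) / prm.alpha j) =
      Real.sin (Real.pi / (prm.alpha j / 2)) := by
    rw [← Real.sin_pi_sub]
    congr 1
    field_simp
    ring
  refine Finset.sum_congr rfl fun a₁ _ => ?_
  rw [hs, headSum, fullConst, one_div_div]
  congr 2
  rw [mul_comm (prm.alpha j), div_div_eq_mul_div, mul_comm Real.pi 2, ← div_div]
  ring

lemma tendsto_cFactor (i j : Fin K) (ψ : ℝ) {a b r : ι → ℝ} {a₀ b₀ r₀ : ℝ}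
    (ha : Tendsto a l (𝓝 a₀)) (hb : Tendsto b l (𝓝 b₀)) (hr : Tendsto r l (𝓝 r₀))
    (hr₀ : 0 < r₀) :
    Tendsto (fun k => prm.cFactor i j ψ (a k) (b k) (r k)) l (𝓝 (prm.cFactor i j ψ a₀ b₀ r₀)) := by
  have hga := (prm.continuous_gam.tendsto a₀).comp ha
  have hgb := (prm.continuous_gam.tendsto b₀).comp hb
  exact (((hgb.div hga (prm.gam_pos a₀).ne').const_mul _).mul_const _).mul
    (hr.rpow_const (Or.inl hr₀.ne'))

lemma tendsto_fI (i j : Fin K) {ψ : ℝ} (hψ : 0 < ψ) {NH NL : ι → ℕ} {a r : ι → ℝ} {a₀ r₀ : ℝ}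
    (hNH : Tendsto NH l atTop) (hNL : Tendsto NL l atTop) (ha : Tendsto a l (𝓝 a₀))
    (hr : Tendsto r l (𝓝 r₀)) (hr₀ : 0 < r₀) :
    Tendsto (fun k => prm.fI (NH k) (NL k) i j ψ (a k) (r k)) l
      (𝓝 (prm.fLim i j ψ a₀ r₀)) := by
  have hβ := prm.one_lt_alpha_div_two j
  have hK := fullConst_pos hβ
  obtain ⟨B, κ, hB0, hB⟩ := prm.tailInt_cFactor_le i j hψ
  obtain ⟨B', κ', hκ', hB'⟩ := prm.gam_le
  have hg0 := prm.gam_pos 0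
  have hBp : 0 ≤ B' := by
    have h1 := hB' 0
    rw [abs_zero, mul_zero, Real.exp_zero, mul_one] at h1
    linarith
  -- `C` at `a₁ = 0` eventually stays below this constant, because `a` and `r` converge; the
  -- dependence on `a₁` is exponentially bounded.
  set C₀ := prm.cFactor i j ψ a₀ 0 r₀ + 1
  have hC₀ : 0 < C₀ := by linarith [prm.cFactor_pos i j hψ a₀ 0 hr₀]
  have hCk : ∀ᶠ k in l, prm.cFactor i j ψ (a k) 0 (r k) < C₀ :=
    (tendsto_order.1 (prm.tendsto_cFactor i j ψ ha tendsto_const_nhds hr hr₀)).2 _ (lt_add_one _)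
  -- The last summand pays for the Gauss–Legendre sum, which lies in `[0, 1]`.
  set M := fullConst (prm.alpha j / 2) * (1 + C₀ / prm.gam 0 * B') + 1 with hM
  have hM0 : 0 ≤ M := by positivity
  simp only [fI_eq]
  refine isQuadratureSeq_hermite.tendsto_sum hNH
    (h := fun k a₁ => fullConst (prm.alpha j / 2) *
      prm.cFactor i j ψ (a k) a₁ (r k) ^ (1 / (prm.alpha j / 2)) -
        headSum (prm.alpha j / 2) (NL k) (prm.cFactor i j ψ (a k) a₁ (r k)))
    (f := fun a₁ => tailInt (prm.alpha j / 2) (prm.cFactor i j ψ a₀ a₁ r₀))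
    (B := max M (B * (1 + prm.cFactor i j ψ a₀ 0 r₀))) (κ := max κ κ')
    (prm.continuous_tailInt_cFactor i j hψ a₀ hr₀) (fun a₁ => ?_) ?_ fun x => ?_
  · rw [abs_of_nonneg (tailInt_nonneg (prm.cFactor_pos i j hψ a₀ a₁ hr₀))]
    refine (hB a₀ a₁ r₀ hr₀).trans ?_
    gcongr
    · exact le_max_right _ _
    · exact le_max_left _ _
  · filter_upwards [hCk, hNL.eventually_ne_atTop 0, (tendsto_order.1 hr).1 0 hr₀]
      with k hk hN hrk a₁ _
    have hC := prm.cFactor_pos i j hψ (a k) a₁ hrk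
    have hu1 := headSum_le_one (β := prm.alpha j / 2) hN hC
    have hu0 := headSum_nonneg (β := prm.alpha j / 2) (NL k) hC
    have he : 1 ≤ Real.exp (κ' * |a₁|) := Real.one_le_exp (by positivity)
    have hCle : prm.cFactor i j ψ (a k) a₁ (r k) ≤ C₀ / prm.gam 0 * (B' * Real.exp (κ' * |a₁|)) := by
      rw [prm.cFactor_eq]
      gcongr
      · exact (prm.gam_pos _).le
      · exact hB' a₁
    have hp : prm.cFactor i j ψ (a k) a₁ (r k) ^ (1 / (prm.alpha j / 2)) ≤
        1 + prm.cFactor i j ψ (a k) a₁ (r k) := by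
      refine rpow_le_one_add hC (by positivity) ?_
      rw [div_le_one (by linarith)]; exact hβ.le
    have hp0 : 0 ≤ prm.cFactor i j ψ (a k) a₁ (r k) ^ (1 / (prm.alpha j / 2)) := by positivity
    have h1 : |fullConst (prm.alpha j / 2) *
        prm.cFactor i j ψ (a k) a₁ (r k) ^ (1 / (prm.alpha j / 2)) -
        headSum (prm.alpha j / 2) (NL k) (prm.cFactor i j ψ (a k) a₁ (r k))| ≤
        M * Real.exp (κ' * |a₁|) := by
      have h2 : fullConst (prm.alpha j / 2) *
          prm.cFactor i j ψ (a k) a₁ (r k) ^ (1 / (prm.alpha j / 2)) ≤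
          fullConst (prm.alpha j / 2) * ((1 + C₀ / prm.gam 0 * B') * Real.exp (κ' * |a₁|)) := by
        refine mul_le_mul_of_nonneg_left ?_ hK.le
        calc _ ≤ _ := hp
          _ ≤ Real.exp (κ' * |a₁|) + C₀ / prm.gam 0 * (B' * Real.exp (κ' * |a₁|)) :=
            add_le_add he hCle
          _ = _ := by ring
      have h3 : 0 ≤ fullConst (prm.alpha j / 2) *
          prm.cFactor i j ψ (a k) a₁ (r k) ^ (1 / (prm.alpha j / 2)) := mul_nonneg hK.le hp0
      have h4 : M * Real.exp (κ' * |a₁|) = fullConst (prm.alpha j / 2) *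
          ((1 + C₀ / prm.gam 0 * B') * Real.exp (κ' * |a₁|)) + Real.exp (κ' * |a₁|) := by
        rw [hM]; ring
      rw [abs_le, h4]
      constructor <;> linarith
    refine h1.trans ?_
    gcongr
    · exact le_max_left _ _
    · exact le_max_right _ _
  · have hc := prm.tendsto_cFactor i j ψ (ha.comp (tendsto_fst (g := 𝓝 x)))
      tendsto_snd (hr.comp tendsto_fst) hr₀
    have hC := prm.cFactor_pos i j hψ a₀ x hr₀
    have h1 := (tendsto_headSum (β := prm.alpha j / 2) (by linarith) hC).comp
      ((hNL.comp (tendsto_fst (g := 𝓝 x))).prodMk hc)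
    rw [eq_sub_of_add_eq' (headInt_add_tailInt hβ hC)]
    exact ((hc.rpow_const (Or.inl hC.ne')).const_mul _).sub h1

/-- The full integral minus a sum exceeding the head integral by at most `δ` is at least the tail
integral minus `δ`. The Hermite weights are nonnegative with sum one, so averaging preserves the
bound, uniformly in all parameters. -/
lemma eventually_neg_le_fI (i j : Fin K) {δ : ℝ} (hδ : 0 < δ) :
    ∀ᶠ N : ℕ × ℕ in atTop, ∀ ψ a r, 0 < ψ → 0 < r → -δ ≤ prm.fI N.1 N.2 i j ψ a r := by
  have hβ := prm.one_lt_alpha_div_two j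
  rw [← prod_atTop_atTop_eq]
  filter_upwards [(eventually_ne_atTop 0).prod_mk (eventually_headSum_le hβ hδ)]
    with N hN ψ a r hψ hr
  rw [fI_eq]
  calc -δ = ∑ a₁ ∈ ghNodes N.1, ghWeight N.1 a₁ / √Real.pi * (-δ) := by
        rw [← Finset.sum_mul, isQuadratureSeq_hermite.sum_one N.1 hN.1, one_mul]
    _ ≤ _ := by
        refine Finset.sum_le_sum fun a₁ ha₁ => mul_le_mul_of_nonneg_left ?_
          (isQuadratureSeq_hermite.nonneg N.1 a₁ ha₁)
        have hC := prm.cFactor_pos i j hψ a a₁ hr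
        linarith [hN.2 _ hC, headInt_add_tailInt hβ hC,
          tailInt_nonneg (β := prm.alpha j / 2) hC]

/-- The summands of `condCoverageClosed`. -/
noncomputable def closedTerm (NH NL : ℕ) (i : Fin K) (a r : ℝ) : ℝ :=
  Real.exp (-(prm.thr i * r ^ prm.alpha i / prm.gam a * prm.invEdgeSnr i)) *
    Real.exp (-Real.pi * r ^ 2 * ∑ j, prm.eps j *
      (prm.zoneLam j .center * prm.fI NH NL i j 1 a r +
        prm.zoneLam j .edge * prm.fI NH NL i j (prm.phi j) a r))

lemma condCoverageClosed_eq (NH NL : ℕ) (i : Fin K) (r : ℝ) :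
    prm.condCoverageClosed NH NL i r =
      ∑ a ∈ ghNodes NH, ghWeight NH a / √Real.pi * prm.closedTerm NH NL i a r :=
  Finset.sum_congr rfl fun _ _ => mul_assoc _ _ _

lemma exp_noise_le_one (i : Fin K) (a : ℝ) {r : ℝ} (hr : 0 < r) :
    Real.exp (-(prm.thr i * r ^ prm.alpha i / prm.gam a * prm.invEdgeSnr i)) ≤ 1 := by
  rw [Real.exp_le_one_iff, neg_nonpos]
  have h1 := prm.thr_pos i
  have h2 := prm.gam_pos a
  have h5 := prm.power_pos i
  have h6 := prm.phi_pos i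
  have h7 := prm.noise_nonneg
  unfold invEdgeSnr
  positivity

lemma coverageTerm_le_one (i : Fin K) (a : ℝ) {r : ℝ} (hr : 0 < r) :
    prm.coverageTerm i a r ≤ 1 := by
  refine mul_le_one₀ (prm.exp_noise_le_one i a hr) (Real.exp_pos _).le ?_
  rw [Real.exp_le_one_iff, mul_assoc, neg_mul, neg_nonpos]
  refine mul_nonneg Real.pi_pos.le (mul_nonneg (sq_nonneg r) (Finset.sum_nonneg fun j _ =>
    mul_nonneg (prm.eps_nonneg j) (add_nonneg
      (mul_nonneg (prm.zoneLam_nonneg j _) (prm.fLim_nonneg i j one_pos a hr))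
      (mul_nonneg (prm.zoneLam_nonneg j _) (prm.fLim_nonneg i j (prm.phi_pos j) a hr)))))

/-- From `f_I ≥ -δ`, `ε_j ≤ 1` and the fact that the two zone densities add up to `λ_j`. The growth
rate in `r²` can be made as small as desired, so the serving density can dominate it. -/
lemma eventually_closedTerm_le (i : Fin K) {δ : ℝ} (hδ : 0 < δ) :
    ∀ᶠ N : ℕ × ℕ in atTop, ∀ a r, 0 < r →
      prm.closedTerm N.1 N.2 i a r ≤ Real.exp (Real.pi * δ * (∑ j, prm.lam j) * r ^ 2) := by
  filter_upwards [eventually_all.2 fun j => prm.eventually_neg_le_fI i j hδ] with N hN a r hr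
  refine (mul_le_of_le_one_left (Real.exp_pos _).le (prm.exp_noise_le_one i a hr)).trans ?_
  rw [Real.exp_le_exp]
  have h1 : ∑ j, -(δ * prm.lam j) ≤ ∑ j, prm.eps j *
      (prm.zoneLam j .center * prm.fI N.1 N.2 i j 1 a r +
        prm.zoneLam j .edge * prm.fI N.1 N.2 i j (prm.phi j) a r) := by
    refine Finset.sum_le_sum fun j _ => ?_
    have h2 : -(δ * prm.lam j) ≤ prm.zoneLam j .center * prm.fI N.1 N.2 i j 1 a r +
        prm.zoneLam j .edge * prm.fI N.1 N.2 i j (prm.phi j) a r := by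
      have h3 := mul_le_mul_of_nonneg_left (hN j 1 a r one_pos hr) (prm.zoneLam_nonneg j .center)
      have h4 := mul_le_mul_of_nonneg_left (hN j _ a r (prm.phi_pos j) hr)
        (prm.zoneLam_nonneg j .edge)
      rw [← prm.zoneLam_add j]
      linarith
    have h5 := mul_le_mul_of_nonneg_left h2 (prm.eps_nonneg j)
    have h6 : 0 ≤ (1 - prm.eps j) * (δ * prm.lam j) :=
      mul_nonneg (sub_nonneg.2 (prm.eps_le_one j)) (mul_pos hδ (prm.lam_pos j)).le
    linarith
  rw [Finset.sum_neg_distrib, ← Finset.mul_sum] at h1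
  have h2 := mul_le_mul_of_nonneg_left h1 (mul_nonneg Real.pi_pos.le (sq_nonneg r))
  linarith

lemma closedTerm_pos (NH NL : ℕ) (i : Fin K) (a r : ℝ) : 0 < prm.closedTerm NH NL i a r :=
  mul_pos (Real.exp_pos _) (Real.exp_pos _)

lemma tendsto_closedTerm (i : Fin K) {NH NL : ι → ℕ} {a r : ι → ℝ} {a₀ r₀ : ℝ}
    (hNH : Tendsto NH l atTop) (hNL : Tendsto NL l atTop) (ha : Tendsto a l (𝓝 a₀))
    (hr : Tendsto r l (𝓝 r₀)) (hr₀ : 0 < r₀) :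
    Tendsto (fun k => prm.closedTerm (NH k) (NL k) i (a k) (r k)) l
      (𝓝 (prm.coverageTerm i a₀ r₀)) := by
  have hga := (prm.continuous_gam.tendsto a₀).comp ha
  refine Tendsto.mul ((Real.continuous_exp.tendsto _).comp ?_)
    ((Real.continuous_exp.tendsto _).comp ?_)
  · exact ((((hr.rpow_const (Or.inl hr₀.ne')).const_mul _).div hga
      (prm.gam_pos a₀).ne').mul_const _).neg
  · refine ((hr.pow 2).const_mul _).mul (tendsto_finsetSum _ fun j _ => ?_)
    exact (((prm.tendsto_fI i j one_pos hNH hNL ha hr hr₀).const_mul _).add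
      ((prm.tendsto_fI i j (prm.phi_pos j) hNH hNL ha hr hr₀).const_mul _)).const_mul _

lemma continuous_coverageTerm (i : Fin K) {r : ℝ} (hr : 0 < r) :
    Continuous fun a => prm.coverageTerm i a r := by
  refine continuous_iff_continuousAt.2 fun a => ContinuousAt.of_tendsto_prod_nhds
    (l := (atTop : Filter ℕ)) (F := fun N a => prm.closedTerm N N i a r) (Eventually.of_forall
      fun b => ?_)
  exact prm.tendsto_closedTerm i tendsto_fst tendsto_fst tendsto_snd tendsto_const_nhds hr

lemma tendsto_condCoverageClosed (i : Fin K) {N : ι → ℕ × ℕ} {r : ι → ℝ} {r₀ : ℝ}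
    (hN : Tendsto N l atTop) (hr : Tendsto r l (𝓝 r₀)) (hr₀ : 0 < r₀) :
    Tendsto (fun k => prm.condCoverageClosed (N k).1 (N k).2 i (r k)) l
      (𝓝 (∫ a, prm.coverageTerm i a r₀ ∂hermiteMeasure)) := by
  have hN' := hN
  rw [← prod_atTop_atTop_eq] at hN'
  have hNH : Tendsto (fun k => (N k).1) l atTop := tendsto_fst.comp hN'
  have hNL : Tendsto (fun k => (N k).2) l atTop := tendsto_snd.comp hN'
  simp only [condCoverageClosed_eq]
  -- For `r` converging to `r₀`, hence eventually below `r₀ + 1`, the growth bound with `δ = 1` is a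
  -- constant.
  set E := Real.exp (Real.pi * 1 * (∑ j, prm.lam j) * (r₀ + 1) ^ 2) with hE
  have hlam : 0 ≤ ∑ j, prm.lam j := Finset.sum_nonneg fun j _ => (prm.lam_pos j).le
  have hE1 : 1 ≤ E := Real.one_le_exp (by positivity)
  refine isQuadratureSeq_hermite.tendsto_sum hNH
    (h := fun k a => prm.closedTerm (N k).1 (N k).2 i a (r k))
    (f := fun a => prm.coverageTerm i a r₀) (B := E) (κ := 0)
    (prm.continuous_coverageTerm i hr₀) (fun a => ?_) ?_ fun x => ?_
  · rw [abs_of_pos (prm.coverageTerm_pos i a r₀), zero_mul, Real.exp_zero, mul_one]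
    exact (prm.coverageTerm_le_one i a hr₀).trans hE1
  · filter_upwards [hN.eventually (prm.eventually_closedTerm_le i one_pos),
      (tendsto_order.1 hr).1 0 hr₀, (tendsto_order.1 hr).2 (r₀ + 1) (by linarith)]
      with k hk hrk hrk' a _
    rw [abs_of_pos (prm.closedTerm_pos _ _ i a _), zero_mul, Real.exp_zero, mul_one]
    refine (hk a (r k) hrk).trans (Real.exp_le_exp.2 ?_)
    gcongr
  · exact prm.tendsto_closedTerm i (hNH.comp tendsto_fst) (hNL.comp tendsto_fst) tendsto_snd
      (hr.comp tendsto_fst) hr₀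

lemma eventually_condCoverageClosed_le (i : Fin K) {δ : ℝ} (hδ : 0 < δ) :
    ∀ᶠ N : ℕ × ℕ in atTop, ∀ r, 0 < r → |prm.condCoverageClosed N.1 N.2 i r| ≤
      Real.exp (Real.pi * δ * (∑ j, prm.lam j) * r ^ 2) := by
  have hN1 : ∀ᶠ N : ℕ × ℕ in atTop, N.1 ≠ 0 := by
    rw [← prod_atTop_atTop_eq]
    exact tendsto_fst.eventually (eventually_ne_atTop 0)
  filter_upwards [prm.eventually_closedTerm_le i hδ, hN1] with N hN hN0 r hr
  rw [condCoverageClosed_eq, abs_of_nonneg (Finset.sum_nonneg fun a ha =>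
    mul_nonneg (isQuadratureSeq_hermite.nonneg N.1 a ha) (prm.closedTerm_pos _ _ i a r).le)]
  calc _ ≤ ∑ a ∈ ghNodes N.1, ghWeight N.1 a / √Real.pi *
        Real.exp (Real.pi * δ * (∑ j, prm.lam j) * r ^ 2) :=
        Finset.sum_le_sum fun a ha => mul_le_mul_of_nonneg_left (hN a r hr)
          (isQuadratureSeq_hermite.nonneg N.1 a ha)
    _ = _ := by rw [← Finset.sum_mul, isQuadratureSeq_hermite.sum_one N.1 hN0, one_mul]

end NetworkParams

/-! ### Gauss–Legendre quadrature of the average over the serving distance -/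

lemma one_add_pow_four_le {η r : ℝ} (hη : 0 < η) (hr : 0 ≤ r) :
    (1 + r) ^ 4 * Real.exp (-(η * r ^ 2)) ≤ 8 / η ^ 2 * Real.exp η := by
  have h1 : (η * (1 + r ^ 2)) ^ 2 ≤ 2 * Real.exp (η * (1 + r ^ 2)) := by
    have h := Real.quadratic_le_exp_of_nonneg (x := η * (1 + r ^ 2)) (by positivity)
    have h0 : 0 ≤ η * (1 + r ^ 2) := by positivity
    linarith
  have h2 : (1 + r) ^ 4 ≤ 4 * (1 + r ^ 2) ^ 2 := by
    have h3 : (1 + r) ^ 2 ≤ 2 * (1 + r ^ 2) := by nlinarith [sq_nonneg (1 - r)]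
    calc (1 + r) ^ 4 = ((1 + r) ^ 2) ^ 2 := by ring
      _ ≤ (2 * (1 + r ^ 2)) ^ 2 := by gcongr
      _ = _ := by ring
  have h4 : (1 + r) ^ 4 ≤ 8 / η ^ 2 * Real.exp (η * (1 + r ^ 2)) := by
    rw [div_mul_eq_mul_div, le_div_iff₀ (by positivity)]
    calc (1 + r) ^ 4 * η ^ 2 ≤ 4 * (1 + r ^ 2) ^ 2 * η ^ 2 := by gcongr
      _ = 4 * (η * (1 + r ^ 2)) ^ 2 := by ring
      _ ≤ 4 * (2 * Real.exp (η * (1 + r ^ 2))) := by gcongr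
      _ = _ := by ring
  calc _ ≤ 8 / η ^ 2 * Real.exp (η * (1 + r ^ 2)) * Real.exp (-(η * r ^ 2)) := by gcongr
    _ = _ := by rw [mul_assoc, ← Real.exp_add]; congr 2; ring

/-- The substitution `r = (1 + x) / (1 - x)`. -/
lemma setIntegral_Ioi_eq_Ioo (g : ℝ → ℝ) :
    ∫ r in Set.Ioi 0, g r = ∫ x in Set.Ioo (-1 : ℝ) 1, 2 / (1 - x) ^ 2 * g ((x + 1) / (1 - x)) := by
  have himg : (fun x : ℝ => (x + 1) / (1 - x)) '' Set.Ioo (-1) 1 = Set.Ioi 0 := by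
    ext r
    simp only [Set.mem_image, Set.mem_Ioo, Set.mem_Ioi]
    constructor
    · rintro ⟨x, ⟨h1, h2⟩, rfl⟩
      exact div_pos (by linarith) (by linarith)
    · intro hr
      refine ⟨(r - 1) / (r + 1), ⟨?_, ?_⟩, ?_⟩
      · rw [lt_div_iff₀ (by linarith)]; linarith
      · rw [div_lt_one (by linarith)]; linarith
      · field_simp
        ring
  have hinj : Set.InjOn (fun x : ℝ => (x + 1) / (1 - x)) (Set.Ioo (-1) 1) := by
    intro x hx y hy hxy
    have h1 : 1 - x ≠ 0 := by linarith [hx.2]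
    have h2 : 1 - y ≠ 0 := by linarith [hy.2]
    simp only [div_eq_div_iff h1 h2] at hxy
    linarith
  have hd (x : ℝ) (hx : x ∈ Set.Ioo (-1 : ℝ) 1) :
      HasDerivWithinAt (fun x : ℝ => (x + 1) / (1 - x)) (2 / (1 - x) ^ 2) (Set.Ioo (-1) 1) x := by
    have h1 : 1 - x ≠ 0 := by linarith [hx.2]
    have h := ((hasDerivAt_id x).add_const 1).div ((hasDerivAt_id x).const_sub 1) h1
    refine (h.congr_deriv ?_).hasDerivWithinAt
    simp only [id]
    congr 1
    ring
  rw [← himg, integral_image_eq_integral_abs_deriv_smul measurableSet_Ioo hd hinj]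
  refine setIntegral_congr_fun measurableSet_Ioo fun x hx => ?_
  simp only [smul_eq_mul]
  rw [abs_of_nonneg (by positivity)]

namespace NetworkParams

variable {K : ℕ} (prm : NetworkParams K)

open scoped Classical in
/-- The integrand of the average over the serving distance after the substitution
`r = (1 + x) / (1 - x)`. -/
noncomputable def averageIntegrand (i : Fin K) (p : ℝ → ℝ) (x : ℝ) : ℝ :=
  if x ∈ Set.Ioo (-1 : ℝ) 1 then
    prm.servingWeight i ((x + 1) / (1 - x)) * (1 + (x + 1) / (1 - x)) ^ 2 * p ((x + 1) / (1 - x))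
  else 0

lemma averageIntegrand_of_mem (i : Fin K) (p : ℝ → ℝ) {x : ℝ} (hx : x ∈ Set.Ioo (-1 : ℝ) 1) :
    prm.averageIntegrand i p x = prm.servingWeight i ((x + 1) / (1 - x)) *
      (1 + (x + 1) / (1 - x)) ^ 2 * p ((x + 1) / (1 - x)) := if_pos hx

lemma averageIntegrand_of_notMem (i : Fin K) (p : ℝ → ℝ) {x : ℝ} (hx : x ∉ Set.Ioo (-1 : ℝ) 1) :
    prm.averageIntegrand i p x = 0 := if_neg hx

lemma averageSum_eq (NL : ℕ) (p : Fin K → ℝ → ℝ) :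
    prm.averageSum NL p =
      ∑ i, ∑ x ∈ glNodes NL, glWeight NL x / 2 * prm.averageIntegrand i (p i) x := by
  refine Finset.sum_congr rfl fun i _ => Finset.sum_congr rfl fun x hx => ?_
  have hx' := glNodes_mem hx
  have h1 : 1 - x ≠ 0 := by linarith [hx'.2]
  have h2 : 1 + (x + 1) / (1 - x) = 2 / (1 - x) := by field_simp; ring
  rw [prm.averageIntegrand_of_mem i _ hx', servingWeight, h2]
  field_simp
  ring

lemma integral_averageIntegrand (i : Fin K) (p : ℝ → ℝ) :
    ∫ x, prm.averageIntegrand i p x ∂legendreMeasure =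
      ∫ r in Set.Ioi 0, p r * prm.servingWeight i r := by
  rw [integral_legendreMeasure, intervalIntegral.integral_of_le (by norm_num),
    integral_Ioc_eq_integral_Ioo, setIntegral_Ioi_eq_Ioo, ← integral_div]
  refine setIntegral_congr_fun measurableSet_Ioo fun x hx => ?_
  have h1 : 1 - x ≠ 0 := by linarith [hx.2]
  have h2 : 1 + (x + 1) / (1 - x) = 2 / (1 - x) := by field_simp; ring
  rw [prm.averageIntegrand_of_mem i _ hx, h2]
  field_simp

lemma servingWeight_le (i : Fin K) {r : ℝ} (hr : 0 < r) :
    prm.servingWeight i r ≤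
      2 * Real.pi * prm.lam i * r * Real.exp (-(Real.pi * prm.lam i * r ^ 2)) := by
  have hl := prm.lam_pos i
  unfold servingWeight
  refine mul_le_mul_of_nonneg_left (Real.exp_le_exp.2 ?_) (by positivity)
  have h : prm.lam i * r ^ 2 ≤ ∑ j, prm.lam j * r ^ (2 * prm.alpha i / prm.alpha j) := by
    refine le_trans (le_of_eq ?_) (Finset.single_le_sum (f := fun j =>
      prm.lam j * r ^ (2 * prm.alpha i / prm.alpha j)) (fun j _ => ?_) (Finset.mem_univ i))
    · rw [mul_div_assoc, div_self (prm.alpha_pos i).ne', mul_one, Real.rpow_two]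
    · have := prm.lam_pos j
      positivity
  have := mul_le_mul_of_nonneg_left h Real.pi_pos.le
  linarith

/-- With `r = (1 + x) / (1 - x)` one has `1 - x² = 4r / (1 + r)²`; what remains is `(1 + r)^4 exp
(-η r²)` with `η = π λ_i - c > 0`, which is bounded. `B` does not depend on `p`, so the bound is
uniform along a family. -/
lemma abs_averageIntegrand_le (i : Fin K) {c : ℝ} (hc : c < Real.pi * prm.lam i) :
    ∃ B, 0 ≤ B ∧ ∀ p : ℝ → ℝ, (∀ r, 0 < r → |p r| ≤ Real.exp (c * r ^ 2)) →
      ∀ x, |prm.averageIntegrand i p x| ≤ B * max 0 (1 - x ^ 2) := by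
  set η := Real.pi * prm.lam i - c with hη
  have hη0 : 0 < η := sub_pos.2 hc
  have hl := prm.lam_pos i
  refine ⟨2 * Real.pi * prm.lam i * (8 / η ^ 2 * Real.exp η) / 4, by positivity,
    fun p hp x => ?_⟩
  by_cases hx : x ∈ Set.Ioo (-1 : ℝ) 1
  · have h1 : 0 < 1 - x := by linarith [hx.2]
    have h1' : 0 < x + 1 := by linarith [hx.1]
    set r := (x + 1) / (1 - x) with hr
    have hr0 : 0 < r := div_pos h1' h1
    have h2 : 1 + r = 2 / (1 - x) := by rw [hr]; field_simp; ring
    have h3 : 1 - x ^ 2 = 4 * (r / (1 + r) ^ 2) := by rw [h2, hr]; field_simp; ring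
    rw [prm.averageIntegrand_of_mem i _ hx, ← hr, abs_mul,
      abs_of_pos (mul_pos (prm.servingWeight_pos i hr0) (by positivity)), h3,
      max_eq_right (by positivity)]
    calc _ ≤ 2 * Real.pi * prm.lam i * r * Real.exp (-(Real.pi * prm.lam i * r ^ 2)) *
          (1 + r) ^ 2 * Real.exp (c * r ^ 2) := by
          gcongr
          · exact prm.servingWeight_le i hr0
          · exact hp r hr0
      _ = 2 * Real.pi * prm.lam i * (r / (1 + r) ^ 2) *
          ((1 + r) ^ 4 * Real.exp (-(η * r ^ 2))) := by
          rw [show -(η * r ^ 2) = -(Real.pi * prm.lam i * r ^ 2) + c * r ^ 2 by rw [hη]; ring,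
            Real.exp_add]
          field_simp
      _ ≤ 2 * Real.pi * prm.lam i * (r / (1 + r) ^ 2) * (8 / η ^ 2 * Real.exp η) := by
          exact mul_le_mul_of_nonneg_left (one_add_pow_four_le hη0 hr0.le) (by positivity)
      _ = _ := by ring
  · rw [prm.averageIntegrand_of_notMem i _ hx, abs_zero]
    positivity

variable {ι : Type*} {l : Filter ι}

lemma tendsto_averageIntegrand (i : Fin K) {p : ι → ℝ → ℝ} {p₀ : ℝ → ℝ} {c : ℝ}
    (hc : c < Real.pi * prm.lam i)
    (hlim : ∀ r, 0 < r → Tendsto (fun q : ι × ℝ => p q.1 q.2) (l ×ˢ 𝓝 r) (𝓝 (p₀ r)))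
    (hb : ∀ᶠ k in l, ∀ r, 0 < r → |p k r| ≤ Real.exp (c * r ^ 2)) (x : ℝ) :
    Tendsto (fun q : ι × ℝ => prm.averageIntegrand i (p q.1) q.2) (l ×ˢ 𝓝 x)
      (𝓝 (prm.averageIntegrand i p₀ x)) := by
  obtain ⟨B, hB0, hB⟩ := prm.abs_averageIntegrand_le i hc
  by_cases hx : x ∈ Set.Ioo (-1 : ℝ) 1
  · have h1 : 1 - x ≠ 0 := by linarith [hx.2]
    have hr0 : 0 < (x + 1) / (1 - x) := div_pos (by linarith [hx.1]) (by linarith [hx.2])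
    have hr : Tendsto (fun q : ι × ℝ => (q.2 + 1) / (1 - q.2)) (l ×ˢ 𝓝 x)
        (𝓝 ((x + 1) / (1 - x))) :=
      (tendsto_snd.add_const 1).div (tendsto_snd.const_sub 1) h1
    rw [prm.averageIntegrand_of_mem i _ hx]
    have hW : Tendsto (fun q : ι × ℝ => prm.servingWeight i ((q.2 + 1) / (1 - q.2))) (l ×ˢ 𝓝 x)
        (𝓝 (prm.servingWeight i ((x + 1) / (1 - x)))) := by
      refine (hr.const_mul _).mul ((Real.continuous_exp.tendsto _).comp (Tendsto.const_mul _
        (tendsto_finsetSum _ fun j _ => Tendsto.const_mul _ ?_)))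
      exact hr.rpow_const (Or.inl hr0.ne')
    have hp := (hlim _ hr0).comp (tendsto_fst.prodMk hr)
    refine ((hW.mul ((hr.const_add 1).pow 2)).mul hp).congr' ?_
    filter_upwards [tendsto_snd.eventually (Ioo_mem_nhds hx.1 hx.2)] with q hq
    exact (prm.averageIntegrand_of_mem i _ hq).symm
  · rw [prm.averageIntegrand_of_notMem i _ hx]
    -- At and beyond `±1` the integrand is squeezed by a continuous bound that vanishes there.
    have hm : Tendsto (fun q : ι × ℝ => B * max 0 (1 - q.2 ^ 2)) (l ×ˢ 𝓝 x) (𝓝 0) := by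
      have hc : Continuous fun y : ℝ => B * max 0 (1 - y ^ 2) := by fun_prop
      have h0 : B * max 0 (1 - x ^ 2) = 0 := by
        rw [max_eq_left, mul_zero]
        by_contra hcon
        exact hx (abs_lt.1 ((sq_lt_one_iff_abs_lt_one x).1 (by linarith)))
      have h := (hc.tendsto x).comp (tendsto_snd (f := l))
      rwa [h0] at h
    refine squeeze_zero_norm' ?_ hm
    filter_upwards [tendsto_fst.eventually hb] with q hq
    exact hB _ hq _

/-- Convergence of the Gauss–Legendre sums for the average over the serving distance. -/
theorem tendsto_averageSum [l.NeBot] {n : ι → ℕ} (hn : Tendsto n l atTop)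
    {p : ι → Fin K → ℝ → ℝ} {p₀ : Fin K → ℝ → ℝ} {c : ℝ} (hc : ∀ i, c < Real.pi * prm.lam i)
    (hlim : ∀ i r, 0 < r → Tendsto (fun q : ι × ℝ => p q.1 i q.2) (l ×ˢ 𝓝 r) (𝓝 (p₀ i r)))
    (hb : ∀ i, ∀ᶠ k in l, ∀ r, 0 < r → |p k i r| ≤ Real.exp (c * r ^ 2)) :
    Tendsto (fun k => prm.averageSum (n k) (p k)) l
      (𝓝 (∑ i, ∫ r in Set.Ioi 0, p₀ i r * prm.servingWeight i r)) := by
  simp only [averageSum_eq, ← integral_averageIntegrand]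
  refine tendsto_finsetSum _ fun i _ => ?_
  have hH := prm.tendsto_averageIntegrand (p := fun k => p k i) i (hc i) (hlim i) (hb i)
  obtain ⟨B, hB0, hB⟩ := prm.abs_averageIntegrand_le i (hc i)
  have hB1 (f : ℝ → ℝ) (hf : ∀ r, 0 < r → |f r| ≤ Real.exp (c * r ^ 2)) (x : ℝ) :
      |prm.averageIntegrand i f x| ≤ B * Real.exp (0 * |x|) := by
    rw [zero_mul, Real.exp_zero]
    refine (hB f hf x).trans (mul_le_mul_of_nonneg_left ?_ hB0)
    exact max_le zero_le_one (by nlinarith [sq_nonneg x])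
  refine isQuadratureSeq_legendre.tendsto_sum hn
    (h := fun k => prm.averageIntegrand i (p k i)) (B := B) (κ := 0) ?_ (hB1 _ fun r hr => ?_) ?_ hH
  · exact continuous_iff_continuousAt.2 fun x => ContinuousAt.of_tendsto_prod_nhds
      (F := fun k => prm.averageIntegrand i (p k i)) (Eventually.of_forall hH)
  · refine le_of_tendsto (Tendsto.of_prod_nhds (g := fun k => p k i) (hlim i r hr)).abs ?_
    filter_upwards [hb i] with k hk using hk r hr
  · filter_upwards [hb i] with k hk x _ using hB1 _ hk x

end NetworkParams

/-! ### Convergence of both approximations to the average coverage probability -/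

namespace IsNetwork

variable {K : ℕ} {prm : NetworkParams K} {Ω : Type*} [MeasurableSpace Ω] {P : Measure Ω}
  [IsProbabilityMeasure P] {Φ : Fin K → Ω → Measure Plane}
  {Θ : Fin K → Zone → Ω → Measure (Plane × ℝ × Bool)} {G : Fin K → Ω → ℝ}

lemma tendsto_condCoverageClosed (hN : IsNetwork prm P Φ Θ G) (i : Fin K) {r : ℝ} (hr : 0 < r) :
    Tendsto (fun q : (ℕ × ℕ) × ℝ => prm.condCoverageClosed q.1.1 q.1.2 i q.2) (atTop ×ˢ 𝓝 r)
      (𝓝 (condCoverage prm P Θ G i r)) := by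
  rw [(hN.condCoverage_eq i hr).2]
  exact prm.tendsto_condCoverageClosed i tendsto_fst tendsto_snd hr

/-- Continuity in the distance comes for free from the continuous convergence of the closed form. -/
lemma continuousAt_condCoverage (hN : IsNetwork prm P Φ Θ G) (i : Fin K) {r : ℝ} (hr : 0 < r) :
    ContinuousAt (condCoverage prm P Θ G i) r := by
  refine ContinuousAt.of_tendsto_prod_nhds (l := (atTop : Filter (ℕ × ℕ)))
    (F := fun N => prm.condCoverageClosed N.1 N.2 i) ?_
  filter_upwards [Ioi_mem_nhds hr] with s hs
  exact hN.tendsto_condCoverageClosed i hs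

theorem tendsto_averageSum_condCoverage (hN : IsNetwork prm P Φ Θ G) :
    Tendsto (fun NL : ℕ => prm.averageSum NL (condCoverage prm P Θ G)) atTop
      (𝓝 (avgCoverage prm P Φ Θ G)) := by
  rw [hN.avgCoverage_eq]
  refine prm.tendsto_averageSum tendsto_id (c := 0)
    (fun i => mul_pos Real.pi_pos (prm.lam_pos i))
    (fun i r hr => (hN.continuousAt_condCoverage i hr).tendsto.comp tendsto_snd)
    fun i => Eventually.of_forall fun k r _ => ?_
  rw [zero_mul, Real.exp_zero, abs_of_nonneg (condCoverage_nonneg i r)]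
  exact condCoverage_le_one i r

theorem tendsto_averageSum_condCoverageClosed (hN : IsNetwork prm P Φ Θ G) :
    Tendsto (fun N : ℕ × ℕ => prm.averageSum N.2 (prm.condCoverageClosed N.1 N.2)) atTop
      (𝓝 (avgCoverage prm P Φ Θ G)) := by
  rw [hN.avgCoverage_eq]
  have hn : Tendsto (fun N : ℕ × ℕ => N.2) atTop atTop := by
    rw [← prod_atTop_atTop_eq]
    exact tendsto_snd
  have hL : 0 ≤ ∑ j, prm.lam j := Finset.sum_nonneg fun j _ => (prm.lam_pos j).le
  obtain ⟨m, hm, hml⟩ : ∃ m, 0 < m ∧ ∀ i, m ≤ prm.lam i := by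
    rcases isEmpty_or_nonempty (Fin K) with h | h
    · exact ⟨1, one_pos, fun i => h.elim i⟩
    · obtain ⟨i, hi⟩ := Finite.exists_min prm.lam
      exact ⟨prm.lam i, prm.lam_pos i, hi⟩
  -- The extra `1` makes `δ ∑ λ_j < m` strict, so that the growth rate `π δ ∑ λ_j` lies below `π
  -- λ_i` for every tier at once.
  set δ := m / (1 + ∑ j, prm.lam j) with hδ
  have hδ0 : 0 < δ := by positivity
  have hδm : δ * ∑ j, prm.lam j < m := by
    rw [hδ, div_mul_eq_mul_div, div_lt_iff₀ (by positivity)]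
    nlinarith
  refine prm.tendsto_averageSum hn (p := fun N i r => prm.condCoverageClosed N.1 N.2 i r)
    (c := Real.pi * δ * ∑ j, prm.lam j) (fun i => ?_)
    (fun i r hr => hN.tendsto_condCoverageClosed i hr)
    fun i => prm.eventually_condCoverageClosed_le i hδ0
  rw [mul_assoc]
  exact mul_lt_mul_of_pos_left (hδm.trans_le (hml i)) Real.pi_pos

end IsNetwork

theorem proposition1 {K : ℕ} (prm : NetworkParams K)
    {Ω : Type*} [MeasurableSpace Ω] (P : Measure Ω) [IsProbabilityMeasure P]
    (Φ : Fin K → Ω → Measure Plane) (Θ : Fin K → Zone → Ω → Measure (Plane × ℝ × Bool))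
    (G : Fin K → Ω → ℝ) (hN : IsNetwork prm P Φ Θ G) :
    -- `f_{R_i}` is the density of the serving distance of a user connected to tier `i`
    (∀ i, 0 < assocProb prm P Φ i ∧
      (P[|assocEvent prm Φ i]).map (nearestDist Φ i) =
        (volume.restrict (Set.Ioi 0)).withDensity
          (fun r => ENNReal.ofReal (servingDensity prm P Φ i r))) ∧
    -- averaging over the serving distance
    (∀ i, IntegrableOn (fun r => condCoverage prm P Θ G i r * servingDensity prm P Φ i r)
      (Set.Ioi 0)) ∧
    avgCoverage prm P Φ Θ G =
      ∑ i, assocProb prm P Φ i *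
        ∫ r in Set.Ioi 0, condCoverage prm P Θ G i r * servingDensity prm P Φ i r ∧
    -- Gauss–Legendre approximation of the average
    Tendsto (fun NL : ℕ => prm.averageSum NL (condCoverage prm P Θ G)) atTop
      (𝓝 (avgCoverage prm P Φ Θ G)) ∧
    -- the same with the closed-form conditional coverage probabilities
    Tendsto (fun N : ℕ × ℕ => prm.averageSum N.2 (prm.condCoverageClosed N.1 N.2)) atTop
      (𝓝 (avgCoverage prm P Φ Θ G)) := by
  refine ⟨fun i => ⟨hN.assocProb_pos i, hN.map_cond_assocEvent i⟩, fun i => ?_, ?_,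
    hN.tendsto_averageSum_condCoverage, hN.tendsto_averageSum_condCoverageClosed⟩
  · simp only [IsNetwork.servingDensity_eq, mul_left_comm _ (assocProb prm P Φ i)⁻¹]
    exact (hN.integrableOn_condCoverage_mul i).const_mul _
  -- The factor `P_{Ai}` cancels the normalisation of the serving density, since it is positive.
  · rw [hN.avgCoverage_eq]
    refine Finset.sum_congr rfl fun i _ => ?_
    simp only [IsNetwork.servingDensity_eq, mul_left_comm _ (assocProb prm P Φ i)⁻¹]
    rw [integral_const_mul, mul_inv_cancel_left₀ (hN.assocProb_pos i).ne']
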